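/- **Setting.** Let $(Y,m)$ be a probability space with a metric $d$ such that $\operatorname{diam} Y\le 1$, let $\alpha$ be an at most countable measurable partition of $Y$ (up to null sets), and let $F:Y\to Y$ be a nonsingular map that restricts to a measure-theoretic bijection from $a$ onto $Y$ for each $a\in\alpha$. Let $\zeta=\frac{dm}{dm\circ F}$ be the inverse Jacobian. Assume that there are constants $\lambda>1$, $K>0$, $\eta\in(0,1]$ such that for all $x,y$ in the same partition element $$d(Fx,Fy)\ge\lambda d(x,y),\qquad |\log\zeta(x)-\log\zeta(y)|\le K\,d(Fx,Fy)^\eta .$$ The measure $m$ is not assumed to be $F$-invariant. Let $\tau:Y\to\{1,2,\dots\}$ be integrable and constant on partition elements, let $\bar\tau=\int_Y\tau\,dm$, and define the Young tower $$\Delta=\{(y,\ell):y\in Y,\ 0\le\ell\le\tau(y)-1\},\qquad f(y,\ell)=\begin{cases}(y,\ell+1),&\ell\le\tau(y)-2,\\(Fy,0),&\ell=\tau(y)-1,\end{cases}$$ with the probability measure $m_\Delta(A\times\{\ell\})=\bar\tau^{-1}m(A)$ for measurable $A\subset\{\tau\ge\ell+1\}$, and the metric $d_\Delta((y,\ell),(y',\ell'))=d(y,y')$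 if $\ell=\ell'$ and $1$ otherwise. For $\phi:\Delta\to\mathbb R$ let $$|\phi|_\eta=\sup_{x\ne y}\frac{|\phi(x)-\phi(y)|}{d_\Delta(x,y)^\eta},\qquad \|\phi\|_\eta=|\phi|_\eta+\sup|\phi| .$$ Let $L:L^1(\Delta)\to L^1(\Delta)$ be the transfer operator of $f$ with respect to $m_\Delta$, that is, $\int_\Delta L\phi\,\psi\,dm_\Delta=\int_\Delta\phi\,\psi\circ f\,dm_\Delta$ for all $\phi\in L^1$, $\psi\in L^\infty$. Suppose that the tower is mixing, i.e. $\gcd\{\tau(a):a\in\alpha\}=1$. Equivalently, there are $\delta>0$ and a finite set $\{I_k\}$ of positive integers with $\gcd\{I_k\}=1$ such that $m(\tau=I_k)\ge\delta$ for every $k$; fix any such $\delta$ and $\{I_k\}$. **Theorem.** Let $\phi:\Delta\to\mathbb R$ be a measurable observable with $\|\phi\|_\eta<\infty$ and $\int_\Delta\phi\,dm_\Delta=0$. 1. Suppose that $m(\tau\ge n)\le C_\tau n^{-\beta}$ for some $\beta>1$ and all $n\ge1$. Then for all $n\ge1$ $$\int_\Delta|L^n\phi|\,dm_\Delta\le C\,\|\phi\|_\eta\,n^{-(\beta-1)},$$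 where $C>0$ is the value at $(\lambda,K,\eta,\max\{I_k\},\delta,\beta,C_\tau)$ of a continuous positive function that depends on nothing else. 2. Suppose that $m(\tau\ge n)\le C_\tau e^{-An^\gamma}$ for some $A>0$, $\gamma\in(0,1]$ and all $n\ge1$. Then for all $n\ge0$ $$\int_\Delta|L^n\phi|\,dm_\Delta\le C\,\|\phi\|_\eta\,e^{-Bn^\gamma},$$ where $B>0$ and $C>0$ are the values at $(\lambda,K,\eta,\max\{I_k\},\delta,A,\gamma,C_\tau)$ of continuous positive functions that depend on nothing else. -/

import Mathlib

open MeasureTheory Set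
open scoped ENNReal

universe u

namespace YoungTower

noncomputable section

/-! ### Uniformly expanding maps -/

/-- `F` restricts to a measure-theoretic bijection from `a` onto the whole space: it is injective
on `a`, it maps measurable subsets of `a` to measurable sets (up to null sets), and `F(a)` has
full measure. -/
structure IsFullBranch {Y : Type u} [MeasurableSpace Y] (m : Measure Y) (F : Y → Y)
    (a : Set Y) : Prop where
  injOn : InjOn F a
  nullMeasurableSet_image : ∀ E ⊆ a, MeasurableSet E → NullMeasurableSet (F '' E) m
  image_conull : m (F '' a)ᶜ = 0

/-- `ζ` is (a version of) the inverse Jacobian `dm / d(m ∘ F)` on the partition elements: it is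
positive there, and `m (F E) = ∫_E ζ⁻¹ dm` for measurable `E` contained in a partition element. -/
structure IsInverseJacobian {Y : Type u} [MeasurableSpace Y] (m : Measure Y) (F : Y → Y)
    (α : Set (Set Y)) (ζ : Y → ℝ) : Prop where
  measurable : Measurable ζ
  pos : ∀ a ∈ α, ∀ x ∈ a, 0 < ζ x
  measure_image : ∀ a ∈ α, ∀ E ⊆ a, MeasurableSet E →
    m (F '' E) = ∫⁻ x in E, ENNReal.ofReal (ζ x)⁻¹ ∂m

/-- `F` is a uniformly expanding map with full branches, with respect to the probability measure
`m`, the at most countable measurable partition `α` (a partition up to a null set), and the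
constants `lam > 1`, `K > 0`, `η ∈ (0, 1]`. The measure `m` need not be `F`-invariant. -/
structure IsUniformlyExpanding {Y : Type u} [MetricSpace Y] [MeasurableSpace Y] (m : Measure Y)
    (F : Y → Y) (α : Set (Set Y)) (lam K η : ℝ) : Prop where
  one_lt_lam : 1 < lam
  K_pos : 0 < K
  η_pos : 0 < η
  η_le_one : η ≤ 1
  isProbabilityMeasure : IsProbabilityMeasure m
  diam_le_one : ∀ x y : Y, dist x y ≤ 1
  nonsingular : Measure.QuasiMeasurePreserving F m m
  countable : α.Countable
  measurableSet : ∀ a ∈ α, MeasurableSet a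
  pairwiseDisjoint : α.PairwiseDisjoint id
  cover : m (⋃₀ α)ᶜ = 0
  fullBranch : ∀ a ∈ α, IsFullBranch m F a
  expansion : ∀ a ∈ α, ∀ x ∈ a, ∀ y ∈ a, lam * dist x y ≤ dist (F x) (F y)
  distortion : ∃ ζ : Y → ℝ, IsInverseJacobian m F α ζ ∧
    ∀ a ∈ α, ∀ x ∈ a, ∀ y ∈ a,
      |Real.log (ζ x) - Real.log (ζ y)| ≤ K * dist (F x) (F y) ^ η

/-! ### Young towers -/

/-- `τ : Y → {1, 2, …}` is integrable and constant on partition elements. -/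
structure IsReturnTime {Y : Type u} [MeasurableSpace Y] (m : Measure Y) (α : Set (Set Y))
    (τ : Y → ℕ) : Prop where
  pos : ∀ y, 0 < τ y
  measurable : Measurable τ
  integrable : Integrable (fun y => (τ y : ℝ)) m
  const : ∀ a ∈ α, ∀ x ∈ a, ∀ y ∈ a, τ x = τ y

/-- The tower `Δ = {(y, ℓ) : 0 ≤ ℓ ≤ τ y - 1}`. -/
abbrev Tower {Y : Type u} (τ : Y → ℕ) : Type u := {p : Y × ℕ // p.2 < τ p.1}

/-- The tower map: `(y, ℓ) ↦ (y, ℓ + 1)` if `ℓ ≤ τ y - 2` and `(y, τ y - 1) ↦ (F y, 0)`. -/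
def towerMap {Y : Type u} (F : Y → Y) (τ : Y → ℕ) (hτ : ∀ y, 0 < τ y) (x : Tower τ) : Tower τ :=
  if h : x.1.2 + 1 < τ x.1.1 then ⟨(x.1.1, x.1.2 + 1), h⟩ else ⟨(F x.1.1, 0), hτ _⟩

/-- The measure `m_Δ` with `m_Δ (A × {ℓ}) = m A / ∫ τ dm`. -/
def towerMeasure {Y : Type u} [MeasurableSpace Y] (m : Measure Y) (τ : Y → ℕ) :
    Measure (Tower τ) :=
  (ENNReal.ofReal (∫ y, (τ y : ℝ) ∂m))⁻¹ •
    (m.prod Measure.count).comap (Subtype.val : Tower τ → Y × ℕ)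

/-- The distance `d_Δ` on the tower. -/
def towerDist {Y : Type u} [MetricSpace Y] (τ : Y → ℕ) (x x' : Tower τ) : ℝ :=
  if x.1.2 = x'.1.2 then dist x.1.1 x'.1.1 else 1

/-- The Hölder seminorm `|φ|_η` with respect to `d_Δ`, with values in `[0, ∞]`. -/
def holderSeminorm {Y : Type u} [MetricSpace Y] (τ : Y → ℕ) (η : ℝ) (φ : Tower τ → ℝ) : ℝ≥0∞ :=
  ⨆ (x : Tower τ) (x' : Tower τ) (_ : x ≠ x'),
    ENNReal.ofReal (|φ x - φ x'| / towerDist τ x x' ^ η)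

/-- The Hölder norm `‖φ‖_η = |φ|_η + |φ|_∞`, with values in `[0, ∞]`. -/
def holderNorm {Y : Type u} [MetricSpace Y] (τ : Y → ℕ) (η : ℝ) (φ : Tower τ → ℝ) : ℝ≥0∞ :=
  holderSeminorm τ η φ + ⨆ x : Tower τ, ENNReal.ofReal |φ x|

/-- The data of a mixing tower: `δ > 0` and a finite set `I` of positive integers with greatest
common divisor `1` such that `m (τ = i) ≥ δ` for all `i ∈ I`. -/
structure IsMixingData {Y : Type u} [MeasurableSpace Y] (m : Measure Y) (τ : Y → ℕ)
    (I : Finset ℕ) (δ : ℝ) : Prop where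
  δ_pos : 0 < δ
  pos : ∀ i ∈ I, 0 < i
  gcd_eq_one : I.gcd id = 1
  le_measure : ∀ i ∈ I, δ ≤ m.real {y | τ y = i}

/-- The tower is mixing: the greatest common divisor of the values of `τ` on the partition
elements is `1`. -/
def IsMixing {Y : Type u} (α : Set (Set Y)) (τ : Y → ℕ) : Prop :=
  ∀ d : ℕ, (∀ a ∈ α, ∀ y ∈ a, d ∣ τ y) → d = 1

/-- A tower is mixing if and only if it admits mixing data. -/
theorem isMixing_iff_exists_isMixingData {Y : Type u} [MetricSpace Y] [MeasurableSpace Y]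
    {m : Measure Y} {F : Y → Y} {α : Set (Set Y)} {lam K η : ℝ} {τ : Y → ℕ}
    (hF : IsUniformlyExpanding m F α lam K η) (hτ : IsReturnTime m α τ) :
    IsMixing α τ ↔ ∃ (I : Finset ℕ) (δ : ℝ), IsMixingData m τ I δ := by
  have hprob := hF.isProbabilityMeasure
  constructor
  · intro hmix
    have hpos : ∀ a ∈ α, m a ≠ 0 := by
      intro a ha h0
      obtain ⟨ζ, hζ, -⟩ := hF.distortion
      have h1 := hζ.measure_image a ha a subset_rfl (hF.measurableSet a ha)
      rw [Measure.restrict_eq_zero.2 h0, lintegral_zero_measure] at h1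
      have h2 : m univ ≤ m (F '' a) + m (F '' a)ᶜ := by
        rw [← union_compl_self (F '' a)]; exact measure_union_le _ _
      rw [h1, (hF.fullBranch a ha).image_conull, measure_univ] at h2
      simp at h2
    have hstep : ∃ I : Finset ℕ, (∀ i ∈ I, ∃ a ∈ α, ∃ y ∈ a, τ y = i) ∧ I.Nonempty ∧
        ∀ J : Finset ℕ, (∀ i ∈ J, ∃ a ∈ α, ∃ y ∈ a, τ y = i) → J.Nonempty →
          I.gcd id ≤ J.gcd id := by
      have hne : ∃ a ∈ α, ∃ y, y ∈ a := by
        by_contra! h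
        exact absurd (hmix 0 fun a ha y hy => absurd hy (h a ha y)) (by norm_num)
      obtain ⟨a, ha, y, hy⟩ := hne
      have hex : ∃ g : ℕ, ∃ I : Finset ℕ, (∀ i ∈ I, ∃ a ∈ α, ∃ y ∈ a, τ y = i) ∧
          I.Nonempty ∧ I.gcd id = g :=
        ⟨_, {τ y}, by simpa using ⟨a, ha, y, hy, rfl⟩, by simp, rfl⟩
      classical
      obtain ⟨I, hI, hI', hg⟩ := Nat.find_spec hex
      exact ⟨I, hI, hI', fun J hJ hJ' => hg ▸ Nat.find_min' hex ⟨J, hJ, hJ', rfl⟩⟩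
    obtain ⟨I, hI, hI', hmin⟩ := hstep
    have hIpos : ∀ i ∈ I, 0 < i := by
      intro i hi
      obtain ⟨a, ha, y, hy, rfl⟩ := hI i hi
      exact hτ.pos y
    have hgcd : I.gcd id = 1 := by
      refine hmix _ fun a ha y hy => ?_
      have h := hmin (insert (τ y) I) (by
        intro i hi
        rcases Finset.mem_insert.1 hi with rfl | hi
        · exact ⟨a, ha, y, hy, rfl⟩
        · exact hI i hi) (Finset.insert_nonempty _ _)
      rw [Finset.gcd_insert] at h
      have hgpos : 0 < I.gcd id := by
        obtain ⟨i, hi⟩ := hI'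
        exact Nat.pos_of_dvd_of_pos (Finset.gcd_dvd hi) (hIpos i hi)
      have h' : Nat.gcd (τ y) (I.gcd id) = I.gcd id :=
        le_antisymm (Nat.gcd_le_right _ hgpos) h
      exact Nat.gcd_eq_right_iff_dvd.1 h'
    refine ⟨I, I.inf' hI' fun i => m.real {y | τ y = i}, ?_, hIpos, hgcd, fun i hi =>
      Finset.inf'_le _ hi⟩
    rw [Finset.lt_inf'_iff]
    intro i hi
    obtain ⟨a, ha, y, hy, rfl⟩ := hI i hi
    refine ENNReal.toReal_pos (fun h0 => hpos a ha ?_) (measure_ne_top _ _)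
    exact measure_mono_null (fun x hx => hτ.const a ha x hx y hy) h0
  · rintro ⟨I, δ, h⟩ d hd
    have hdvd : d ∣ I.gcd id := by
      refine Finset.dvd_gcd fun i hi => ?_
      by_contra hn
      have h0 : m {y | τ y = i} = 0 := by
        refine measure_mono_null (fun y hy => ?_) hF.cover
        rintro ⟨a, ha, hya⟩
        have hy' : τ y = i := hy
        exact hn (hy' ▸ hd a ha y hya)
      have h1 := h.le_measure i hi
      rw [Measure.real, h0] at h1
      exact absurd h.δ_pos (by simpa using h1)
    rw [h.gcd_eq_one] at hdvd
    exact Nat.dvd_one.1 hdvd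

/-! ### The transfer operator -/

/-- The transfer operator of a nonsingular map `f` with respect to `μ`: for integrable `φ`,
`transferOperator μ f φ` is the density with respect to `μ` of the push-forward under `f` of the
signed measure `φ μ` (treating the positive and the negative part of `φ` separately). -/
def transferOperator {X : Type u} [MeasurableSpace X] (μ : Measure X) (f : X → X) (φ : X → ℝ) :
    X → ℝ := fun x =>
  (((μ.withDensity fun z => ENNReal.ofReal (φ z)).map f).rnDeriv μ x).toReal -
    (((μ.withDensity fun z => ENNReal.ofReal (-φ z)).map f).rnDeriv μ x).toReal

/-- The duality that characterizes the transfer operator (up to null sets). -/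
theorem integral_transferOperator_mul {X : Type u} [MeasurableSpace X] {μ : Measure X}
    [IsFiniteMeasure μ] {f : X → X} (hf : Measure.QuasiMeasurePreserving f μ μ) {φ : X → ℝ}
    (hφ : Integrable φ μ) {ψ : X → ℝ} (hψ : Measurable ψ) {c : ℝ} (hc : ∀ x, |ψ x| ≤ c) :
    Integrable (transferOperator μ f φ) μ ∧
      ∫ x, transferOperator μ f φ x * ψ x ∂μ = ∫ x, φ x * ψ (f x) ∂μ := by
  have key : ∀ g : X → ℝ, Integrable g μ →
      Integrable (fun x =>
        (((μ.withDensity fun z => ENNReal.ofReal (g z)).map f).rnDeriv μ x).toReal) μ ∧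
      ∫ x, (((μ.withDensity fun z => ENNReal.ofReal (g z)).map f).rnDeriv μ x).toReal * ψ x ∂μ
        = ∫ x, max (g x) 0 * ψ (f x) ∂μ := by
    intro g hg
    have hfin : IsFiniteMeasure (μ.withDensity fun z => ENNReal.ofReal (g z)) :=
      isFiniteMeasure_withDensity_ofReal hg.2
    have hac : (μ.withDensity fun z => ENNReal.ofReal (g z)).map f ≪ μ :=
      ((withDensity_absolutelyContinuous _ _).map hf.measurable).trans hf.absolutelyContinuous
    refine ⟨Measure.integrable_toReal_rnDeriv, ?_⟩
    have h1 := integral_rnDeriv_smul (f := ψ) hac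
    simp only [smul_eq_mul] at h1
    rw [h1, integral_map hf.measurable.aemeasurable hψ.aestronglyMeasurable,
      integral_withDensity_eq_integral_toReal_smul₀ hg.1.aemeasurable.ennreal_ofReal
        (Filter.Eventually.of_forall fun _ => ENNReal.ofReal_lt_top)]
    simp only [ENNReal.toReal_ofReal', smul_eq_mul]
  obtain ⟨i1, e1⟩ := key φ hφ
  obtain ⟨i2, e2⟩ := key (fun x => -φ x) hφ.neg
  have hb : ∀ᵐ x ∂μ, ‖ψ x‖ ≤ c := Filter.Eventually.of_forall hc
  have hb' : ∀ᵐ x ∂μ, ‖ψ (f x)‖ ≤ c := Filter.Eventually.of_forall fun x => hc (f x)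
  have hm' : AEStronglyMeasurable (fun x => ψ (f x)) μ :=
    (hψ.comp hf.measurable).aestronglyMeasurable
  refine ⟨i1.sub i2, ?_⟩
  simp only [transferOperator, sub_mul]
  rw [integral_sub (i1.mul_bdd hψ.aestronglyMeasurable hb)
    (i2.mul_bdd hψ.aestronglyMeasurable hb), e1, e2,
    ← integral_sub (hφ.pos_part.mul_bdd hm' hb') (hφ.neg_part.mul_bdd hm' hb')]
  refine integral_congr_ae (Filter.Eventually.of_forall fun x => ?_)
  rcases le_total 0 (φ x) with h | h <;> simp [h]

/-! ### The parameters on which the constants depend -/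

/-- Parameters `(lam, K, η, max I, δ, β, Cτ)` for polynomial tails. -/
def polyParams : Set (ℝ × ℝ × ℝ × ℕ × ℝ × ℝ × ℝ) :=
  {(lam, K, η, _, δ, β, Cτ) : ℝ × ℝ × ℝ × ℕ × ℝ × ℝ × ℝ |
    1 < lam ∧ 0 < K ∧ 0 < η ∧ η ≤ 1 ∧ 0 < δ ∧ 1 < β ∧ 0 < Cτ}

/-- Parameters `(lam, K, η, max I, δ, A, γ, Cτ)` for (stretched) exponential tails. -/
def expParams : Set (ℝ × ℝ × ℝ × ℕ × ℝ × ℝ × ℝ × ℝ) :=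
  {(lam, K, η, _, δ, A, γ, Cτ) : ℝ × ℝ × ℝ × ℕ × ℝ × ℝ × ℝ × ℝ |
    1 < lam ∧ 0 < K ∧ 0 < η ∧ η ≤ 1 ∧ 0 < δ ∧ 0 < A ∧ 0 < γ ∧ γ ≤ 1 ∧ 0 < Cτ}

end

end YoungTower

/-! The argument is a coupling, run as an induction on rates instead of a construction of a joint
process. A measure on the base is regular if the logarithm of its density is `η`-Hölder with
constant `R`. Bounded distortion and expansion make `F` improve `R` to some `R' < R`
(`IsCellRegular.map`). The gap between the two constants is what allows a fixed multiple of `m` to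
be subtracted from a freshly returned measure while the remainder stays regular
(`IsRegular.exists_sub`). On the tower the corresponding invariant class consists of the measures
whose pieces of given residual time arrive at the base as regular measures (`IsAdmissible.map`).
Since the return times generate all large integers, and residual times have uniformly small tails,
every evolved regular measure has, from some time `M` on, a definite part of its mass on the base at
every instant. Hence any two such measures of equal mass share a fraction `c`, a multiple of `m` on
the base (`IsRegular.exists_evolve_eq_add`). The shared part cancels. The two remainders are split
by residual time, their pieces are paired by product weights, and each pair is compared once both
pieces have returned and run `M` further steps. If `T` bounds the residual tails, memory is
therefore lost at any antitone rate `D` with `1 ≤ D 0` that satisfies, whenever `D n < 1`, the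
renewal-type inequality `(1 - c) * D (n - M) + 2 * ∑ k, T k * (D (n - M - (k + 1)) - D (n - M - k))
≤ D n`, the sum running over `k < n - M`; this is a strong induction (`losesMemory`). A mean-zero
observable, scaled and shifted to a positive density, is the difference of two admissible
probability measures, so the `L¹` norm of its iterates is at most a multiple of `D n`
(`integral_abs_iterate_transferOperator_le`). Explicit polynomial and stretched exponential
sequences solve the inequality (`exists_polynomial_rate`, `exists_exponential_rate`). All constants
are uniform near each parameter, and a partition of unity makes them continuous. -/

namespace YoungTower

/-! ### Measures on the base with log-Hölder densities -/

section Base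

/-- Both sides are of order `t` on `[0, 1]`: the left exponential is bounded above by `R * t * exp
R`, the right difference below by `(R - R') * t`. The ratio of these bounds is the fraction of a
density that can be removed at the cost of raising `R'` to `R`. -/
theorem exp_sub_bound {R R' t : ℝ} (hR' : 0 ≤ R') (hR : R' < R) (ht : 0 ≤ t) (ht1 : t ≤ 1) :
    (R - R') / (R * Real.exp R) * (Real.exp (R * t) - 1) ≤
      Real.exp (R * t) - Real.exp (R' * t) := by
  have hRp : 0 < R := hR'.trans_lt hR
  have h1 : Real.exp (R * t) - 1 ≤ R * t * Real.exp R := by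
    have h := Real.add_one_le_exp (-(R * t))
    have h2 : Real.exp (R * t) * Real.exp (-(R * t)) = 1 := by rw [← Real.exp_add]; simp
    have h3 : Real.exp (R * t) ≤ Real.exp R :=
      Real.exp_le_exp.2 (mul_le_of_le_one_right hRp.le ht1)
    have h4 := mul_le_mul_of_nonneg_left h (Real.exp_pos (R * t)).le
    have h5 := mul_le_mul_of_nonneg_left h3 (mul_nonneg hRp.le ht)
    nlinarith
  have h2 : (R - R') * t ≤ Real.exp (R * t) - Real.exp (R' * t) := by
    have h := Real.add_one_le_exp ((R - R') * t)
    have h3 : Real.exp (R * t) = Real.exp (R' * t) * Real.exp ((R - R') * t) := by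
      rw [← Real.exp_add]; ring_nf
    have h4 : 1 ≤ Real.exp (R' * t) := Real.one_le_exp (mul_nonneg hR' ht)
    have h5 : 0 ≤ (R - R') * t := mul_nonneg (sub_pos.2 hR).le ht
    rw [h3]
    nlinarith
  refine le_trans ?_ h2
  calc _ ≤ (R - R') / (R * Real.exp R) * (R * t * Real.exp R) := by
        gcongr
    _ = _ := by field_simp

variable {Y : Type*} [MetricSpace Y] {η R R' : ℝ}

/-- `log ρ` is Hölder on `s` with exponent `η` and constant `R`. -/
def IsLogHolderOn (η R : ℝ) (ρ : Y → ℝ≥0∞) (s : Set Y) : Prop :=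
  ∀ x ∈ s, ∀ y ∈ s, ρ x ≤ ENNReal.ofReal (Real.exp (R * dist x y ^ η)) * ρ y

theorem IsLogHolderOn.mono {ρ : Y → ℝ≥0∞} {s t : Set Y} (h : IsLogHolderOn η R ρ t)
    (hs : s ⊆ t) : IsLogHolderOn η R ρ s :=
  fun x hx y hy => h x (hs hx) y (hs hy)

theorem IsLogHolderOn.congr {ρ ρ' : Y → ℝ≥0∞} {s : Set Y} (h : IsLogHolderOn η R ρ s)
    (hs : EqOn ρ ρ' s) : IsLogHolderOn η R ρ' s :=
  fun x hx y hy => by rw [← hs hx, ← hs hy]; exact h x hx y hy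

theorem IsLogHolderOn.mono_const {ρ : Y → ℝ≥0∞} {s : Set Y} (h : IsLogHolderOn η R ρ s)
    (hR : R ≤ R') : IsLogHolderOn η R' ρ s := fun x hx y hy => by
  refine (h x hx y hy).trans ?_
  gcongr

theorem IsLogHolderOn.add {ρ ρ' : Y → ℝ≥0∞} {s : Set Y} (h : IsLogHolderOn η R ρ s)
    (h' : IsLogHolderOn η R ρ' s) : IsLogHolderOn η R (fun x => ρ x + ρ' x) s :=
  fun x hx y hy => by
    rw [mul_add]
    exact add_le_add (h x hx y hy) (h' x hx y hy)

theorem IsLogHolderOn.tsum {ι : Type*} {ρ : ι → Y → ℝ≥0∞} {s : Set Y}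
    (h : ∀ i, IsLogHolderOn η R (ρ i) s) : IsLogHolderOn η R (fun x => ∑' i, ρ i x) s :=
  fun x hx y hy => by
    rw [← ENNReal.tsum_mul_left]
    exact ENNReal.tsum_le_tsum fun i => h i x hx y hy

theorem IsLogHolderOn.const_mul {ρ : Y → ℝ≥0∞} {s : Set Y} (c : ℝ≥0∞)
    (h : IsLogHolderOn η R ρ s) : IsLogHolderOn η R (fun x => c * ρ x) s :=
  fun x hx y hy => by
    rw [mul_left_comm]
    exact mul_le_mul_right (h x hx y hy) c

theorem rpow_dist_le_one (hη : 0 < η) (hd : ∀ x y : Y, dist x y ≤ 1) (x y : Y) :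
    dist x y ^ η ≤ 1 :=
  Real.rpow_le_one dist_nonneg (hd x y) hη.le

variable [MeasurableSpace Y] {m : Measure Y} {α : Set (Set Y)}

/-- `ν` has a density whose logarithm is Hölder on a conull set. -/
def IsRegular (m : Measure Y) (η R : ℝ) (ν : Measure Y) : Prop :=
  ∃ ρ : Y → ℝ≥0∞, Measurable ρ ∧ ν = m.withDensity ρ ∧ ∃ G ∈ ae m, IsLogHolderOn η R ρ G

/-- `ν` has a density whose logarithm is Hölder on each partition element, off a null set. -/
def IsCellRegular (m : Measure Y) (α : Set (Set Y)) (η R : ℝ) (ν : Measure Y) : Prop :=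
  ∃ ρ : Y → ℝ≥0∞, Measurable ρ ∧ ν = m.withDensity ρ ∧
    ∃ G ∈ ae m, ∀ a ∈ α, IsLogHolderOn η R ρ (G ∩ a)

theorem IsRegular.of_aemeasurable {ρ : Y → ℝ≥0∞} (hρ : AEMeasurable ρ m) {G : Set Y}
    (hG : G ∈ ae m) (h : IsLogHolderOn η R ρ G) : IsRegular m η R (m.withDensity ρ) := by
  refine ⟨hρ.mk ρ, hρ.measurable_mk, withDensity_congr_ae hρ.ae_eq_mk,
    G ∩ {x | ρ x = hρ.mk ρ x}, Filter.inter_mem hG hρ.ae_eq_mk, ?_⟩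
  exact (h.mono inter_subset_left).congr fun x hx => hx.2

theorem IsRegular.mono {ν : Measure Y} (h : IsRegular m η R ν) (hR : R ≤ R') :
    IsRegular m η R' ν := by
  obtain ⟨ρ, hρ, e, G, hG, h⟩ := h
  exact ⟨ρ, hρ, e, G, hG, h.mono_const hR⟩

theorem IsRegular.smul {ν : Measure Y} (h : IsRegular m η R ν) (c : ℝ≥0∞) :
    IsRegular m η R (c • ν) := by
  obtain ⟨ρ, hρ, rfl, G, hG, h⟩ := h
  refine ⟨fun x => c * ρ x, hρ.const_mul c, ?_, G, hG, h.const_mul c⟩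
  rw [← withDensity_smul c hρ]
  rfl

theorem IsRegular.add {ν ν' : Measure Y} (h : IsRegular m η R ν) (h' : IsRegular m η R ν') :
    IsRegular m η R (ν + ν') := by
  obtain ⟨ρ, hρ, rfl, G, hG, h⟩ := h
  obtain ⟨ρ', hρ', rfl, G', hG', h'⟩ := h'
  exact ⟨fun x => ρ x + ρ' x, hρ.add hρ', (withDensity_add_left hρ _).symm, G ∩ G',
    Filter.inter_mem hG hG', (h.mono inter_subset_left).add (h'.mono inter_subset_right)⟩

theorem isRegular_self (hR : 0 ≤ R) : IsRegular m η R m := by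
  refine ⟨1, measurable_one, withDensity_one.symm, univ, Filter.univ_mem, fun x _ y _ => ?_⟩
  simp only [Pi.one_apply, mul_one, ENNReal.one_le_ofReal]
  exact Real.one_le_exp (mul_nonneg hR (Real.rpow_nonneg dist_nonneg _))

theorem IsRegular.isCellRegular {ν : Measure Y} (h : IsRegular m η R ν) :
    IsCellRegular m α η R ν := by
  obtain ⟨ρ, hρ, e, G, hG, h⟩ := h
  exact ⟨ρ, hρ, e, G, hG, fun a _ => h.mono inter_subset_left⟩

/-- Cutting along a union of cells destroys regularity across cells but not inside them. This is the
purpose of the cellwise notion; the full branches of `F` later restore the global one. -/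
theorem IsCellRegular.restrict {ν : Measure Y} (h : IsCellRegular m α η R ν) {s : Set Y}
    (hs : MeasurableSet s) (hα : ∀ a ∈ α, ∀ x ∈ a, ∀ y ∈ a, x ∈ s → y ∈ s) :
    IsCellRegular m α η R (ν.restrict s) := by
  obtain ⟨ρ, hρ, rfl, G, hG, h⟩ := h
  refine ⟨s.indicator ρ, hρ.indicator hs, ?_, G, hG, fun a ha x hx y hy => ?_⟩
  · rw [restrict_withDensity hs, withDensity_indicator hs]
  · by_cases hxs : x ∈ s
    · rw [indicator_of_mem hxs, indicator_of_mem (hα a ha x hx.2 y hy.2 hxs)]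
      exact h a ha x hx y hy
    · simp [hxs]

/-- A log-Hölder density is comparable to its mean. -/
theorem IsLogHolderOn.le_mean [IsProbabilityMeasure m] (hη : 0 < η) (hR : 0 ≤ R)
    (hd : ∀ x y : Y, dist x y ≤ 1) {ρ : Y → ℝ≥0∞} {G : Set Y} (hG : G ∈ ae m)
    (h : IsLogHolderOn η R ρ G) {x : Y} (hx : x ∈ G) :
    ρ x ≤ ENNReal.ofReal (Real.exp R) * ∫⁻ y, ρ y ∂m ∧
      ∫⁻ y, ρ y ∂m ≤ ENNReal.ofReal (Real.exp R) * ρ x := by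
  have key : ∀ x ∈ G, ∀ y ∈ G, ρ x ≤ ENNReal.ofReal (Real.exp R) * ρ y := fun x hx y hy => by
    refine (h x hx y hy).trans ?_
    gcongr
    exact mul_le_of_le_one_right hR (rpow_dist_le_one hη hd x y)
  constructor
  · rw [← lintegral_const_mul' _ _ ENNReal.ofReal_ne_top]
    calc ρ x = ∫⁻ _, ρ x ∂m := by simp
      _ ≤ _ := lintegral_mono_ae (Filter.mem_of_superset hG fun y hy => key x hx y hy)
  · calc ∫⁻ y, ρ y ∂m ≤ ∫⁻ _, ENNReal.ofReal (Real.exp R) * ρ x ∂m :=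
          lintegral_mono_ae (Filter.mem_of_superset hG fun y hy => key y hy x hx)
      _ = _ := by simp

theorem IsRegular.apply_le [IsProbabilityMeasure m] (hη : 0 < η) (hR : 0 ≤ R)
    (hd : ∀ x y : Y, dist x y ≤ 1) {ν : Measure Y} (h : IsRegular m η R ν) {s : Set Y}
    (hs : MeasurableSet s) : ν s ≤ ENNReal.ofReal (Real.exp R) * ν univ * m s := by
  obtain ⟨ρ, hρ, rfl, G, hG, h⟩ := h
  rw [withDensity_apply _ hs, withDensity_apply _ MeasurableSet.univ, Measure.restrict_univ]
  calc ∫⁻ x in s, ρ x ∂m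
      ≤ ∫⁻ _ in s, ENNReal.ofReal (Real.exp R) * ∫⁻ y, ρ y ∂m ∂m :=
        lintegral_mono_ae (ae_restrict_of_ae
          (Filter.mem_of_superset hG fun x hx => (h.le_mean hη hR hd hG hx).1))
    _ = _ := by simp

theorem IsRegular.le_apply [IsProbabilityMeasure m] (hη : 0 < η) (hR : 0 ≤ R)
    (hd : ∀ x y : Y, dist x y ≤ 1) {ν : Measure Y} (h : IsRegular m η R ν) {s : Set Y}
    (hs : MeasurableSet s) : ν univ * m s ≤ ENNReal.ofReal (Real.exp R) * ν s := by
  obtain ⟨ρ, hρ, rfl, G, hG, h⟩ := h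
  rw [withDensity_apply _ hs, withDensity_apply _ MeasurableSet.univ, Measure.restrict_univ,
    ← lintegral_const_mul' _ _ ENNReal.ofReal_ne_top]
  calc _ = ∫⁻ _ in s, ∫⁻ y, ρ y ∂m ∂m := by simp
    _ ≤ _ := lintegral_mono_ae (ae_restrict_of_ae
          (Filter.mem_of_superset hG fun x hx => (h.le_mean hη hR hd hG hx).2))

/-- A multiple of `m` can be subtracted from a regular measure at the expense of the constant. -/
theorem IsRegular.exists_sub [IsProbabilityMeasure m] (hη : 0 < η) (hR' : 0 ≤ R') (hR : R' < R)
    (hd : ∀ x y : Y, dist x y ≤ 1) {ν : Measure Y} [IsFiniteMeasure ν] (h : IsRegular m η R' ν)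
    {c : ℝ≥0∞}
    (hc : c ≤ ENNReal.ofReal (Real.exp (-R') * ((R - R') / (R * Real.exp R))) * ν univ) :
    ∃ ν', IsRegular m η R ν' ∧ ν = ν' + c • m := by
  obtain ⟨ρ, hρ, rfl, G, hG, h⟩ := h
  have hfin : ∫⁻ y, ρ y ∂m ≠ ∞ := by
    have := measure_ne_top (m.withDensity ρ) univ
    rwa [withDensity_apply _ MeasurableSet.univ, Measure.restrict_univ] at this
  rw [withDensity_apply _ MeasurableSet.univ, Measure.restrict_univ] at hc
  have hRp : 0 < R := hR'.trans_lt hR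
  set κ := (R - R') / (R * Real.exp R) with hκ
  have hκ0 : 0 ≤ κ := div_nonneg (sub_pos.2 hR).le (by positivity)
  have hκ1 : κ ≤ 1 := by
    rw [hκ, div_le_one (by positivity)]
    nlinarith [Real.one_le_exp hRp.le]
  -- The mean of `ρ` is at most `exp R' * ρ x`; the factor `exp (-R')` in the bound on `c` cancels
  -- this.
  have hcρ : ∀ x ∈ G, c ≤ ENNReal.ofReal κ * ρ x := fun x hx => by
    have h1 := (h.le_mean hη hR' hd hG hx).2
    refine hc.trans ?_
    calc _ ≤ ENNReal.ofReal (Real.exp (-R') * κ) * (ENNReal.ofReal (Real.exp R') * ρ x) := by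
          gcongr
      _ = _ := by
        rw [← mul_assoc, ← ENNReal.ofReal_mul (by positivity)]
        congr 2
        rw [mul_right_comm, ← Real.exp_add]
        simp
  have hcle : ∀ x ∈ G, c ≤ ρ x := fun x hx => (hcρ x hx).trans
    (mul_le_of_le_one_left (zero_le) (by simpa using ENNReal.ofReal_le_ofReal hκ1))
  have hρfin : ∀ x ∈ G, ρ x ≠ ∞ := fun x hx =>
    ((h.le_mean hη hR' hd hG hx).1.trans_lt
      (ENNReal.mul_lt_top ENNReal.ofReal_lt_top hfin.lt_top)).ne
  refine ⟨m.withDensity fun x => ρ x - c, ⟨_, hρ.sub_const c, rfl, G, hG, ?_⟩, ?_⟩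
  · intro x hx y hy
    beta_reduce
    have hcfin : c ≠ ∞ := ((hcle x hx).trans_lt (hρfin x hx).lt_top).ne
    have h1 := h x hx y hy
    have h2 := hcle x hx
    have h3 := hcle y hy
    have h4 := hcρ y hy
    generalize ρ x = p at *
    have hp := hρfin y hy
    generalize ρ y = q at *
    have hpf : p ≠ ∞ := (h1.trans_lt (ENNReal.mul_lt_top ENNReal.ofReal_lt_top hp.lt_top)).ne
    lift p to NNReal using hpf
    lift q to NNReal using hp
    lift c to NNReal using hcfin
    have ht0 : 0 ≤ dist x y ^ η := Real.rpow_nonneg dist_nonneg _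
    have ht1 := rpow_dist_le_one hη hd x y
    generalize dist x y ^ η = t at *
    have e1 : (p : ℝ) ≤ Real.exp (R' * t) * q := by
      have := ENNReal.toReal_mono (ENNReal.mul_ne_top ENNReal.ofReal_ne_top ENNReal.coe_ne_top) h1
      simpa [ENNReal.toReal_mul, ENNReal.toReal_ofReal (Real.exp_pos _).le] using this
    have e2 : (c : ℝ) ≤ κ * q := by
      have := ENNReal.toReal_mono (ENNReal.mul_ne_top ENNReal.ofReal_ne_top ENNReal.coe_ne_top) h4
      simpa [ENNReal.toReal_mul, ENNReal.toReal_ofReal hκ0] using this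
    have e3 := exp_sub_bound hR' hR ht0 ht1
    rw [← hκ] at e3
    have e4 : 0 ≤ Real.exp (R * t) - 1 := sub_nonneg.2 (Real.one_le_exp (mul_nonneg hRp.le ht0))
    -- After inserting `p ≤ exp (R' * t) * q`, the claim becomes `c * (exp (R * t) - 1) ≤ (exp (R *
    -- t) - exp (R' * t)) * q`, which follows from `c ≤ κ * q` and `exp_sub_bound`.
    have e5 : (p : ℝ) - c ≤ Real.exp (R * t) * (q - c) := by
      have := mul_le_mul_of_nonneg_right e2 e4
      have := mul_le_mul_of_nonneg_right e3 q.2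
      nlinarith [q.2]
    have h2' : c ≤ p := by exact_mod_cast h2
    have h3' : c ≤ q := by exact_mod_cast h3
    rw [← ENNReal.coe_sub, ← ENNReal.coe_sub, ENNReal.ofReal, ← ENNReal.coe_mul, ENNReal.coe_le_coe,
      ← NNReal.coe_le_coe]
    push_cast [h2', h3', Real.coe_toNNReal _ (Real.exp_pos _).le]
    exact e5
  · have hae : ρ =ᵐ[m] fun x => (ρ x - c) + c :=
      Filter.mem_of_superset hG fun x hx => (tsub_add_cancel_of_le (hcle x hx)).symm
    rw [← withDensity_const, ← withDensity_add_left (hρ.sub_const c)]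
    exact withDensity_congr_ae hae

end Base

end YoungTower

namespace YoungTower

/-! ### Push-forward of densities by the expanding map -/

section PushForward

variable {Y : Type u} [MeasurableSpace Y] {m : Measure Y} {F : Y → Y}
  {α : Set (Set Y)} {ζ : Y → ℝ} {a : Set Y}

/-- The push-forward under a full branch of the measure with density `ζ⁻¹` is `m`. -/
theorem map_withDensity_inv_jacobian (hF : Measurable F) (hb : IsFullBranch m F a) (ha : a ∈ α)
    (ham : MeasurableSet a) (hζ : IsInverseJacobian m F α ζ) :
    ((m.restrict a).withDensity fun x => ENNReal.ofReal (ζ x)⁻¹).map F = m := by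
  ext s hs
  rw [Measure.map_apply hF hs, withDensity_apply _ (hF hs), Measure.restrict_restrict (hF hs),
    ← hζ.measure_image a ha _ inter_subset_right ((hF hs).inter ham), image_preimage_inter,
    measure_inter_conull hb.image_conull]

theorem measure_image_eq_zero (ha : a ∈ α) (hζ : IsInverseJacobian m F α ζ) {s : Set Y}
    (hs : s ⊆ a) (hsm : MeasurableSet s) (h0 : m s = 0) : m (F '' s) = 0 := by
  rw [hζ.measure_image a ha s hs hsm, Measure.restrict_eq_zero.2 h0, lintegral_zero_measure]

/-- The density of the push-forward of a measure under a full branch. -/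
theorem exists_branch_density (hF : Measurable F) (hb : IsFullBranch m F a) (ha : a ∈ α)
    (ham : MeasurableSet a) (hζ : IsInverseJacobian m F α ζ) {g : Y → ℝ≥0∞} (hg : Measurable g) :
    ∃ ρ : Y → ℝ≥0∞, AEMeasurable ρ m ∧ (∀ x ∈ a, ρ (F x) = g x * ENNReal.ofReal (ζ x)) ∧
      ∀ s, MeasurableSet s → ∫⁻ x in F ⁻¹' s ∩ a, g x ∂m = ∫⁻ y in s, ρ y ∂m := by
  set w : Y → ℝ≥0∞ := fun x => g x * ENNReal.ofReal (ζ x) with hw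
  have hwm : Measurable w := hg.mul hζ.measurable.ennreal_ofReal
  -- By injectivity the supremum runs over at most one preimage, so this is `w` composed with the
  -- inverse branch, and `0` off `F '' a`.
  set ρ : Y → ℝ≥0∞ := fun y => ⨆ x : a, ⨆ _ : F x = y, w x with hρ
  have hval : ∀ x ∈ a, ρ (F x) = w x := fun x hx => by
    refine le_antisymm (iSup_le fun z => iSup_le fun hz => ?_) ?_
    · rw [hb.injOn z.2 hx hz]
    · exact le_iSup_of_le ⟨x, hx⟩ (le_iSup_of_le rfl le_rfl)
  have hnull : NullMeasurable ρ m := fun s hs => by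
    have h1 : ρ ⁻¹' s ∩ F '' a = F '' (a ∩ w ⁻¹' s) := by
      ext y
      constructor
      · rintro ⟨hy, x, hx, rfl⟩
        exact ⟨x, ⟨hx, by rw [mem_preimage, ← hval x hx]; exact hy⟩, rfl⟩
      · rintro ⟨x, ⟨hx, hxs⟩, rfl⟩
        exact ⟨by rw [mem_preimage, hval x hx]; exact hxs, x, hx, rfl⟩
    have h2 : NullMeasurableSet (ρ ⁻¹' s ∩ F '' a) m := by
      rw [h1]
      exact hb.nullMeasurableSet_image _ inter_subset_left (ham.inter (hwm hs))
    rw [← inter_union_compl (ρ ⁻¹' s) (F '' a)]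
    exact h2.union (NullMeasurableSet.of_null (measure_mono_null inter_subset_right
      hb.image_conull))
  have hρm : AEMeasurable ρ m := hnull.aemeasurable
  refine ⟨ρ, hρm, hval, fun s hs => ?_⟩
  have hmap := map_withDensity_inv_jacobian hF hb ha ham hζ
  have hind : AEMeasurable (s.indicator ρ)
      (((m.restrict a).withDensity fun x => ENNReal.ofReal (ζ x)⁻¹).map F) := by
    rw [hmap]; exact hρm.indicator hs
  have hzm : Measurable fun x => ENNReal.ofReal (ζ x)⁻¹ := hζ.measurable.inv.ennreal_ofReal
  calc ∫⁻ x in F ⁻¹' s ∩ a, g x ∂m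
      = ∫⁻ x in a, (F ⁻¹' s).indicator g x ∂m := by
        rw [lintegral_indicator (hF hs), Measure.restrict_restrict (hF hs)]
    _ = ∫⁻ x in a, ENNReal.ofReal (ζ x)⁻¹ * s.indicator ρ (F x) ∂m := by
        refine setLIntegral_congr_fun ham fun x hx => ?_
        by_cases hxs : F x ∈ s
        · have hp := hζ.pos a ha x hx
          rw [indicator_of_mem (show x ∈ F ⁻¹' s from hxs), indicator_of_mem hxs, hval x hx, hw,
            mul_left_comm, ← ENNReal.ofReal_mul (inv_nonneg.2 hp.le), inv_mul_cancel₀ hp.ne']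
          simp
        · rw [indicator_of_notMem (show x ∉ F ⁻¹' s from hxs), indicator_of_notMem hxs, mul_zero]
    _ = ∫⁻ x, s.indicator ρ (F x) ∂((m.restrict a).withDensity fun x =>
          ENNReal.ofReal (ζ x)⁻¹) := by
        exact (lintegral_withDensity_eq_lintegral_mul₀' hzm.aemeasurable
          (hind.comp_measurable hF)).symm
    _ = ∫⁻ y in s, ρ y ∂m := by
        rw [← lintegral_map' hind hF.aemeasurable, hmap, lintegral_indicator hs]

/-- Pushing forward by a uniformly expanding map contracts the Hölder constant of the logarithm
of the density. -/
theorem IsCellRegular.map [MetricSpace Y] {lam K η R R' : ℝ} (hF : IsUniformlyExpanding m F α lam K η) (hR : 0 ≤ R)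
    (hRR' : R * lam ^ (-η) + K ≤ R') {ν : Measure Y} (h : IsCellRegular m α η R ν) :
    IsRegular m η R' (ν.map F) := by
  obtain ⟨g, hg, rfl, G, hG, h⟩ := h
  obtain ⟨ζ, hζ, hdist⟩ := hF.distortion
  have hFm := hF.nonsingular.measurable
  have : Countable α := hF.countable.to_subtype
  choose ρ hρm hρv hρi using fun a : α =>
    exists_branch_density hFm (hF.fullBranch a a.2) a.2 (hF.measurableSet a a.2) hζ hg
  obtain ⟨N, hNG, hNm, hN0⟩ := exists_measurable_superset_of_null (mem_ae_iff.1 hG)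
  -- The exceptional set must be discarded upstairs, so its image has to be null. The Jacobian
  -- formula gives this, but only for measurable sets, hence the measurable hull `N`.
  have himg : ∀ a : α, F '' (a \ N) ∈ ae m := fun a => by
    have h1 : (F '' ((a : Set Y) \ N))ᶜ ⊆ (F '' (a : Set Y))ᶜ ∪ F '' ((a : Set Y) ∩ N) := by
      rw [← compl_subset_compl, compl_compl, compl_union, compl_compl]
      rintro y ⟨⟨x, hx, rfl⟩, hy⟩
      exact ⟨x, ⟨hx, fun hxN => hy ⟨x, ⟨hx, hxN⟩, rfl⟩⟩, rfl⟩
    refine mem_ae_iff.2 (measure_mono_null h1 (measure_union_null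
      (hF.fullBranch a a.2).image_conull ?_))
    exact measure_image_eq_zero a.2 hζ inter_subset_left ((hF.measurableSet a a.2).inter hNm)
      (measure_mono_null inter_subset_right hN0)
  have hmap : (m.withDensity g).map F = m.withDensity fun y => ∑' a, ρ a y := by
    ext s hs
    have hU : MeasurableSet (⋃₀ α) := MeasurableSet.sUnion hF.countable hF.measurableSet
    rw [Measure.map_apply hFm hs, withDensity_apply _ hs, lintegral_tsum fun a => (hρm a).restrict]
    have hcov : m.withDensity g (⋃₀ α)ᶜ = 0 := withDensity_absolutelyContinuous _ _ hF.cover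
    rw [← measure_inter_conull hcov, sUnion_eq_iUnion, inter_iUnion, measure_iUnion]
    · refine tsum_congr fun a => ?_
      rw [withDensity_apply _ ((hFm hs).inter (hF.measurableSet a a.2)), hρi a s hs]
    · intro a b hab
      exact (hF.pairwiseDisjoint a.2 b.2 (fun h => hab (Subtype.ext h))).mono inter_subset_right
        inter_subset_right
    · exact fun a => (hFm hs).inter (hF.measurableSet a a.2)
  rw [hmap]
  -- On this set every point has a good preimage in every cell, so the branches can be compared one
  -- by one and the Hölder bounds summed.
  refine IsRegular.of_aemeasurable (AEMeasurable.tsum hρm)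
    (G := ⋂ a : α, F '' (a \ N)) (countable_iInter_mem.2 himg) (IsLogHolderOn.tsum fun a => ?_)
  intro x hx y hy
  obtain ⟨x', hx', rfl⟩ := mem_iInter.1 hx a
  obtain ⟨y', hy', rfl⟩ := mem_iInter.1 hy a
  have hGN : ∀ z, z ∉ N → z ∈ G := fun z hz => by_contra fun hzG => hz (hNG hzG)
  have h1 := h a a.2 x' ⟨hGN _ hx'.2, hx'.1⟩ y' ⟨hGN _ hy'.2, hy'.1⟩
  have hx0 := hζ.pos a a.2 x' hx'.1
  have hy0 := hζ.pos a a.2 y' hy'.1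
  have h2 : ζ x' ≤ Real.exp (K * dist (F x') (F y') ^ η) * ζ y' := by
    have h3 := (le_abs_self _).trans (hdist a a.2 x' hx'.1 y' hy'.1)
    rw [← Real.exp_log hx0, ← Real.exp_log hy0, ← Real.exp_add]
    exact Real.exp_le_exp.2 (by simpa [Real.exp_log hx0, Real.exp_log hy0] using
      (by linarith : Real.log (ζ x') ≤ K * dist (F x') (F y') ^ η + Real.log (ζ y')))
  have hlam : 0 < lam := one_pos.trans hF.one_lt_lam
  -- Expansion multiplies the old constant by `lam ^ (-η)`; the distortion of `ζ` adds `K`.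
  have h4 : dist x' y' ^ η ≤ lam ^ (-η) * dist (F x') (F y') ^ η := by
    have h5 := hF.expansion a a.2 x' hx'.1 y' hy'.1
    rw [Real.rpow_neg hlam.le, ← Real.inv_rpow hlam.le,
      ← Real.mul_rpow (inv_nonneg.2 hlam.le) dist_nonneg]
    refine Real.rpow_le_rpow dist_nonneg ?_ hF.η_pos.le
    rw [inv_mul_eq_div, le_div_iff₀ hlam]
    linarith
  rw [hρv a x' hx'.1, hρv a y' hy'.1]
  calc g x' * ENNReal.ofReal (ζ x')
      ≤ (ENNReal.ofReal (Real.exp (R * dist x' y' ^ η)) * g y') *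
          ENNReal.ofReal (Real.exp (K * dist (F x') (F y') ^ η) * ζ y') := by gcongr
    _ = ENNReal.ofReal (Real.exp (R * dist x' y' ^ η + K * dist (F x') (F y') ^ η)) *
          (g y' * ENNReal.ofReal (ζ y')) := by
        rw [Real.exp_add, ENNReal.ofReal_mul (Real.exp_pos _).le,
          ENNReal.ofReal_mul (Real.exp_pos _).le]
        ring
    _ ≤ _ := by
        gcongr
        have h6 : 0 ≤ dist (F x') (F y') ^ η := Real.rpow_nonneg dist_nonneg _
        nlinarith [mul_le_mul_of_nonneg_left h4 hR, mul_le_mul_of_nonneg_right hRR' h6]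

end PushForward

end YoungTower

namespace YoungTower

/-! ### Residual times and iteration on the tower -/

section Dynamics

variable {Y : Type u} {F : Y → Y} {τ : Y → ℕ}

/-- The number of steps after which a point of the tower returns to the base level. -/
def residual (x : Tower τ) : ℕ := τ x.1.1 - x.1.2

/-- The inclusion of the base into the tower. -/
def toBase (hτ : ∀ y, 0 < τ y) (y : Y) : Tower τ := ⟨(y, 0), hτ y⟩

/-- The base level of the tower. -/
def baseLevel (τ : Y → ℕ) : Set (Tower τ) := {x | x.1.2 = 0}

theorem residual_pos (x : Tower τ) : 0 < residual x := Nat.sub_pos_of_lt x.2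

theorem towerMap_of_residual_eq_one (hτ : ∀ y, 0 < τ y) {x : Tower τ} (hx : residual x = 1) :
    towerMap F τ hτ x = toBase hτ (F x.1.1) := by
  have h : ¬ x.1.2 + 1 < τ x.1.1 := by unfold residual at hx; omega
  rw [towerMap, dif_neg h]
  rfl

theorem towerMap_of_one_lt_residual (hτ : ∀ y, 0 < τ y) {x : Tower τ} (hx : 1 < residual x) :
    (towerMap F τ hτ x).1 = (x.1.1, x.1.2 + 1) := by
  have h : x.1.2 + 1 < τ x.1.1 := by unfold residual at hx; omega
  rw [towerMap, dif_pos h]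

theorem residual_towerMap (hτ : ∀ y, 0 < τ y) {x : Tower τ} (hx : 1 < residual x) :
    residual (towerMap F τ hτ x) + 1 = residual x := by
  have h := towerMap_of_one_lt_residual (F := F) hτ hx
  unfold residual at hx ⊢
  rw [h]
  dsimp only
  omega

theorem towerMap_mem_baseLevel_iff (hτ : ∀ y, 0 < τ y) (x : Tower τ) :
    towerMap F τ hτ x ∈ baseLevel τ ↔ residual x = 1 := by
  rcases Nat.lt_or_eq_of_le (residual_pos x : 1 ≤ residual x) with h | h
  · have h' := towerMap_of_one_lt_residual (F := F) hτ h
    simp [baseLevel, h', h.ne']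
  · simp [h.symm, towerMap_of_residual_eq_one hτ h.symm, baseLevel, toBase]

theorem iterate_towerMap_residual (hτ : ∀ y, 0 < τ y) (n : ℕ) (x : Tower τ)
    (hx : residual x = n + 1) : (towerMap F τ hτ)^[n + 1] x = toBase hτ (F x.1.1) := by
  induction n generalizing x with
  | zero => exact towerMap_of_residual_eq_one hτ hx
  | succ n ih =>
    have h1 : 1 < residual x := by omega
    have h2 := residual_towerMap (F := F) hτ h1
    rw [Function.iterate_succ_apply, ih _ (by omega), towerMap_of_one_lt_residual hτ h1]

variable [MeasurableSpace Y]

theorem measurable_residual (hτm : Measurable τ) : Measurable (residual (τ := τ)) := by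
  unfold residual
  exact (hτm.comp (measurable_fst.comp measurable_subtype_coe)).sub
    (measurable_snd.comp measurable_subtype_coe)

theorem measurableSet_residual_eq (hτm : Measurable τ) (r : ℕ) :
    MeasurableSet {x : Tower τ | residual x = r} :=
  measurable_residual hτm (measurableSet_singleton r)

theorem measurableSet_le_residual (hτm : Measurable τ) (r : ℕ) :
    MeasurableSet {x : Tower τ | r ≤ residual x} :=
  measurable_residual hτm measurableSet_Ici

theorem measurable_toBase (hτ : ∀ y, 0 < τ y) : Measurable (toBase hτ) :=
  (measurable_id.prodMk measurable_const).subtype_mk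

theorem measurableSet_baseLevel : MeasurableSet (baseLevel τ) :=
  (measurable_snd.comp measurable_subtype_coe) (measurableSet_singleton 0)

theorem measurable_towerMap (hτm : Measurable τ) (hτ : ∀ y, 0 < τ y) (hF : Measurable F) :
    Measurable (towerMap F τ hτ) := by
  have h1 : Measurable fun x : Tower τ => x.1.1 := measurable_fst.comp measurable_subtype_coe
  have h2 : Measurable fun x : Tower τ => x.1.2 := measurable_snd.comp measurable_subtype_coe
  have hs : MeasurableSet {x : Tower τ | x.1.2 + 1 < τ x.1.1} :=
    measurableSet_lt (h2.add_const 1) (hτm.comp h1)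
  have h3 : Measurable fun x : Tower τ => (towerMap F τ hτ x).1 := by
    have : (fun x : Tower τ => (towerMap F τ hτ x).1) =
        fun x => if x.1.2 + 1 < τ x.1.1 then (x.1.1, x.1.2 + 1) else (F x.1.1, 0) := by
      funext x
      unfold towerMap
      split_ifs <;> rfl
    rw [this]
    exact Measurable.ite hs (h1.prodMk (h2.add_const 1)) ((hF.comp h1).prodMk measurable_const)
  exact h3.subtype_mk

/-- The push-forward of a measure on the base by the `n`-th iterate of the tower map. -/
noncomputable def evolve (F : Y → Y) (hτ : ∀ y, 0 < τ y) (n : ℕ) (ν : Measure Y) :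
    Measure (Tower τ) :=
  (ν.map (toBase hτ)).map ((towerMap F τ hτ)^[n])

theorem evolve_zero (hτ : ∀ y, 0 < τ y) (ν : Measure Y) :
    evolve F hτ 0 ν = ν.map (toBase hτ) := by
  simp [evolve]

theorem evolve_add {hτ : ∀ y, 0 < τ y} (hτm : Measurable τ) (hF : Measurable F) (n k : ℕ)
    (ν : Measure Y) :
    evolve F hτ (n + k) ν = (evolve F hτ n ν).map ((towerMap F τ hτ)^[k]) := by
  have hf := measurable_towerMap hτm hτ hF
  rw [evolve, evolve, Measure.map_map (hf.iterate _) (hf.iterate _), ← Function.iterate_add,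
    add_comm]

theorem evolve_univ {hτ : ∀ y, 0 < τ y} (hτm : Measurable τ) (hF : Measurable F) (n : ℕ)
    (ν : Measure Y) : evolve F hτ n ν univ = ν univ := by
  have hf := measurable_towerMap hτm hτ hF
  rw [evolve, Measure.map_apply (hf.iterate _) .univ, preimage_univ,
    Measure.map_apply (measurable_toBase hτ) .univ, preimage_univ]

theorem isFiniteMeasure_evolve {hτ : ∀ y, 0 < τ y} (hτm : Measurable τ) (hF : Measurable F) (n : ℕ)
    (ν : Measure Y) [IsFiniteMeasure ν] : IsFiniteMeasure (evolve F hτ n ν) :=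
  ⟨by rw [evolve_univ hτm hF]; exact measure_lt_top _ _⟩

end Dynamics

/-! ### Admissible measures on the tower -/

section Admissible

variable {Y : Type u} [MetricSpace Y] [MeasurableSpace Y] {m : Measure Y} {F : Y → Y}
  {α : Set (Set Y)} {lam K η R R' : ℝ} {τ : Y → ℕ}

/-- A measure on the tower is admissible if each of its parts with a given residual time is
regular when it returns to the base. -/
def IsAdmissible (m : Measure Y) (F : Y → Y) (hτ : ∀ y, 0 < τ y) (η R' : ℝ)
    (μ : Measure (Tower τ)) : Prop :=
  ∀ r, ∃ ν, IsRegular m η R' ν ∧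
    (μ.restrict {x | residual x = r + 1}).map ((towerMap F τ hτ)^[r + 1]) = ν.map (toBase hτ)

theorem IsAdmissible.add {hτ : ∀ y, 0 < τ y} (hτm : Measurable τ) (hF : Measurable F)
    {μ μ' : Measure (Tower τ)} (h : IsAdmissible m F hτ η R' μ)
    (h' : IsAdmissible m F hτ η R' μ') : IsAdmissible m F hτ η R' (μ + μ') := fun r => by
  obtain ⟨ν, hν, e⟩ := h r
  obtain ⟨ν', hν', e'⟩ := h' r
  have hf := (measurable_towerMap hτm hτ hF).iterate (r + 1)
  exact ⟨ν + ν', hν.add hν', by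
    rw [Measure.restrict_add, Measure.map_add _ _ hf, e, e',
      Measure.map_add _ _ (measurable_toBase hτ)]⟩

/-- On the base the residual time is `τ`, which is constant on cells, and the first return is `F`.
So each piece is a cellwise restriction followed by one push-forward. -/
theorem IsRegular.isAdmissible (hF : IsUniformlyExpanding m F α lam K η)
    (hτ : IsReturnTime m α τ) (hR : 0 ≤ R) (hRR' : R * lam ^ (-η) + K ≤ R') {ν : Measure Y}
    (h : IsRegular m η R ν) : IsAdmissible m F hτ.pos η R' (ν.map (toBase hτ.pos)) := fun r => by
  have hFm := hF.nonsingular.measurable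
  have hι := measurable_toBase hτ.pos
  have hf := (measurable_towerMap hτ.measurable hτ.pos hFm).iterate (r + 1)
  have hs : MeasurableSet {y | τ y = r + 1} := hτ.measurable (measurableSet_singleton _)
  refine ⟨(ν.restrict {y | τ y = r + 1}).map F, (h.isCellRegular.restrict hs ?_).map hF hR hRR', ?_⟩
  · intro a ha x hx y hy hxs
    exact (hτ.const a ha y hy x hx).trans hxs
  · rw [Measure.restrict_map hι (measurableSet_residual_eq hτ.measurable _),
      Measure.map_map hf hι, Measure.map_map hι hFm]
    refine Measure.map_congr ((ae_restrict_iff' hs).2 (Filter.Eventually.of_forall fun y hy => ?_))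
    exact iterate_towerMap_residual hτ.pos r _ hy

/-- The points that land on the base in one step are exactly those of residual time one, so the new
base part is the piece `r = 0`. -/
theorem IsAdmissible.exists_restrict_baseLevel {hτ : ∀ y, 0 < τ y} (hτm : Measurable τ)
    (hF : Measurable F) {μ : Measure (Tower τ)} (h : IsAdmissible m F hτ η R' μ) :
    ∃ ν, IsRegular m η R' ν ∧
      (μ.map (towerMap F τ hτ)).restrict (baseLevel τ) = ν.map (toBase hτ) := by
  obtain ⟨ν, hν, e⟩ := h 0
  refine ⟨ν, hν, ?_⟩
  rw [Measure.restrict_map (measurable_towerMap hτm hτ hF) measurableSet_baseLevel, ← e]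
  congr 2
  ext x
  exact towerMap_mem_baseLevel_iff hτ x

/-- Off the base a step just lowers the residual time by one: the new piece `r` is the image of the
old piece `r + 1` and has the same eventual return. -/
theorem IsAdmissible.map_restrict_compl {hτ : ∀ y, 0 < τ y} (hτm : Measurable τ)
    (hF : Measurable F) {μ : Measure (Tower τ)} (h : IsAdmissible m F hτ η R' μ) :
    IsAdmissible m F hτ η R' ((μ.map (towerMap F τ hτ)).restrict (baseLevel τ)ᶜ) := fun r => by
  obtain ⟨ν, hν, e⟩ := h (r + 1)
  refine ⟨ν, hν, ?_⟩
  have hf := measurable_towerMap hτm hτ hF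
  have hs := measurableSet_residual_eq (τ := τ) hτm (r + 1)
  rw [Measure.restrict_restrict hs,
    Measure.restrict_map hf (hs.inter measurableSet_baseLevel.compl),
    Measure.map_map (hf.iterate _) hf, ← Function.iterate_succ, ← e]
  congr 2
  ext x
  simp only [mem_preimage, mem_inter_iff, mem_ofPred_eq, mem_compl_iff, towerMap_mem_baseLevel_iff]
  have h0 := residual_pos x
  rcases Nat.lt_or_eq_of_le (h0 : 1 ≤ residual x) with h1 | h1
  · have := residual_towerMap (F := F) hτ h1
    omega
  · omega

theorem IsAdmissible.map (hF : IsUniformlyExpanding m F α lam K η) (hτ : IsReturnTime m α τ)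
    (hR' : 0 ≤ R') (hR : R' ≤ R) (hRR' : R * lam ^ (-η) + K ≤ R') {μ : Measure (Tower τ)}
    (h : IsAdmissible m F hτ.pos η R' μ) :
    IsAdmissible m F hτ.pos η R' (μ.map (towerMap F τ hτ.pos)) := by
  have hFm := hF.nonsingular.measurable
  obtain ⟨ν, hν, e⟩ := h.exists_restrict_baseLevel hτ.measurable hFm
  rw [← Measure.restrict_add_restrict_compl (μ := μ.map _) (measurableSet_baseLevel (τ := τ)), e]
  exact ((hν.mono hR).isAdmissible hF hτ (hR'.trans hR) hRR').add hτ.measurable hFm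
    (h.map_restrict_compl hτ.measurable hFm)

theorem IsRegular.isAdmissible_evolve (hF : IsUniformlyExpanding m F α lam K η)
    (hτ : IsReturnTime m α τ) (hR' : 0 ≤ R') (hR : R' ≤ R) (hRR' : R * lam ^ (-η) + K ≤ R')
    {ν : Measure Y} (h : IsRegular m η R ν) (n : ℕ) :
    IsAdmissible m F hτ.pos η R' (evolve F hτ.pos n ν) := by
  induction n with
  | zero => rw [evolve_zero]; exact h.isAdmissible hF hτ (hR'.trans hR) hRR'
  | succ n ih =>
    rw [evolve_add hτ.measurable hF.nonsingular.measurable]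
    exact ih.map hF hτ hR' hR hRR'

theorem IsRegular.exists_evolve_restrict_baseLevel (hF : IsUniformlyExpanding m F α lam K η)
    (hτ : IsReturnTime m α τ) (hR' : 0 ≤ R') (hR : R' ≤ R) (hRR' : R * lam ^ (-η) + K ≤ R')
    {ν : Measure Y} (h : IsRegular m η R ν) (n : ℕ) :
    ∃ ν', IsRegular m η R ν' ∧
      (evolve F hτ.pos n ν).restrict (baseLevel τ) = ν'.map (toBase hτ.pos) := by
  cases n with
  | zero =>
    refine ⟨ν, h, ?_⟩
    rw [evolve_zero, Measure.restrict_map (measurable_toBase _) measurableSet_baseLevel]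
    rw [show toBase hτ.pos ⁻¹' baseLevel τ = univ from eq_univ_of_forall fun _ => rfl,
      Measure.restrict_univ]
  | succ n =>
    obtain ⟨ν', hν', e⟩ := (h.isAdmissible_evolve hF hτ hR' hR hRR' n).exists_restrict_baseLevel
      hτ.measurable hF.nonsingular.measurable
    exact ⟨ν', hν'.mono hR, by
      rw [evolve_add hτ.measurable hF.nonsingular.measurable]; exact e⟩

/-- The residual time of a measure that starts from a regular measure on the base has uniformly
controlled tails. -/
theorem IsRegular.evolve_le_residual (hF : IsUniformlyExpanding m F α lam K η)
    (hτ : IsReturnTime m α τ) (hR' : 0 ≤ R') (hR : R' ≤ R) (hRR' : R * lam ^ (-η) + K ≤ R')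
    {ν : Measure Y} (h : IsRegular m η R ν) (n k : ℕ) :
    evolve F hτ.pos n ν {x | k ≤ residual x} ≤
      ENNReal.ofReal (Real.exp R) * (∑ j ∈ Finset.range (n + 1), m {y | k + j ≤ τ y}) *
        ν univ := by
  have hprob := hF.isProbabilityMeasure
  have hFm := hF.nonsingular.measurable
  have hms : ∀ k, MeasurableSet {y | k ≤ τ y} := fun k => hτ.measurable measurableSet_Ici
  have hbase : ∀ ν', IsRegular m η R ν' → ∀ k,
      ν'.map (toBase hτ.pos) {x | k ≤ residual x} ≤
        ENNReal.ofReal (Real.exp R) * m {y | k ≤ τ y} * ν' univ := fun ν' hν' k => by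
    rw [Measure.map_apply (measurable_toBase _) (measurableSet_le_residual hτ.measurable k),
      mul_right_comm]
    exact hν'.apply_le hF.η_pos (hR'.trans hR) hF.diam_le_one (hms k)
  induction n generalizing k with
  | zero => simpa [evolve_zero] using hbase ν h k
  | succ n ih =>
    obtain ⟨ν', hν', e⟩ := h.exists_evolve_restrict_baseLevel hF hτ hR' hR hRR' (n + 1)
    have hν'le : ν' univ ≤ ν univ := by
      have h1 := congrArg (fun μ : Measure (Tower τ) => μ univ) e
      simp only [Measure.map_apply (measurable_toBase hτ.pos) .univ, preimage_univ] at h1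
      rw [← h1, Measure.restrict_apply .univ, univ_inter,
        ← evolve_univ hτ.measurable hFm (hτ := hτ.pos) (n + 1) ν]
      exact measure_mono (subset_univ _)
    -- Mass with residual time at least `k` either is on the base now, where the tail of `τ`
    -- controls it, or had residual time at least `k + 1` one step earlier.
    have hsplit : evolve F hτ.pos (n + 1) ν {x | k ≤ residual x} ≤
        (evolve F hτ.pos (n + 1) ν).restrict (baseLevel τ) {x | k ≤ residual x} +
          evolve F hτ.pos n ν {x | k + 1 ≤ residual x} := by
      rw [← measure_inter_add_sdiff _ (measurableSet_baseLevel (τ := τ)),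
        Measure.restrict_apply (measurableSet_le_residual hτ.measurable k)]
      gcongr ?_ + ?_
      · exact le_rfl
      rw [evolve_add hτ.measurable hFm, Function.iterate_one,
        Measure.map_apply (measurable_towerMap hτ.measurable hτ.pos hFm)
          ((measurableSet_le_residual hτ.measurable k).diff measurableSet_baseLevel)]
      refine measure_mono fun x hx => ?_
      obtain ⟨h1, h2⟩ := hx
      rw [towerMap_mem_baseLevel_iff] at h2
      have h3 := residual_towerMap (F := F) hτ.pos (x := x) (by have := residual_pos x; omega)
      simp only [mem_ofPred_eq] at h1 ⊢
      omega
    refine hsplit.trans ?_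
    rw [e]
    calc _ ≤ ENNReal.ofReal (Real.exp R) * m {y | k ≤ τ y} * ν univ +
          ENNReal.ofReal (Real.exp R) *
            (∑ j ∈ Finset.range (n + 1), m {y | k + 1 + j ≤ τ y}) * ν univ := by
          gcongr
          · exact (hbase ν' hν' k).trans (by gcongr)
          · exact ih (k + 1)
      _ = _ := by
          rw [Finset.sum_range_succ' _ (n + 1)]
          simp only [add_zero, add_assoc, add_comm 1]
          ring

end Admissible

end YoungTower

namespace YoungTower

/-! ### Product coupling and summation by parts -/

section Sequences

/-- Here `b`, `b'` are the masses of the pieces of two measures of mass `w`, and `x`, `x'` the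
masses that these pieces give to a test set. Pairing piece `r` with piece `s` at weight `b r * b' s
/ w` writes the difference as a double sum. Since `G (max r s) ≤ g + (G r - g) + (G s - g)`, the
double sum splits into single sums. -/
theorem abs_sum_sub_sum_le_of_product_coupling {N : ℕ} {b b' x x' G : ℕ → ℝ} {w g : ℝ}
    (hx : ∀ r, 0 ≤ x r) (hxb : ∀ r, x r ≤ b r) (hx' : ∀ r, 0 ≤ x' r) (hxb' : ∀ r, x' r ≤ b' r)
    (hb : ∑ r ∈ Finset.range N, b r = w) (hb' : ∑ r ∈ Finset.range N, b' r = w)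
    (hg : ∀ r, g ≤ G r)
    (h : ∀ r ∈ Finset.range N, ∀ s ∈ Finset.range N,
      |b' s * x r - b r * x' s| ≤ b r * b' s * G (max r s)) :
    |∑ r ∈ Finset.range N, x r - ∑ r ∈ Finset.range N, x' r| ≤
      w * g + ∑ r ∈ Finset.range N, b r * (G r - g) + ∑ r ∈ Finset.range N, b' r * (G r - g) := by
  have hb0 : ∀ r, 0 ≤ b r := fun r => (hx r).trans (hxb r)
  have hb0' : ∀ r, 0 ≤ b' r := fun r => (hx' r).trans (hxb' r)
  have hw : 0 ≤ w := hb ▸ Finset.sum_nonneg fun r _ => hb0 r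
  rcases hw.eq_or_lt with h0 | hpos
  · have e1 : ∑ r ∈ Finset.range N, x r = 0 :=
      le_antisymm (by rw [h0, ← hb]; exact Finset.sum_le_sum fun r _ => hxb r)
        (Finset.sum_nonneg fun r _ => hx r)
    have e2 : ∑ r ∈ Finset.range N, x' r = 0 :=
      le_antisymm (by rw [h0, ← hb']; exact Finset.sum_le_sum fun r _ => hxb' r)
        (Finset.sum_nonneg fun r _ => hx' r)
    rw [e1, e2, ← h0]
    have s1 : 0 ≤ ∑ r ∈ Finset.range N, b r * (G r - g) :=
      Finset.sum_nonneg fun r _ => mul_nonneg (hb0 r) (sub_nonneg.2 (hg r))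
    have s2 : 0 ≤ ∑ r ∈ Finset.range N, b' r * (G r - g) :=
      Finset.sum_nonneg fun r _ => mul_nonneg (hb0' r) (sub_nonneg.2 (hg r))
    simp only [sub_self, abs_zero, zero_mul, zero_add]
    exact add_nonneg s1 s2
  · have hmax : ∀ r s, G (max r s) ≤ g + (G r - g) + (G s - g) := fun r s => by
      rcases le_total r s with hrs | hrs
      · rw [max_eq_right hrs]; linarith [hg r]
      · rw [max_eq_left hrs]; linarith [hg s]
    have key : w * |∑ r ∈ Finset.range N, x r - ∑ r ∈ Finset.range N, x' r| ≤
        w * (w * g + ∑ r ∈ Finset.range N, b r * (G r - g) +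
          ∑ r ∈ Finset.range N, b' r * (G r - g)) := by
      calc w * |∑ r ∈ Finset.range N, x r - ∑ r ∈ Finset.range N, x' r|
          = |∑ r ∈ Finset.range N, ∑ s ∈ Finset.range N, (b' s * x r - b r * x' s)| := by
            rw [show w * |∑ r ∈ Finset.range N, x r - ∑ r ∈ Finset.range N, x' r| =
              |w * (∑ r ∈ Finset.range N, x r - ∑ r ∈ Finset.range N, x' r)| by
                rw [abs_mul, abs_of_pos hpos]]
            congr 1
            simp only [Finset.sum_sub_distrib, ← Finset.sum_mul, ← Finset.mul_sum, hb, hb']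
            ring
        _ ≤ ∑ r ∈ Finset.range N, ∑ s ∈ Finset.range N,
              b r * b' s * (g + (G r - g) + (G s - g)) := by
            refine (Finset.abs_sum_le_sum_abs _ _).trans (Finset.sum_le_sum fun r hr => ?_)
            refine (Finset.abs_sum_le_sum_abs _ _).trans (Finset.sum_le_sum fun s hs => ?_)
            exact (h r hr s hs).trans
              (mul_le_mul_of_nonneg_left (hmax r s) (mul_nonneg (hb0 r) (hb0' s)))
        _ = ∑ r ∈ Finset.range N, ∑ s ∈ Finset.range N,
              (g * (b r * b' s) + (b r * (G r - g)) * b' s + b r * (b' s * (G s - g))) := by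
            refine Finset.sum_congr rfl fun r _ => Finset.sum_congr rfl fun s _ => by ring
        _ = _ := by
            simp only [Finset.sum_add_distrib, ← Finset.sum_mul, ← Finset.mul_sum, hb, hb']
            ring
    exact le_of_mul_le_mul_left key hpos

/-- Abel summation: write `H (r + 1) - H 0` as a sum of increments and exchange the sums, so that
only the tails of `b` appear. -/
theorem sum_mul_sub_le_of_tail {N : ℕ} {b t H : ℕ → ℝ} (hH : Monotone H)
    (hb : ∀ k, ∑ r ∈ Finset.range N, (if k ≤ r then b r else 0) ≤ t k) :
    ∑ r ∈ Finset.range N, b r * (H (r + 1) - H 0) ≤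
      ∑ k ∈ Finset.range N, t k * (H (k + 1) - H k) := by
  have h1 : ∀ r ∈ Finset.range N, b r * (H (r + 1) - H 0) =
      ∑ k ∈ Finset.range N, (if k ≤ r then b r else 0) * (H (k + 1) - H k) := fun r hr => by
    rw [← Finset.sum_range_sub, Finset.mul_sum]
    rw [← Finset.sum_subset (Finset.range_subset_range.2 (Finset.mem_range.1 hr))]
    · refine Finset.sum_congr rfl fun k hk => ?_
      rw [if_pos (Nat.lt_succ_iff.1 (Finset.mem_range.1 hk))]
    · intro k _ hk
      rw [if_neg (fun h => hk (Finset.mem_range.2 (Nat.lt_succ_iff.2 h))), zero_mul]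
  rw [Finset.sum_congr rfl h1, Finset.sum_comm]
  refine Finset.sum_le_sum fun k _ => ?_
  rw [← Finset.sum_mul]
  exact mul_le_mul_of_nonneg_right (hb k) (sub_nonneg.2 (hH k.le_succ))

end Sequences

section Evolve

variable {Y : Type u} [MeasurableSpace Y] {F : Y → Y} {τ : Y → ℕ}

theorem evolve_apply {hτ : ∀ y, 0 < τ y} (hτm : Measurable τ) (hF : Measurable F) (n : ℕ)
    (ν : Measure Y) {A : Set (Tower τ)} (hA : MeasurableSet A) :
    evolve F hτ n ν A = ν {y | (towerMap F τ hτ)^[n] (toBase hτ y) ∈ A} := by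
  have hf := (measurable_towerMap hτm hτ hF).iterate n
  rw [evolve, Measure.map_apply hf hA, Measure.map_apply (measurable_toBase hτ) (hf hA)]
  rfl

theorem evolve_le_of_restrict_le {hτ : ∀ y, 0 < τ y} (hτm : Measurable τ) (hF : Measurable F)
    {n : ℕ} {ν ν' : Measure Y} {s : Set (Tower τ)}
    (h : (evolve F hτ n ν).restrict s = ν'.map (toBase hτ)) (k : ℕ) {A : Set (Tower τ)}
    (hA : MeasurableSet A) : evolve F hτ k ν' A ≤ evolve F hτ (n + k) ν A := by
  have hf := (measurable_towerMap hτm hτ hF).iterate k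
  rw [evolve_add hτm hF, evolve, ← h, Measure.map_apply hf hA, Measure.map_apply hf hA]
  exact Measure.restrict_apply_le _ _

theorem measure_eq_sum_residual (hτm : Measurable τ) (μ : Measure (Tower τ))
    (A : Set (Tower τ)) (n : ℕ) :
    μ A = ∑ r ∈ Finset.range n, μ (A ∩ {x | residual x = r + 1}) +
      μ (A ∩ {x | n + 1 ≤ residual x}) := by
  induction n with
  | zero =>
    rw [Finset.sum_range_zero, zero_add]
    congr 1
    exact (inter_eq_left.2 fun x _ => residual_pos x).symm
  | succ n ih =>
    rw [ih, Finset.sum_range_succ, add_assoc]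
    congr 1
    rw [← measure_inter_add_sdiff (A ∩ {x | n + 1 ≤ residual x})
      (measurableSet_residual_eq hτm (n + 1))]
    congr 2
    · ext x
      simp only [mem_inter_iff, mem_ofPred_eq]
      grind
    · ext x
      simp only [mem_inter_iff, mem_sdiff, mem_ofPred_eq]
      grind

theorem evolve_smul {hτ : ∀ y, 0 < τ y} (n : ℕ) (c : ℝ≥0∞) (ν : Measure Y) :
    evolve F hτ n (c • ν) = c • evolve F hτ n ν := by
  rw [evolve, Measure.map_smul, Measure.map_smul, evolve]

end Evolve

/-! ### Mass returning to the base -/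

section LowerBound

variable {Y : Type u} [MetricSpace Y] [MeasurableSpace Y] {m : Measure Y} {F : Y → Y}
  {α : Set (Set Y)} {lam K η R R' : ℝ} {τ : Y → ℕ}

theorem IsRegular.le_apply_of_isMixingData (hF : IsUniformlyExpanding m F α lam K η)
    (hτ : IsReturnTime m α τ) (hR : 0 ≤ R) {I : Finset ℕ} {δ : ℝ} (hI : IsMixingData m τ I δ)
    {ν : Measure Y} (h : IsRegular m η R ν) {i : ℕ} (hi : i ∈ I) :
    ENNReal.ofReal (Real.exp (-R) * δ) * ν univ ≤ ν {y | τ y = i} := by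
  have hprob := hF.isProbabilityMeasure
  have hs : MeasurableSet {y | τ y = i} := hτ.measurable (measurableSet_singleton _)
  have h1 := h.le_apply hF.η_pos hR hF.diam_le_one hs
  have h2 : ENNReal.ofReal δ ≤ m {y | τ y = i} := ENNReal.ofReal_le_of_le_toReal (hI.le_measure i hi)
  calc ENNReal.ofReal (Real.exp (-R) * δ) * ν univ
      = ENNReal.ofReal (Real.exp (-R)) * (ν univ * ENNReal.ofReal δ) := by
        rw [ENNReal.ofReal_mul (Real.exp_pos _).le]; ring
    _ ≤ ENNReal.ofReal (Real.exp (-R)) * (ENNReal.ofReal (Real.exp R) * ν {y | τ y = i}) := by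
        exact mul_le_mul_right ((mul_le_mul_right h2 _).trans h1) _
    _ = ν {y | τ y = i} := by
        rw [← mul_assoc, ← ENNReal.ofReal_mul (Real.exp_pos _).le, ← Real.exp_add]
        simp

/-- Write `n` as a sum of elements of `I`. Each corresponding excursion is made by at least a
fraction `exp (-R) * δ` of the mass, and the part on the base is again regular. There are at most
`n` excursions, which is why the exponent can be `n` itself. -/
theorem IsRegular.pow_le_evolve_baseLevel (hF : IsUniformlyExpanding m F α lam K η)
    (hτ : IsReturnTime m α τ) (hR' : 0 ≤ R') (hR : R' ≤ R) (hRR' : R * lam ^ (-η) + K ≤ R')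
    {I : Finset ℕ} {δ : ℝ} (hI : IsMixingData m τ I δ) {n : ℕ}
    (hn : n ∈ AddSubmonoid.closure (I : Set ℕ)) {ν : Measure Y} (h : IsRegular m η R ν) :
    ENNReal.ofReal (Real.exp (-R) * δ) ^ n * ν univ ≤ evolve F hτ.pos n ν (baseLevel τ) := by
  have hprob := hF.isProbabilityMeasure
  have hFm := hF.nonsingular.measurable
  have hR0 := hR'.trans hR
  set κ := ENNReal.ofReal (Real.exp (-R) * δ) with hκdef
  induction hn using AddSubmonoid.closure_induction generalizing ν with
  | mem i hi =>
    have hκ : κ ≤ 1 := by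
      have h1 := (isRegular_self (m := m) (η := η) hR0).le_apply_of_isMixingData hF hτ hR0 hI hi
      rw [measure_univ, mul_one] at h1
      exact h1.trans prob_le_one
    calc κ ^ i * ν univ ≤ κ * ν univ := by
          gcongr
          exact pow_le_of_le_one zero_le hκ (hI.pos i hi).ne'
      _ ≤ ν {y | τ y = i} := h.le_apply_of_isMixingData hF hτ hR0 hI hi
      _ ≤ _ := by
        rw [evolve_apply hτ.measurable hFm i ν measurableSet_baseLevel]
        refine measure_mono fun y hy => ?_
        obtain ⟨k, rfl⟩ : ∃ k, i = k + 1 := ⟨i - 1, by have := hI.pos i hi; omega⟩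
        have := iterate_towerMap_residual (F := F) hτ.pos k (toBase hτ.pos y) hy
        simp only [mem_ofPred_eq, this]
        rfl
  | zero =>
    rw [evolve_apply hτ.measurable hFm 0 ν measurableSet_baseLevel, pow_zero, one_mul]
    exact measure_mono fun y _ => rfl
  | add x y _ _ hx hy =>
    obtain ⟨ν', hν', e⟩ := h.exists_evolve_restrict_baseLevel hF hτ hR' hR hRR' x
    have h1 : ν' univ = evolve F hτ.pos x ν (baseLevel τ) := by
      have h2 := congrArg (fun μ : Measure (Tower τ) => μ univ) e
      simpa [Measure.map_apply (measurable_toBase hτ.pos) .univ] using h2.symm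
    calc κ ^ (x + y) * ν univ = κ ^ y * (κ ^ x * ν univ) := by ring
      _ ≤ κ ^ y * ν' univ := by rw [h1]; gcongr; exact hx h
      _ ≤ evolve F hτ.pos y ν' (baseLevel τ) := hy hν'
      _ ≤ _ := evolve_le_of_restrict_le hτ.measurable hFm e y measurableSet_baseLevel

/-- The bound must not deteriorate with `n`, so the argument restarts at time `n - (L + N)`. At that
time at least half of the mass has residual time at most `L`; after it returns, at least `N` steps
remain, a number that lies in the semigroup generated by `I`. -/
theorem IsRegular.le_evolve_baseLevel (hF : IsUniformlyExpanding m F α lam K η)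
    (hτ : IsReturnTime m α τ) (hR' : 0 ≤ R') (hR : R' ≤ R) (hRR' : R * lam ^ (-η) + K ≤ R')
    {I : Finset ℕ} {δ : ℝ} (hI : IsMixingData m τ I δ) (hIne : I.Nonempty) {L N : ℕ}
    (hN : ∀ n, N ≤ n → n ∈ AddSubmonoid.closure (I : Set ℕ))
    (hL : ∀ ν, IsRegular m η R ν → ∀ n,
      evolve F hτ.pos n ν {x | L + 1 ≤ residual x} ≤ ν univ / 2)
    {ν : Measure Y} [IsFiniteMeasure ν] (h : IsRegular m η R ν) {n : ℕ} (hn : L + N ≤ n) :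
    ENNReal.ofReal (Real.exp (-R) * δ) ^ (L + N) * (ν univ / 2) ≤
      evolve F hτ.pos n ν (baseLevel τ) := by
  have hprob := hF.isProbabilityMeasure
  have hFm := hF.nonsingular.measurable
  have hR0 := hR'.trans hR
  set κ := ENNReal.ofReal (Real.exp (-R) * δ) with hκdef
  have hκ : κ ≤ 1 := by
    obtain ⟨i, hi⟩ := hIne
    have h1 := (isRegular_self (m := m) (η := η) hR0).le_apply_of_isMixingData hF hτ hR0 hI hi
    rw [measure_univ, mul_one] at h1
    exact h1.trans prob_le_one
  obtain ⟨j, rfl⟩ : ∃ j, n = j + (L + N) := ⟨n - (L + N), by omega⟩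
  set z := evolve F hτ.pos j ν with hz
  have hf := (measurable_towerMap hτ.measurable hτ.pos hFm)
  have hadm := h.isAdmissible_evolve hF hτ hR' hR hRR' j
  have hhalf : ν univ / 2 ≤ ∑ r ∈ Finset.range L, z {x | residual x = r + 1} := by
    have h1 := measure_eq_sum_residual hτ.measurable z univ L
    simp only [univ_inter] at h1
    rw [hz, evolve_univ hτ.measurable hFm, ← hz] at h1
    have h2 := hL ν h j
    have h3 : ν univ / 2 + ν univ / 2 ≤
        ∑ r ∈ Finset.range L, z {x | residual x = r + 1} + ν univ / 2 := by
      rw [ENNReal.add_halves]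
      exact h1.le.trans (by gcongr)
    exact (ENNReal.add_le_add_iff_right (ENNReal.div_ne_top (measure_ne_top _ _) two_ne_zero)).1 h3
  have hstep : ∀ r ∈ Finset.range L, κ ^ (L + N) * z {x | residual x = r + 1} ≤
      z (((towerMap F τ hτ.pos)^[L + N] ⁻¹' baseLevel τ) ∩ {x | residual x = r + 1}) := by
    intro r hr
    have hrL := Finset.mem_range.1 hr
    obtain ⟨ν', hν', e⟩ := hadm r
    have hmass : ν' univ = z {x | residual x = r + 1} := by
      have h2 := congrArg (fun μ : Measure (Tower τ) => μ univ) e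
      simpa [-Function.iterate_succ, Measure.map_apply (measurable_toBase hτ.pos) .univ,
        Measure.map_apply (hf.iterate (r + 1)) .univ] using h2.symm
    obtain ⟨k, hk⟩ : ∃ k, L + N = k + (r + 1) := ⟨L + N - (r + 1), by omega⟩
    have hB := measurableSet_baseLevel (τ := τ)
    have h4 : z (((towerMap F τ hτ.pos)^[L + N] ⁻¹' baseLevel τ) ∩ {x | residual x = r + 1}) =
        evolve F hτ.pos k ν' (baseLevel τ) := by
      rw [evolve, ← e, Measure.map_map (hf.iterate _) (hf.iterate _), ← Function.iterate_add,
        Measure.map_apply (hf.iterate _) hB, Measure.restrict_apply ((hf.iterate _) hB), ← hk]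
    rw [h4, ← hmass]
    refine le_trans ?_ ((hν'.mono hR).pow_le_evolve_baseLevel hF hτ hR' hR hRR' hI
      (hN k (by omega)))
    gcongr ?_ * _
    exact pow_le_pow_of_le_one zero_le hκ (by omega)
  calc κ ^ (L + N) * (ν univ / 2)
      ≤ κ ^ (L + N) * ∑ r ∈ Finset.range L, z {x | residual x = r + 1} := by gcongr
    _ ≤ ∑ r ∈ Finset.range L,
          z (((towerMap F τ hτ.pos)^[L + N] ⁻¹' baseLevel τ) ∩ {x | residual x = r + 1}) := by
        rw [Finset.mul_sum]
        exact Finset.sum_le_sum hstep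
    _ ≤ z ((towerMap F τ hτ.pos)^[L + N] ⁻¹' baseLevel τ) := by
        rw [measure_eq_sum_residual hτ.measurable z _ L]
        exact le_self_add
    _ = _ := by
        rw [evolve_add hτ.measurable hFm, Measure.map_apply (hf.iterate _) measurableSet_baseLevel]

/-- After enough time, a fixed proportion of a measure that started from a regular measure on the
base can be replaced by a multiple of the reference measure on the base. -/
theorem IsRegular.exists_evolve_eq_add (hF : IsUniformlyExpanding m F α lam K η)
    (hτ : IsReturnTime m α τ) (hR' : 0 ≤ R') (hR : R' < R) (hRR' : R * lam ^ (-η) + K ≤ R')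
    {ν : Measure Y} [IsFiniteMeasure ν] (h : IsRegular m η R ν) {n : ℕ} {p c : ℝ≥0∞}
    (hp : p * ν univ ≤ evolve F hτ.pos (n + 1) ν (baseLevel τ))
    (hc : c ≤ ENNReal.ofReal (Real.exp (-R') * ((R - R') / (R * Real.exp R))) * p) :
    ∃ μ, IsAdmissible m F hτ.pos η R' μ ∧
      evolve F hτ.pos (n + 1) ν = μ + (c * ν univ) • m.map (toBase hτ.pos) := by
  have hprob := hF.isProbabilityMeasure
  have hFm := hF.nonsingular.measurable
  have hι := measurable_toBase hτ.pos
  have hadm := h.isAdmissible_evolve hF hτ hR' hR.le hRR' n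
  -- The time is `n + 1` so that the base part has just arrived. It then has the better constant
  -- `R'`, which leaves room for the subtraction.
  obtain ⟨ν', hν', e⟩ := hadm.exists_restrict_baseLevel hτ.measurable hFm
  have hco := hadm.map_restrict_compl hτ.measurable hFm
  have hfin := isFiniteMeasure_evolve hτ.measurable hFm (hτ := hτ.pos) (n + 1) ν
  have hev : evolve F hτ.pos (n + 1) ν = (evolve F hτ.pos n ν).map (towerMap F τ hτ.pos) := by
    rw [evolve_add hτ.measurable hFm, Function.iterate_one]
  rw [← hev] at e hco
  have hmass : ν' univ = evolve F hτ.pos (n + 1) ν (baseLevel τ) := by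
    have h2 := congrArg (fun μ : Measure (Tower τ) => μ univ) e
    simpa [Measure.map_apply hι .univ] using h2.symm
  have hfin' : IsFiniteMeasure ν' := ⟨by rw [hmass]; exact measure_lt_top _ _⟩
  obtain ⟨ν'', hν'', e'⟩ := hν'.exists_sub hF.η_pos hR' hR hF.diam_le_one (c := c * ν univ) (by
    calc c * ν univ ≤ _ := mul_le_mul_left hc _
      _ ≤ _ := by rw [mul_assoc, hmass]; gcongr)
  refine ⟨(evolve F hτ.pos (n + 1) ν).restrict (baseLevel τ)ᶜ + ν''.map (toBase hτ.pos),
    hco.add hτ.measurable hFm (hν''.isAdmissible hF hτ (hR'.trans hR.le) hRR'), ?_⟩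
  rw [add_assoc, ← Measure.map_smul, ← Measure.map_add _ _ hι, ← e', ← e,
    Measure.restrict_compl_add_restrict measurableSet_baseLevel]

end LowerBound

end YoungTower

namespace YoungTower

/-! ### Loss of memory by coupling -/

section Coupling

variable {Y : Type u} [MetricSpace Y] [MeasurableSpace Y] {m : Measure Y} {F : Y → Y}
  {α : Set (Set Y)} {lam K η R R' : ℝ} {τ : Y → ℕ}

/-- Any two regular measures of equal mass on the base that have evolved for at least `M` steps
are `d`-close, relative to their mass, after `n` more steps. -/
def LosesMemory (m : Measure Y) (F : Y → Y) (hτ : ∀ y, 0 < τ y) (η R : ℝ) (M n : ℕ)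
    (d : ℝ) : Prop :=
  ∀ ν ν' : Measure Y, IsRegular m η R ν → IsRegular m η R ν' → IsFiniteMeasure ν →
    IsFiniteMeasure ν' → ν univ = ν' univ → ∀ j j', M ≤ j → M ≤ j' →
      ∀ A : Set (Tower τ), MeasurableSet A →
        |(evolve F hτ (j + n) ν).real A - (evolve F hτ (j' + n) ν').real A| ≤ d * ν.real univ

/-- The pieces of residual times `r + 1` and `s + 1` have both returned after `max r s + 1` steps,
and after `M` further steps loss of memory applies to them for the remaining `n - M - (max r s + 1)`
steps. Product coupling with `G r = D (n - M - (r + 1))` and summation by parts give the bound. The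
tails are measured against `w₀`, the mass before subtraction, whereas `w` is the mass of the
remainders. -/
theorem abs_sub_le_of_coupling {hτ : ∀ y, 0 < τ y} (hτm : Measurable τ) (hF : Measurable F)
    (hR : R' ≤ R) {M n : ℕ} {D T : ℕ → ℝ} {w w₀ : ℝ} (hD : Antitone D) (hD0 : 1 ≤ D 0)
    (hclaim : ∀ k < n, LosesMemory m F hτ η R M k (D k))
    {μ μ' : Measure (Tower τ)} [IsFiniteMeasure μ] [IsFiniteMeasure μ']
    (hμ : IsAdmissible m F hτ η R' μ) (hμ' : IsAdmissible m F hτ η R' μ')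
    (hw : μ.real univ = w) (hw' : μ'.real univ = w)
    (hT : ∀ k, μ.real {x | k + 1 ≤ residual x} ≤ w₀ * T k)
    (hT' : ∀ k, μ'.real {x | k + 1 ≤ residual x} ≤ w₀ * T k)
    {A : Set (Tower τ)} (hA : MeasurableSet A) :
    |μ.real ((towerMap F τ hτ)^[n] ⁻¹' A) - μ'.real ((towerMap F τ hτ)^[n] ⁻¹' A)| ≤
      w * D (n - M) +
        2 * (w₀ * ∑ k ∈ Finset.range (n - M), T k * (D (n - M - (k + 1)) - D (n - M - k))) := by
  have hf := measurable_towerMap hτm hτ hF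
  set S := (towerMap F τ hτ)^[n] ⁻¹' A with hS
  -- The last cell, `r = n`, collects all points that do not return within `n` steps.
  set P : ℕ → Set (Tower τ) := fun r =>
    if r < n then {x | residual x = r + 1} else {x | n + 1 ≤ residual x} with hP
  have hsum : ∀ (ρ : Measure (Tower τ)) [IsFiniteMeasure ρ] (E : Set (Tower τ)),
      ∑ r ∈ Finset.range (n + 1), ρ.real (E ∩ P r) = ρ.real E := fun ρ _ E => by
    have h1 := congrArg ENNReal.toReal (measure_eq_sum_residual hτm ρ E n)
    rw [ENNReal.toReal_add (ENNReal.sum_ne_top.2 fun _ _ => measure_ne_top _ _)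
      (measure_ne_top _ _), ENNReal.toReal_sum fun _ _ => measure_ne_top _ _] at h1
    rw [measureReal_def, h1, Finset.sum_range_succ]
    congr 1
    · refine Finset.sum_congr rfl fun r hr => ?_
      simp only [hP, if_pos (Finset.mem_range.1 hr)]
      rfl
    · simp only [hP, lt_irrefl, if_false]
      rfl
  have htail : ∀ (ρ : Measure (Tower τ)) [IsFiniteMeasure ρ],
      (∀ k, ρ.real {x | k + 1 ≤ residual x} ≤ w₀ * T k) → ∀ k,
      ∑ r ∈ Finset.range (n + 1), (if k ≤ r then ρ.real (P r) else 0) ≤ w₀ * T k := by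
    intro ρ _ hρ k
    refine le_trans (le_of_le_of_eq (Finset.sum_le_sum fun r hr => ?_)
      (hsum ρ {x | k + 1 ≤ residual x})) (hρ k)
    split_ifs with hkr
    · refine measureReal_mono fun x hx => ⟨?_, hx⟩
      simp only [hP] at hx
      have hr' := Finset.mem_range.1 hr
      split_ifs at hx with h1
      · simp only [mem_ofPred_eq] at hx ⊢; omega
      · simp only [mem_ofPred_eq] at hx ⊢; omega
    · exact measureReal_nonneg
  have hpiece : ∀ (ρ : Measure (Tower τ)) [IsFiniteMeasure ρ], IsAdmissible m F hτ η R' ρ →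
      ∀ r < n, ∃ ν, IsRegular m η R ν ∧ IsFiniteMeasure ν ∧ ν.real univ = ρ.real (P r) ∧
        ρ.real (S ∩ P r) = (evolve F hτ (n - (r + 1)) ν).real A := by
    intro ρ _ hρ r hr
    obtain ⟨ν, hν, e⟩ := hρ r
    have hmass : ν univ = ρ {x | residual x = r + 1} := by
      have h2 := congrArg (fun μ : Measure (Tower τ) => μ univ) e
      simpa [-Function.iterate_succ, Measure.map_apply (measurable_toBase hτ) .univ,
        Measure.map_apply (hf.iterate (r + 1)) .univ] using h2.symm
    refine ⟨ν, hν.mono hR, ⟨hmass ▸ measure_lt_top _ _⟩, ?_, ?_⟩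
    · simp only [measureReal_def, hmass, hP, if_pos hr]
    · simp only [measureReal_def, hP, if_pos hr]
      congr 1
      rw [evolve, ← e, Measure.map_map (hf.iterate _) (hf.iterate _), ← Function.iterate_add,
        Measure.map_apply (hf.iterate _) hA, Measure.restrict_apply ((hf.iterate _) hA),
        Nat.sub_add_cancel hr]
  set H : ℕ → ℝ := fun k => D (n - M - k) with hH
  have hHmono : Monotone H := fun a b hab => hD (by omega)
  have hmain := abs_sum_sub_sum_le_of_product_coupling (N := n + 1)
    (b := fun r => μ.real (P r)) (b' := fun r => μ'.real (P r)) (x := fun r => μ.real (S ∩ P r))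
    (x' := fun r => μ'.real (S ∩ P r)) (G := fun r => H (r + 1)) (w := w) (g := H 0)
    (fun r => measureReal_nonneg) (fun r => measureReal_mono inter_subset_right)
    (fun r => measureReal_nonneg) (fun r => measureReal_mono inter_subset_right)
    (by simpa [hw] using hsum μ univ) (by simpa [hw'] using hsum μ' univ)
    (fun r => hHmono (Nat.zero_le _)) ?_
  · rw [hsum, hsum] at hmain
    have h1 := sum_mul_sub_le_of_tail hHmono (htail μ hT)
    have h2 := sum_mul_sub_le_of_tail hHmono (htail μ' hT')
    have h3 : ∑ k ∈ Finset.range (n + 1), w₀ * T k * (H (k + 1) - H k) =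
        w₀ * ∑ k ∈ Finset.range (n - M), T k * (D (n - M - (k + 1)) - D (n - M - k)) := by
      rw [Finset.mul_sum, ← Finset.sum_subset (s₁ := Finset.range (n - M))]
      · exact Finset.sum_congr rfl fun k _ => by rw [mul_assoc]
      · exact Finset.range_subset_range.2 (by omega)
      · intro k _ hk
        rw [Finset.mem_range, not_lt] at hk
        have e1 : n - M - (k + 1) = 0 := by omega
        have e2 : n - M - k = 0 := by omega
        simp only [hH, e1, e2, sub_self, mul_zero]
    rw [h3] at h1 h2
    refine hmain.trans ?_
    have h4 : H 0 = D (n - M) := rfl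
    rw [h4] at h1 h2 ⊢
    linarith
  · intro r hr s hs
    have hr' := Finset.mem_range.1 hr
    have hs' := Finset.mem_range.1 hs
    by_cases hq : M + (max r s + 1) ≤ n
    · have hrn : r < n := by have := le_max_left r s; omega
      have hsn : s < n := by have := le_max_right r s; omega
      obtain ⟨ν, hν, hνf, hνm, hνe⟩ := hpiece μ hμ r hrn
      obtain ⟨ν', hν', hνf', hνm', hνe'⟩ := hpiece μ' hμ' s hsn
      -- Each piece is multiplied by the mass of the other to equalize masses. The starting times `M
      -- + max r s - r` and `M + max r s - s` differ, which is why `LosesMemory` allows `j ≠ j'`.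
      have hb := hclaim (n - (M + (max r s + 1))) (by omega)
        (ENNReal.ofReal (μ'.real (P s)) • ν) (ENNReal.ofReal (μ.real (P r)) • ν')
        (hν.smul _) (hν'.smul _) (ν.smul_finite ENNReal.ofReal_ne_top)
        (ν'.smul_finite ENNReal.ofReal_ne_top)
        (by
          rw [← hνm, ← hνm', Measure.smul_apply, Measure.smul_apply, ofReal_measureReal,
            ofReal_measureReal, smul_eq_mul, smul_eq_mul, mul_comm])
        (M + max r s - r) (M + max r s - s)
        (by have := le_max_left r s; omega) (by have := le_max_right r s; omega) A hA
      have e1 : M + max r s - r + (n - (M + (max r s + 1))) = n - (r + 1) := by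
        have := le_max_left r s; omega
      have e2 : M + max r s - s + (n - (M + (max r s + 1))) = n - (s + 1) := by
        have := le_max_right r s; omega
      rw [e1, e2, evolve_smul, evolve_smul, measureReal_ennreal_smul_apply,
        measureReal_ennreal_smul_apply, measureReal_ennreal_smul_apply,
        ENNReal.toReal_ofReal measureReal_nonneg, ENNReal.toReal_ofReal measureReal_nonneg,
        ← hνe, ← hνe', hνm] at hb
      refine hb.trans (le_of_eq ?_)
      have e3 : n - (M + (max r s + 1)) = n - M - (max r s + 1) := by omega
      rw [e3]
      simp only [hH]
      ring
    -- Too little time remains, and truncated subtraction evaluates `D` at `0`; there `1 ≤ D 0`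
    -- makes the trivial bound enough.
    · have e1 : n - M - (max r s + 1) = 0 := by omega
      have hx0 : 0 ≤ μ.real (S ∩ P r) := measureReal_nonneg
      have hx1 : μ.real (S ∩ P r) ≤ μ.real (P r) := measureReal_mono inter_subset_right
      have hy0 : 0 ≤ μ'.real (S ∩ P s) := measureReal_nonneg
      have hy1 : μ'.real (S ∩ P s) ≤ μ'.real (P s) := measureReal_mono inter_subset_right
      simp only [hH, e1]
      have hbb : 0 ≤ μ.real (P r) * μ'.real (P s) := mul_nonneg measureReal_nonneg measureReal_nonneg
      have h5 := mul_le_mul_of_nonneg_left hD0 hbb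
      rw [abs_le]
      constructor <;> nlinarith [mul_le_mul_of_nonneg_left hx1 (hy0.trans hy1),
        mul_le_mul_of_nonneg_left hy1 (hx0.trans hx1), mul_nonneg hx0 (hy0.trans hy1),
        mul_nonneg hy0 (hx0.trans hx1)]

/-- Loss of memory at the rate `D`, provided that `D` satisfies a renewal-type inequality. -/
theorem losesMemory (hF : IsUniformlyExpanding m F α lam K η) (hτ : IsReturnTime m α τ)
    (hR : R' ≤ R) {M : ℕ} {D T : ℕ → ℝ} {c : ℝ} (hc0 : 0 ≤ c) (hD : Antitone D)
    (hD0 : 1 ≤ D 0)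
    (hrec : ∀ n, 1 ≤ D n ∨ (1 - c) * D (n - M) +
      2 * ∑ k ∈ Finset.range (n - M), T k * (D (n - M - (k + 1)) - D (n - M - k)) ≤ D n)
    (hdec : ∀ ν, IsRegular m η R ν → IsFiniteMeasure ν → ∀ n, M ≤ n →
      ∃ μ, IsAdmissible m F hτ.pos η R' μ ∧
        evolve F hτ.pos n ν = μ + (ENNReal.ofReal c * ν univ) • m.map (toBase hτ.pos))
    (htail : ∀ ν, IsRegular m η R ν → IsFiniteMeasure ν → ∀ n k,
      (evolve F hτ.pos n ν).real {x | k + 1 ≤ residual x} ≤ ν.real univ * T k) (n : ℕ) :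
    LosesMemory m F hτ.pos η R M n (D n) := by
  have hprob := hF.isProbabilityMeasure
  have hFm := hF.nonsingular.measurable
  have hf := measurable_towerMap hτ.measurable hτ.pos hFm
  induction n using Nat.strong_induction_on with
  | _ n ih =>
    intro ν ν' hν hν' hνf hνf' hmass j j' hj hj' A hA
    have hmass' : ν.real univ = ν'.real univ := by simp only [measureReal_def, hmass]
    have hev : ∀ (ν : Measure Y) k, (evolve F hτ.pos k ν).real univ = ν.real univ := fun ν k => by
      simp only [measureReal_def, evolve_univ hτ.measurable hFm]
    have hfin : ∀ (ν : Measure Y) [IsFiniteMeasure ν] k, IsFiniteMeasure (evolve F hτ.pos k ν) :=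
      fun ν _ k => isFiniteMeasure_evolve hτ.measurable hFm k ν
    rcases hrec n with h1 | h1
    · have f1 := hfin ν (j + n)
      have f2 := hfin ν' (j' + n)
      have a1 : (evolve F hτ.pos (j + n) ν).real A ≤ ν.real univ :=
        (measureReal_mono (subset_univ A)).trans_eq (hev ν _)
      have a2 : (evolve F hτ.pos (j' + n) ν').real A ≤ ν.real univ :=
        (measureReal_mono (subset_univ A)).trans_eq ((hev ν' _).trans hmass'.symm)
      have a3 : 0 ≤ (evolve F hτ.pos (j + n) ν).real A := measureReal_nonneg
      have a4 : 0 ≤ (evolve F hτ.pos (j' + n) ν').real A := measureReal_nonneg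
      have a5 : 0 ≤ ν.real univ := measureReal_nonneg
      have a6 := mul_le_mul_of_nonneg_right h1 a5
      rw [abs_le]
      constructor <;> linarith
    -- Both measures contain the same multiple `κ` of `m` on the base. It evolves identically and
    -- cancels, leaving remainders of relative mass `1 - c`.
    · obtain ⟨μ, hμ, e⟩ := hdec ν hν hνf j hj
      obtain ⟨μ', hμ', e'⟩ := hdec ν' hν' hνf' j' hj'
      have f1 := hfin ν j
      have f2 := hfin ν' j'
      set κ : Measure (Tower τ) := (ENNReal.ofReal c * ν univ) • m.map (toBase hτ.pos) with hκ
      rw [← hmass, ← hκ] at e'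
      have g1 : IsFiniteMeasure μ := isFiniteMeasure_of_le _ (e ▸ Measure.le_add_right le_rfl)
      have g2 : IsFiniteMeasure μ' := isFiniteMeasure_of_le _ (e' ▸ Measure.le_add_right le_rfl)
      have g3 : IsFiniteMeasure κ := isFiniteMeasure_of_le _ (e ▸ Measure.le_add_left le_rfl)
      have hκ1 : κ.real univ = c * ν.real univ := by
        rw [hκ, measureReal_ennreal_smul_apply, ENNReal.toReal_mul, ENNReal.toReal_ofReal hc0,
          measureReal_def (m.map _), Measure.map_apply (measurable_toBase _) .univ, preimage_univ,
          measure_univ (μ := m), ENNReal.toReal_one, mul_one, measureReal_def]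
      have hsplit : ∀ (ρ : Measure (Tower τ)) [IsFiniteMeasure ρ] (ν : Measure Y) (j : ℕ),
          evolve F hτ.pos j ν = ρ + κ → (evolve F hτ.pos (j + n) ν).real A =
            ρ.real ((towerMap F τ hτ.pos)^[n] ⁻¹' A) +
              κ.real ((towerMap F τ hτ.pos)^[n] ⁻¹' A) := fun ρ _ ν j e => by
        rw [evolve_add hτ.measurable hFm, measureReal_def, Measure.map_apply (hf.iterate n) hA, e,
          ← measureReal_def, measureReal_add_apply]
      have hmain := abs_sub_le_of_coupling hτ.measurable hFm hR (w := (1 - c) * ν.real univ)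
        (w₀ := ν.real univ) (T := T) hD hD0 ih hμ hμ'
        (by
          have := hev ν j
          rw [e, measureReal_add_apply, hκ1] at this
          linarith)
        (by
          have := hev ν' j'
          rw [e', measureReal_add_apply, hκ1, ← hmass'] at this
          linarith)
        (fun k => by
          have := htail ν hν hνf j k
          rw [e, measureReal_add_apply] at this
          exact (le_add_of_nonneg_right measureReal_nonneg).trans this)
        (fun k => by
          have := htail ν' hν' hνf' j' k
          rw [e', measureReal_add_apply, ← hmass'] at this
          exact (le_add_of_nonneg_right measureReal_nonneg).trans this) hA
      rw [hsplit μ ν j e, hsplit μ' ν' j' e', add_sub_add_right_eq_sub]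
      refine hmain.trans ?_
      have h2 := mul_le_mul_of_nonneg_right h1 (measureReal_nonneg (μ := ν) (s := univ))
      nlinarith

end Coupling

end YoungTower

namespace YoungTower

/-! ### The reference measure on the tower -/

section TowerMeasure

variable {Y : Type u} {τ : Y → ℕ}

/-- The restriction of a function on the tower to a level, extended by zero to the base. -/
noncomputable def onLevel (g : Tower τ → ℝ≥0∞) (l : ℕ) (y : Y) : ℝ≥0∞ :=
  Function.extend (Subtype.val : Tower τ → Y × ℕ) g 0 (y, l)

theorem onLevel_of_lt (g : Tower τ → ℝ≥0∞) {l : ℕ} {y : Y} (h : l < τ y) :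
    onLevel g l y = g ⟨(y, l), h⟩ :=
  Subtype.val_injective.extend_apply g 0 (⟨(y, l), h⟩ : Tower τ)

theorem onLevel_of_not_lt (g : Tower τ → ℝ≥0∞) {l : ℕ} {y : Y} (h : ¬ l < τ y) :
    onLevel g l y = 0 := by
  refine Function.extend_apply' g (0 : Y × ℕ → ℝ≥0∞) (y, l) ?_
  rintro ⟨x, hx⟩
  have := x.2
  rw [hx] at this
  exact h this

variable [MeasurableSpace Y] {m : Measure Y} {F : Y → Y}

theorem measurableEmbedding_tower (hτ : Measurable τ) :
    MeasurableEmbedding (Subtype.val : Tower τ → Y × ℕ) :=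
  MeasurableEmbedding.subtype_coe (measurableSet_lt measurable_snd (hτ.comp measurable_fst))

theorem measurable_onLevel (hτ : Measurable τ) {g : Tower τ → ℝ≥0∞} (hg : Measurable g) (l : ℕ) :
    Measurable (onLevel g l) :=
  ((measurableEmbedding_tower hτ).measurable_extend hg measurable_zero).comp
    (measurable_id.prodMk measurable_const)

theorem lintegral_towerMeasure [SFinite m] (hτ : Measurable τ) {g : Tower τ → ℝ≥0∞}
    (hg : Measurable g) :
    ∫⁻ x, g x ∂towerMeasure m τ =
      (ENNReal.ofReal (∫ y, (τ y : ℝ) ∂m))⁻¹ * ∑' l, ∫⁻ y, onLevel g l y ∂m := by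
  have he := measurableEmbedding_tower hτ
  set G : Y × ℕ → ℝ≥0∞ := Function.extend (Subtype.val : Tower τ → Y × ℕ) g 0 with hG
  have hGm : Measurable G := he.measurable_extend hg measurable_zero
  have hGv : ∀ x : Tower τ, G x.1 = g x := fun x => Subtype.val_injective.extend_apply g 0 x
  rw [towerMeasure, lintegral_smul_measure, smul_eq_mul]
  congr 1
  calc ∫⁻ x, g x ∂(m.prod Measure.count).comap (Subtype.val : Tower τ → Y × ℕ)
      = ∫⁻ x : Tower τ, G x.1 ∂(m.prod Measure.count).comap (Subtype.val : Tower τ → Y × ℕ) := by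
        simp only [hGv]
    _ = ∫⁻ p in range (Subtype.val : Tower τ → Y × ℕ), G p ∂m.prod Measure.count := by
        rw [← he.map_comap, he.lintegral_map]
    _ = ∫⁻ p, G p ∂m.prod Measure.count := by
        rw [← lintegral_indicator he.measurableSet_range]
        congr 1
        funext p
        by_cases hp : p ∈ range (Subtype.val : Tower τ → Y × ℕ)
        · rw [indicator_of_mem hp]
        · rw [indicator_of_notMem hp, hG, Function.extend_apply' _ _ _ hp]
          rfl
    _ = ∫⁻ y, ∑' l, onLevel g l y ∂m := by
        rw [lintegral_prod _ hGm.aemeasurable]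
        refine lintegral_congr fun y => ?_
        rw [lintegral_count]
        rfl
    _ = _ := lintegral_tsum fun l => (measurable_onLevel hτ hg l).aemeasurable

theorem towerMeasure_apply [SFinite m] (hτ : Measurable τ) {A : Set (Tower τ)}
    (hA : MeasurableSet A) :
    towerMeasure m τ A =
      (ENNReal.ofReal (∫ y, (τ y : ℝ) ∂m))⁻¹ * ∑' l, ∫⁻ y, onLevel (A.indicator 1) l y ∂m := by
  rw [← lintegral_towerMeasure hτ (measurable_one.indicator hA), lintegral_indicator_one hA]

theorem towerMeasure_eq_zero_iff [SFinite m] (hτ : Measurable τ) {A : Set (Tower τ)}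
    (hA : MeasurableSet A) :
    towerMeasure m τ A = 0 ↔ ∀ l, ∀ᵐ y ∂m, ∀ h : l < τ y, (⟨(y, l), h⟩ : Tower τ) ∉ A := by
  rw [towerMeasure_apply hτ hA, mul_eq_zero, or_iff_right (by simp), ENNReal.tsum_eq_zero]
  refine forall_congr' fun l => ?_
  rw [lintegral_eq_zero_iff (measurable_onLevel hτ (measurable_one.indicator hA) l)]
  refine Filter.eventually_congr (Filter.Eventually.of_forall fun y => ?_)
  by_cases h : l < τ y
  · simp [onLevel_of_lt _ h, h]
  · simp [onLevel_of_not_lt _ h, h]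

variable {α : Set (Set Y)}

theorem lintegral_returnTime (hτ : IsReturnTime m α τ) :
    ∫⁻ y, (τ y : ℝ≥0∞) ∂m = ENNReal.ofReal (∫ y, (τ y : ℝ) ∂m) := by
  rw [ofReal_integral_eq_lintegral_ofReal hτ.integrable
    (Filter.Eventually.of_forall fun y => Nat.cast_nonneg _)]
  simp

theorem one_le_integral_returnTime [IsProbabilityMeasure m] (hτ : IsReturnTime m α τ) :
    1 ≤ ENNReal.ofReal (∫ y, (τ y : ℝ) ∂m) := by
  rw [← lintegral_returnTime hτ]
  calc (1 : ℝ≥0∞) = ∫⁻ _, 1 ∂m := by simp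
    _ ≤ _ := lintegral_mono fun y => Nat.one_le_cast.2 (hτ.pos y)

theorem isProbabilityMeasure_towerMeasure [IsProbabilityMeasure m] (hτ : IsReturnTime m α τ) :
    IsProbabilityMeasure (towerMeasure m τ) := by
  constructor
  have h1 : ∑' l, ∫⁻ y, onLevel ((univ : Set (Tower τ)).indicator 1) l y ∂m =
      ∫⁻ y, (τ y : ℝ≥0∞) ∂m := by
    rw [← lintegral_tsum fun l =>
      (measurable_onLevel hτ.measurable (measurable_one.indicator .univ) l).aemeasurable]
    refine lintegral_congr fun y => ?_
    rw [tsum_eq_sum (s := Finset.range (τ y))]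
    · rw [Finset.sum_congr rfl fun l hl => by
        rw [onLevel_of_lt _ (Finset.mem_range.1 hl), indicator_univ, Pi.one_apply]]
      simp
    · intro l hl
      exact onLevel_of_not_lt _ fun h => hl (Finset.mem_range.2 h)
  rw [towerMeasure_apply hτ.measurable .univ, h1, lintegral_returnTime hτ]
  exact ENNReal.inv_mul_cancel (one_pos.trans_le (one_le_integral_returnTime hτ)).ne'
    ENNReal.ofReal_ne_top

theorem quasiMeasurePreserving_towerMap [SFinite m] (hτ : IsReturnTime m α τ)
    (hF : Measure.QuasiMeasurePreserving F m m) :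
    Measure.QuasiMeasurePreserving (towerMap F τ hτ.pos) (towerMeasure m τ) (towerMeasure m τ) := by
  have hf := measurable_towerMap hτ.measurable hτ.pos hF.measurable
  refine ⟨hf, Measure.AbsolutelyContinuous.mk fun A hA h0 => ?_⟩
  rw [towerMeasure_eq_zero_iff hτ.measurable hA] at h0
  rw [Measure.map_apply hf hA, towerMeasure_eq_zero_iff hτ.measurable (hf hA)]
  intro l
  filter_upwards [h0 (l + 1), hF.ae (h0 0)] with y h1 h2 h
  by_cases h3 : l + 1 < τ y
  · simpa [towerMap, h3] using h1 h3
  · simpa [towerMap, h3] using h2 (hτ.pos _)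

/-- Residual time at least `k` on level `j` means `k + j ≤ τ y`, and the normalizing factor is at
most one. -/
theorem towerMeasure_le_residual [IsProbabilityMeasure m] (hτ : IsReturnTime m α τ) (k : ℕ) :
    towerMeasure m τ {x | k ≤ residual x} ≤ ∑' j, m {y | k + j ≤ τ y} := by
  rw [towerMeasure_apply hτ.measurable (measurableSet_le_residual hτ.measurable k)]
  refine (mul_le_of_le_one_left zero_le
    (ENNReal.inv_le_one.2 (one_le_integral_returnTime hτ))).trans (ENNReal.tsum_le_tsum fun l => ?_)
  have hs : MeasurableSet {y | k + l ≤ τ y} := hτ.measurable measurableSet_Ici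
  rw [← lintegral_indicator_one hs]
  refine lintegral_mono fun y => ?_
  by_cases h : l < τ y
  · rw [onLevel_of_lt _ h]
    by_cases h' : k ≤ τ y - l
    · rw [indicator_of_mem (show y ∈ {y | k + l ≤ τ y} by simp only [mem_ofPred_eq]; omega)]
      exact indicator_le_self' (fun _ _ => zero_le) _
    · rw [indicator_of_notMem (show (⟨(y, l), h⟩ : Tower τ) ∉ {x : Tower τ | k ≤ residual x}
        from h')]
      exact zero_le
  · rw [onLevel_of_not_lt _ h]
    exact zero_le

end TowerMeasure

/-! ### Admissibility of measures with Hölder densities -/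

section Density

variable {Y : Type u} [MetricSpace Y] [MeasurableSpace Y] {m : Measure Y} {F : Y → Y}
  {α : Set (Set Y)} {lam K η R R' : ℝ} {τ : Y → ℕ}

/-- A measure on the tower whose density is log-Hölder on each level is admissible. -/
theorem isAdmissible_withDensity (hF : IsUniformlyExpanding m F α lam K η)
    (hτ : IsReturnTime m α τ) (hR : 0 ≤ R) (hRR' : R * lam ^ (-η) + K ≤ R')
    {g : Tower τ → ℝ≥0∞} (hg : Measurable g) {G : Set (Tower τ)} (hG : G ∈ ae (towerMeasure m τ))
    (hgG : ∀ x ∈ G, ∀ x' ∈ G, x.1.2 = x'.1.2 →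
      g x ≤ ENNReal.ofReal (Real.exp (R * dist x.1.1 x'.1.1 ^ η)) * g x') :
    IsAdmissible m F hτ.pos η R' ((towerMeasure m τ).withDensity g) := fun r => by
  have hprob := hF.isProbabilityMeasure
  have hFm := hF.nonsingular.measurable
  have hι := measurable_toBase hτ.pos
  have hf := (measurable_towerMap hτ.measurable hτ.pos hFm).iterate (r + 1)
  have hs := measurableSet_residual_eq hτ.measurable (r + 1)
  set c := (ENNReal.ofReal (∫ y, (τ y : ℝ) ∂m))⁻¹ with hc
  -- Points of residual time `r + 1` on different levels reach the base at the same moment, through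
  -- `F`. Their densities can therefore be added on `Y` before pushing forward once.
  set gr : Y → ℝ≥0∞ := fun y =>
    c * ∑' l, onLevel ({x : Tower τ | residual x = r + 1}.indicator g) l y with hgr
  have hlm : ∀ l, Measurable (onLevel ({x : Tower τ | residual x = r + 1}.indicator g) l) :=
    measurable_onLevel hτ.measurable (hg.indicator hs)
  have hgrm : Measurable gr := (Measurable.tsum hlm).const_mul c
  have hcell : IsCellRegular m α η R (m.withDensity gr) := by
    obtain ⟨N, hNG, hNm, hN0⟩ := exists_measurable_superset_of_null (mem_ae_iff.1 hG)
    refine ⟨gr, hgrm, rfl, {y | ∀ l, ∀ h : l < τ y, (⟨(y, l), h⟩ : Tower τ) ∉ N},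
      ae_all_iff.2 ((towerMeasure_eq_zero_iff hτ.measurable hNm).1 hN0), fun a ha => ?_⟩
    refine (IsLogHolderOn.tsum fun l => ?_).const_mul c
    rintro y ⟨hy, hya⟩ y' ⟨hy', hya'⟩
    have hτy := hτ.const a ha y hya y' hya'
    by_cases h : l < τ y
    · have h' : l < τ y' := hτy ▸ h
      rw [onLevel_of_lt _ h, onLevel_of_lt _ h']
      by_cases hr : τ y - l = r + 1
      · rw [indicator_of_mem (show (⟨(y, l), h⟩ : Tower τ) ∈ {x : Tower τ | residual x = r + 1}
          from hr), indicator_of_mem (show (⟨(y', l), h'⟩ : Tower τ) ∈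
          {x : Tower τ | residual x = r + 1} from (hτy ▸ hr : τ y' - l = r + 1))]
        exact hgG _ (by_contra fun hn => hy l h (hNG hn)) _
          (by_contra fun hn => hy' l h' (hNG hn)) rfl
      · rw [indicator_of_notMem (show (⟨(y, l), h⟩ : Tower τ) ∉ {x : Tower τ | residual x = r + 1}
          from hr)]
        exact zero_le
    · rw [onLevel_of_not_lt _ h]
      exact zero_le
  refine ⟨(m.withDensity gr).map F, hcell.map hF hR hRR', ?_⟩
  ext A hA
  rw [Measure.map_apply hf hA, Measure.restrict_apply (hf hA), Measure.map_apply hι hA,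
    Measure.map_apply hFm (hι hA), withDensity_apply _ ((hf hA).inter hs),
    withDensity_apply _ (hFm (hι hA)), ← lintegral_indicator ((hf hA).inter hs),
    lintegral_towerMeasure hτ.measurable (hg.indicator ((hf hA).inter hs)),
    lintegral_const_mul _ (Measurable.tsum hlm),
    lintegral_tsum fun l => (hlm l).aemeasurable]
  congr 1
  refine tsum_congr fun l => ?_
  rw [← lintegral_indicator (hFm (hι hA))]
  refine lintegral_congr fun y => ?_
  by_cases h : l < τ y
  · by_cases hr : τ y - l = r + 1
    · have e := iterate_towerMap_residual (F := F) hτ.pos r (⟨(y, l), h⟩ : Tower τ) hr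
      by_cases hyA : toBase hτ.pos (F y) ∈ A
      · rw [indicator_of_mem (show y ∈ F ⁻¹' (toBase hτ.pos ⁻¹' A) from hyA), onLevel_of_lt _ h,
          onLevel_of_lt _ h, indicator_of_mem, indicator_of_mem]
        · exact hr
        · exact ⟨by rw [mem_preimage, e]; exact hyA, hr⟩
      · rw [indicator_of_notMem (show y ∉ F ⁻¹' (toBase hτ.pos ⁻¹' A) from hyA),
          onLevel_of_lt _ h, indicator_of_notMem]
        exact fun hn => hyA (by have := hn.1; rwa [mem_preimage, e] at this)
    · have h0 : onLevel ({x : Tower τ | residual x = r + 1}.indicator g) l y = 0 := by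
        rw [onLevel_of_lt _ h]
        exact indicator_of_notMem (show (⟨(y, l), h⟩ : Tower τ) ∉
          {x : Tower τ | residual x = r + 1} from hr) g
      rw [onLevel_of_lt _ h, indicator_of_notMem fun hn => hr hn.2]
      exact (indicator_apply_eq_zero.2 fun _ => h0).symm
  · have h0 : onLevel ({x : Tower τ | residual x = r + 1}.indicator g) l y = 0 :=
      onLevel_of_not_lt _ h
    rw [onLevel_of_not_lt _ h]
    exact (indicator_apply_eq_zero.2 fun _ => h0).symm

end Density

end YoungTower

namespace YoungTower

/-! ### Duality for iterates of the transfer operator -/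

section TransferOperator

variable {X : Type*} [MeasurableSpace X] {μ : Measure X} {f : X → X}

theorem measurable_transferOperator (φ : X → ℝ) : Measurable (transferOperator μ f φ) :=
  (Measure.measurable_rnDeriv _ _).ennreal_toReal.sub
    (Measure.measurable_rnDeriv _ _).ennreal_toReal

theorem integral_iterate_transferOperator_mul [IsFiniteMeasure μ]
    (hf : Measure.QuasiMeasurePreserving f μ μ) {φ : X → ℝ} (hφ : Integrable φ μ) (n : ℕ) :
    Integrable ((transferOperator μ f)^[n] φ) μ ∧
      ∀ (ψ : X → ℝ) (c : ℝ), Measurable ψ → (∀ x, |ψ x| ≤ c) →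
        ∫ x, (transferOperator μ f)^[n] φ x * ψ x ∂μ = ∫ x, φ x * ψ (f^[n] x) ∂μ := by
  induction n with
  | zero => exact ⟨hφ, fun ψ c _ _ => rfl⟩
  | succ n ih =>
    rw [Function.iterate_succ_apply']
    refine ⟨(integral_transferOperator_mul hf ih.1 (measurable_const (a := (0 : ℝ)))
      (c := 0) (by simp)).1, fun ψ c hψ hc => ?_⟩
    rw [(integral_transferOperator_mul hf ih.1 hψ hc).2,
      ih.2 (fun x => ψ (f x)) c (hψ.comp hf.measurable) fun x => hc (f x)]
    simp only [Function.iterate_succ_apply']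

/-- Test the iterate against its sign, written as `2 * 1_A - 1`. By duality the constant part
contributes the integral of `φ`, which is zero. At least one application of the operator is needed
for the iterate, and hence `A`, to be measurable. -/
theorem integral_abs_iterate_transferOperator [IsFiniteMeasure μ]
    (hf : Measure.QuasiMeasurePreserving f μ μ) {φ : X → ℝ} (hφ : Integrable φ μ)
    (h0 : ∫ x, φ x ∂μ = 0) (n : ℕ) :
    ∃ A, MeasurableSet A ∧
      ∫ x, |(transferOperator μ f)^[n + 1] φ x| ∂μ = 2 * ∫ x in f^[n + 1] ⁻¹' A, φ x ∂μ := by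
  set u := (transferOperator μ f)^[n + 1] φ with hu
  have hum : Measurable u := by
    rw [hu, Function.iterate_succ_apply']
    exact measurable_transferOperator _
  have hA : MeasurableSet {x | 0 ≤ u x} := measurableSet_le measurable_const hum
  refine ⟨{x | 0 ≤ u x}, hA, ?_⟩
  set s : X → ℝ := fun x => 2 * {x | 0 ≤ u x}.indicator 1 x - 1 with hs
  have hsm : Measurable s := ((measurable_one.indicator hA).const_mul 2).sub_const 1
  have hsv : ∀ x, (0 ≤ u x ∧ s x = 1) ∨ (u x < 0 ∧ s x = -1) := fun x => by
    by_cases h : 0 ≤ u x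
    · exact Or.inl ⟨h, by
        rw [hs]
        beta_reduce
        rw [indicator_of_mem (show x ∈ {x | 0 ≤ u x} from h), Pi.one_apply]
        norm_num⟩
    · exact Or.inr ⟨not_le.1 h, by
        rw [hs]
        beta_reduce
        rw [indicator_of_notMem (show x ∉ {x | 0 ≤ u x} from h)]
        norm_num⟩
  have hsb : ∀ x, |s x| ≤ 1 := fun x => by
    rcases hsv x with h | h <;> simp [h.2]
  have habs : ∀ x, |u x| = u x * s x := fun x => by
    rcases hsv x with h | h
    · rw [h.2, mul_one, abs_of_nonneg h.1]
    · rw [h.2, abs_of_neg h.1]; ring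
  have hfA : MeasurableSet (f^[n + 1] ⁻¹' {x | 0 ≤ u x}) := (hf.measurable.iterate _) hA
  simp only [habs]
  rw [(integral_iterate_transferOperator_mul hf hφ (n + 1)).2 s 1 hsm hsb]
  calc ∫ x, φ x * s (f^[n + 1] x) ∂μ
      = ∫ x, (2 * (f^[n + 1] ⁻¹' {x | 0 ≤ u x}).indicator φ x - φ x) ∂μ := by
        refine integral_congr_ae (Filter.Eventually.of_forall fun x => ?_)
        by_cases h : x ∈ f^[n + 1] ⁻¹' {x | 0 ≤ u x}
        · beta_reduce
          rw [indicator_of_mem h, hs]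
          beta_reduce
          rw [indicator_of_mem (show f^[n + 1] x ∈ {x | 0 ≤ u x} from h), Pi.one_apply]
          ring
        · beta_reduce
          rw [indicator_of_notMem h, hs]
          beta_reduce
          rw [indicator_of_notMem (show f^[n + 1] x ∉ {x | 0 ≤ u x} from h)]
          ring
    _ = _ := by
        rw [integral_sub ((hφ.indicator hfA).const_mul 2) hφ, h0, sub_zero, integral_const_mul,
          integral_indicator hfA]

end TransferOperator

section Holder

variable {Y : Type u} [MetricSpace Y] {η : ℝ} {τ : Y → ℕ}

theorem abs_le_holderNorm {φ : Tower τ → ℝ} (h : holderNorm τ η φ < ∞) (x : Tower τ) :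
    |φ x| ≤ (holderNorm τ η φ).toReal := by
  rw [← ENNReal.ofReal_le_iff_le_toReal h.ne]
  exact (le_iSup (fun x => ENNReal.ofReal |φ x|) x).trans le_add_self

theorem abs_sub_le_holderNorm {φ : Tower τ → ℝ} (h : holderNorm τ η φ < ∞) {x x' : Tower τ}
    (hx : x.1.2 = x'.1.2) :
    |φ x - φ x'| ≤ (holderNorm τ η φ).toReal * dist x.1.1 x'.1.1 ^ η := by
  by_cases hxx : x = x'
  · subst hxx
    rw [sub_self, abs_zero]
    exact mul_nonneg ENNReal.toReal_nonneg (Real.rpow_nonneg dist_nonneg _)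
  · have hd : 0 < dist x.1.1 x'.1.1 :=
      dist_pos.2 fun h => hxx (Subtype.ext (Prod.ext h hx))
    rw [← div_le_iff₀ (Real.rpow_pos_of_pos hd _), ← ENNReal.ofReal_le_iff_le_toReal h.ne]
    have h1 : ENNReal.ofReal (|φ x - φ x'| / towerDist τ x x' ^ η) ≤ holderSeminorm τ η φ :=
      le_iSup_of_le x (le_iSup_of_le x' (le_iSup_of_le hxx le_rfl))
    rw [towerDist, if_pos hx] at h1
    exact h1.trans le_self_add

end Holder

/-! ### From loss of memory to decay of the transfer operator -/

section Decay

variable {Y : Type u} [MetricSpace Y] [MeasurableSpace Y] {m : Measure Y} {F : Y → Y}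
  {α : Set (Set Y)} {lam K η R R' : ℝ} {τ : Y → ℕ}

/-- The integral of an observable of small norm, in terms of an admissible probability measure. -/
theorem exists_isAdmissible_setIntegral (hF : IsUniformlyExpanding m F α lam K η)
    (hτ : IsReturnTime m α τ) (hR : 1 ≤ R) (hRR' : R * lam ^ (-η) + K ≤ R')
    {φ : Tower τ → ℝ} (hφ : AEMeasurable φ (towerMeasure m τ))
    (hφn : holderNorm τ η φ < ∞) (h0 : ∫ x, φ x ∂towerMeasure m τ = 0) {H : ℝ} (hH : 0 < H)
    (hφH : (holderNorm τ η φ).toReal ≤ H) :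
    ∃ μ : Measure (Tower τ), IsProbabilityMeasure μ ∧ IsAdmissible m F hτ.pos η R' μ ∧
      μ ≤ (3 / 2 : ℝ≥0∞) • towerMeasure m τ ∧
      ∀ S, MeasurableSet S →
        ∫ x in S, φ x ∂towerMeasure m τ = 2 * H * (μ.real S - (towerMeasure m τ).real S) := by
  have hprob := hF.isProbabilityMeasure
  have hpt := isProbabilityMeasure_towerMeasure hτ
  set ψ := hφ.mk φ with hψ
  have hψm : Measurable ψ := hφ.measurable_mk
  have hG : {x | φ x = ψ x} ∈ ae (towerMeasure m τ) := hφ.ae_eq_mk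
  have hφi : Integrable φ (towerMeasure m τ) :=
    Integrable.of_bound hφ.aestronglyMeasurable _
      (Filter.Eventually.of_forall (abs_le_holderNorm hφn))
  have hb : ∀ x, |φ x| ≤ H := fun x => (abs_le_holderNorm hφn x).trans hφH
  -- With this scaling `v` lies between `1 / 2` and `3 / 2`, has mean one, and its logarithm is
  -- Hölder on each level with constant `1 ≤ R`.
  set v : Tower τ → ℝ := fun x => 1 + φ x / (2 * H) with hv
  have hv1 : ∀ x, 1 / 2 ≤ v x := fun x => by
    have h1 := (abs_le.1 (hb x)).1
    have h2 : -(1 / 2) ≤ φ x / (2 * H) := by rw [le_div_iff₀ (by positivity)]; linarith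
    simp only [hv]; linarith
  have hv2 : ∀ x, v x ≤ 3 / 2 := fun x => by
    have h1 := (abs_le.1 (hb x)).2
    have h2 : φ x / (2 * H) ≤ 1 / 2 := by rw [div_le_iff₀ (by positivity)]; linarith
    simp only [hv]; linarith
  have hvi : Integrable v (towerMeasure m τ) := (integrable_const 1).add (hφi.div_const _)
  set g : Tower τ → ℝ≥0∞ := fun x => ENNReal.ofReal (1 + ψ x / (2 * H)) with hg
  have hgm : Measurable g := ((hψm.div_const _).const_add 1).ennreal_ofReal
  have hgv : ∀ x, φ x = ψ x → g x = ENNReal.ofReal (v x) := fun x hx => by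
    simp only [hg, hv, hx]
  have hgae : g =ᵐ[towerMeasure m τ] fun x => ENNReal.ofReal (v x) :=
    Filter.mem_of_superset hG hgv
  have hreal : ∀ S, MeasurableSet S → ((towerMeasure m τ).withDensity g).real S =
      (towerMeasure m τ).real S + (∫ x in S, φ x ∂towerMeasure m τ) / (2 * H) := fun S hS => by
    rw [measureReal_def, withDensity_congr_ae hgae, withDensity_apply _ hS,
      ← ofReal_integral_eq_lintegral_ofReal hvi.restrict
        (Filter.Eventually.of_forall fun x => (by norm_num : (0 : ℝ) ≤ 1 / 2).trans (hv1 x)),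
      ENNReal.toReal_ofReal (integral_nonneg fun x =>
        (by norm_num : (0 : ℝ) ≤ 1 / 2).trans (hv1 x)), hv,
      integral_add (integrable_const 1) (hφi.div_const _).restrict, integral_div]
    simp
  have hfin : ((towerMeasure m τ).withDensity g) univ ≠ ∞ := by
    rw [withDensity_congr_ae hgae, withDensity_apply _ .univ, Measure.restrict_univ]
    exact (hvi.lintegral_lt_top).ne
  refine ⟨(towerMeasure m τ).withDensity g, ⟨?_⟩, ?_, ?_, fun S hS => ?_⟩
  · have h1 := hreal univ .univ
    rw [Measure.restrict_univ, h0, zero_div, add_zero,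
      probReal_univ (μ := towerMeasure m τ)] at h1
    rw [← ENNReal.toReal_eq_one_iff]
    exact h1
  · refine isAdmissible_withDensity hF hτ (zero_le_one.trans hR) hRR' hgm hG
      fun x hx x' hx' hl => ?_
    rw [hgv x hx, hgv x' hx', ← ENNReal.ofReal_mul (Real.exp_pos _).le]
    refine ENNReal.ofReal_le_ofReal ?_
    set t := dist x.1.1 x'.1.1 ^ η
    have ht : 0 ≤ t := Real.rpow_nonneg dist_nonneg _
    have h1 : φ x - φ x' ≤ H * t := (le_abs_self _).trans
      ((abs_sub_le_holderNorm hφn hl).trans (mul_le_mul_of_nonneg_right hφH ht))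
    have h2 : v x ≤ v x' + t / 2 := by
      have : (φ x - φ x') / (2 * H) ≤ t / 2 := by
        rw [div_le_iff₀ (by positivity)]; linarith
      rw [sub_div] at this
      simp only [hv]
      linarith
    have h3 : 1 + t ≤ Real.exp (R * t) := by
      have h4 := Real.add_one_le_exp (R * t)
      nlinarith
    have h5 := hv1 x'
    nlinarith
  · refine Measure.le_iff.2 fun S hS => ?_
    rw [withDensity_congr_ae hgae, withDensity_apply _ hS, Measure.smul_apply, smul_eq_mul,
      ← setLIntegral_const]
    refine lintegral_mono fun x => ?_
    calc ENNReal.ofReal (v x) ≤ ENNReal.ofReal (3 / 2) := ENNReal.ofReal_le_ofReal (hv2 x)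
      _ = 3 / 2 := by
        rw [ENNReal.ofReal_div_of_pos (by norm_num)]
        norm_num
  · rw [hreal S hS]
    field_simp
    ring

/-- Decay of the iterates of the transfer operator at the rate `D`, provided that `D` satisfies a
renewal-type inequality. -/
theorem integral_abs_iterate_transferOperator_le (hF : IsUniformlyExpanding m F α lam K η)
    (hτ : IsReturnTime m α τ) {I : Finset ℕ} {δ : ℝ} (hI : IsMixingData m τ I δ)
    (hR' : 0 ≤ R') (hR : R' < R) (hRR' : R * lam ^ (-η) + K ≤ R') (hR1 : 1 ≤ R) {N L : ℕ}
    (hN : ∀ n, N ≤ n → n ∈ AddSubmonoid.closure (I : Set ℕ)) {T : ℕ → ℝ}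
    (hT0 : ∀ k, 0 ≤ T k)
    (hT : ∀ k n, Real.exp R * ∑ j ∈ Finset.range n, m.real {y | k + 1 + j ≤ τ y} ≤ T k)
    (hL : T L ≤ 1 / 2) {c : ℝ} (hc0 : 0 ≤ c) (hc1 : c ≤ 1 / 2)
    (hc : c ≤ Real.exp (-R') * ((R - R') / (R * Real.exp R)) *
      ((Real.exp (-R) * δ) ^ (L + N) * (1 / 2)))
    {D : ℕ → ℝ} (hD : Antitone D) (hDnn : ∀ n, 0 ≤ D n) (hD0 : 1 ≤ D 0)
    (hrec : ∀ n, 1 ≤ D n ∨ (1 - c) * D (n - (L + N + 1)) +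
      2 * ∑ k ∈ Finset.range (n - (L + N + 1)),
        T k * (D (n - (L + N + 1) - (k + 1)) - D (n - (L + N + 1) - k)) ≤ D n)
    {φ : Tower τ → ℝ} (hφ : AEMeasurable φ (towerMeasure m τ))
    (hφn : holderNorm τ η φ < ∞) (h0 : ∫ x, φ x ∂towerMeasure m τ = 0) (n : ℕ) :
    Integrable ((transferOperator (towerMeasure m τ) (towerMap F τ hτ.pos))^[n] φ)
      (towerMeasure m τ) ∧
    ∫ x, |(transferOperator (towerMeasure m τ) (towerMap F τ hτ.pos))^[n] φ x|
      ∂towerMeasure m τ ≤ 8 * D n * (holderNorm τ η φ).toReal := by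
  have hprob := hF.isProbabilityMeasure
  have hpt := isProbabilityMeasure_towerMeasure hτ
  have hFm := hF.nonsingular.measurable
  have hf := measurable_towerMap hτ.measurable hτ.pos hFm
  have hqmp := quasiMeasurePreserving_towerMap hτ hF.nonsingular
  have hR0 : 0 ≤ R := hR'.trans hR.le
  have hφi : Integrable φ (towerMeasure m τ) :=
    Integrable.of_bound hφ.aestronglyMeasurable _
      (Filter.Eventually.of_forall (abs_le_holderNorm hφn))
  refine ⟨(integral_iterate_transferOperator_mul hqmp hφi n).1, ?_⟩
  have hHn : 0 ≤ (holderNorm τ η φ).toReal := ENNReal.toReal_nonneg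
  cases n with
  | zero =>
    calc ∫ x, |φ x| ∂towerMeasure m τ
        ≤ ∫ _, (holderNorm τ η φ).toReal ∂towerMeasure m τ :=
          integral_mono hφi.abs (integrable_const _) (abs_le_holderNorm hφn)
      _ = (holderNorm τ η φ).toReal := by simp
      _ ≤ _ := le_mul_of_one_le_left hHn (by linarith)
  | succ n =>
    obtain ⟨A, hA, e⟩ := integral_abs_iterate_transferOperator hqmp hφi h0 n
    rw [e]
    have hTE : ∀ k n, ENNReal.ofReal (Real.exp R) *
        (∑ j ∈ Finset.range n, m {y | k + 1 + j ≤ τ y}) ≤ ENNReal.ofReal (T k) := fun k n => by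
      refine le_trans (le_of_eq ?_) (ENNReal.ofReal_le_ofReal (hT k n))
      rw [ENNReal.ofReal_mul (Real.exp_pos _).le,
        ENNReal.ofReal_sum_of_nonneg fun _ _ => measureReal_nonneg]
      exact congrArg _ (Finset.sum_congr rfl fun _ _ => ofReal_measureReal).symm
    have hev : ∀ ν, IsRegular m η R ν → ∀ n k,
        evolve F hτ.pos n ν {x | k + 1 ≤ residual x} ≤ ENNReal.ofReal (T k) * ν univ :=
      fun ν hν n k => (hν.evolve_le_residual hF hτ hR' hR.le hRR' n (k + 1)).trans
        (mul_le_mul_left (hTE k (n + 1)) _)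
    have hIne : I.Nonempty := by
      rw [Finset.nonempty_iff_ne_empty]
      rintro rfl
      exact absurd hI.gcd_eq_one (by simp)
    have hmem := losesMemory hF hτ hR.le hc0 hD hD0 hrec
      (fun ν hν hνf n hn => by
        obtain ⟨k, rfl⟩ : ∃ k, n = k + 1 := ⟨n - 1, by omega⟩
        refine hν.exists_evolve_eq_add hF hτ hR' hR hRR'
          (p := ENNReal.ofReal (Real.exp (-R) * δ) ^ (L + N) * ENNReal.ofReal (1 / 2)) ?_ ?_
        · refine le_trans (le_of_eq ?_) (hν.le_evolve_baseLevel hF hτ hR' hR.le hRR' hI hIne hN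
            (fun ν' hν' n' => (hev ν' hν' n' L).trans ?_) (n := k + 1) (by omega))
          · rw [mul_assoc, ENNReal.div_eq_inv_mul, one_div, ENNReal.ofReal_inv_of_pos two_pos]
            simp
          · rw [ENNReal.div_eq_inv_mul]
            gcongr
            refine (ENNReal.ofReal_le_ofReal hL).trans (le_of_eq ?_)
            rw [one_div, ENNReal.ofReal_inv_of_pos two_pos]
            simp
        · refine (ENNReal.ofReal_le_ofReal hc).trans (le_of_eq ?_)
          have h1 : 0 ≤ (R - R') / (R * Real.exp R) :=
            div_nonneg (sub_nonneg.2 hR.le) (by positivity)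
          have h2 := hI.δ_pos
          rw [ENNReal.ofReal_mul (by positivity), ENNReal.ofReal_mul (by positivity),
            ENNReal.ofReal_mul (by positivity), ENNReal.ofReal_pow (by positivity)])
      (fun ν hν hνf n k => by
        have h1 := ENNReal.toReal_mono (ENNReal.mul_ne_top ENNReal.ofReal_ne_top
          (measure_ne_top _ _)) (hev ν hν n k)
        rwa [ENNReal.toReal_mul, ENNReal.toReal_ofReal (hT0 k), mul_comm] at h1)
    have htail : ∀ k, (3 / 2 : ℝ≥0∞) * towerMeasure m τ {x | k + 1 ≤ residual x} ≤
        ENNReal.ofReal (T k) := fun k => by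
      have h32 : (3 / 2 : ℝ≥0∞) ≤ ENNReal.ofReal (Real.exp R) := by
        have : (3 / 2 : ℝ≥0∞) = ENNReal.ofReal (3 / 2) := by
          rw [ENNReal.ofReal_div_of_pos (by norm_num)]
          norm_num
        rw [this]
        refine ENNReal.ofReal_le_ofReal ?_
        have := Real.add_one_le_exp R
        linarith
      calc _ ≤ ENNReal.ofReal (Real.exp R) * ∑' j, m {y | k + 1 + j ≤ τ y} :=
            mul_le_mul' h32 (towerMeasure_le_residual hτ (k + 1))
        _ ≤ _ := by
          rw [← ENNReal.tsum_mul_left]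
          refine ENNReal.tsum_le_of_sum_range_le fun n => ?_
          rw [← Finset.mul_sum]
          exact hTE k n
    -- The norm of `φ` may vanish, so the estimate is proved for every positive `H` above it, and
    -- `H` is let down to the norm at the end.
    have hbound : ∀ H, 0 < H → (holderNorm τ η φ).toReal ≤ H →
        2 * ∫ x in (towerMap F τ hτ.pos)^[n + 1] ⁻¹' A, φ x ∂towerMeasure m τ ≤
          8 * D (n + 1) * H := fun H hH hφH => by
      obtain ⟨μ, hμp, hμa, hμle, hμi⟩ :=
        exists_isAdmissible_setIntegral hF hτ hR1 hRR' hφ hφn h0 hH hφH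
      have hself : IsAdmissible m F hτ.pos η R' (towerMeasure m τ) := by
        have h1 := isAdmissible_withDensity hF hτ hR0 hRR' (g := 1) measurable_one
          Filter.univ_mem (fun x _ x' _ _ => by
            simp only [Pi.one_apply, mul_one, ENNReal.one_le_ofReal]
            exact Real.one_le_exp (mul_nonneg hR0 (Real.rpow_nonneg dist_nonneg _)))
        rwa [withDensity_one] at h1
      have hreal : ∀ (ρ : Measure (Tower τ)) k, ρ {x | k + 1 ≤ residual x} ≤
          (3 / 2 : ℝ≥0∞) * towerMeasure m τ {x | k + 1 ≤ residual x} →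
          ρ.real {x | k + 1 ≤ residual x} ≤ 1 * T k := fun ρ k h => by
        rw [one_mul]
        exact ENNReal.toReal_le_of_le_ofReal (hT0 k) (h.trans (htail k))
      have hmain := abs_sub_le_of_coupling hτ.measurable hFm hR.le (w := 1) (w₀ := 1) hD hD0
        (n := n + 1) (fun k _ => hmem k) hμa hself (by simp) (by simp)
        (fun k => hreal μ k (hμle _))
        (fun k => hreal _ k (le_mul_of_one_le_left zero_le (by
          rw [ENNReal.le_div_iff_mul_le (by simp) (by simp), one_mul]; norm_num))) hA
      rw [hμi _ ((hf.iterate _) hA)]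
      -- No common part has been removed here, so the coupling bound carries `D (n - M)` in place of
      -- `(1 - c) * D (n - M)`. As `c ≤ 1 / 2`, this costs at most a factor two.
      have hfinal : μ.real ((towerMap F τ hτ.pos)^[n + 1] ⁻¹' A) -
          (towerMeasure m τ).real ((towerMap F τ hτ.pos)^[n + 1] ⁻¹' A) ≤ 2 * D (n + 1) := by
        rcases hrec (n + 1) with h1 | h1
        · have a1 : μ.real ((towerMap F τ hτ.pos)^[n + 1] ⁻¹' A) ≤ 1 := measureReal_le_one
          have a2 : 0 ≤ (towerMeasure m τ).real ((towerMap F τ hτ.pos)^[n + 1] ⁻¹' A) :=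
            measureReal_nonneg
          linarith
        · refine ((le_abs_self _).trans hmain).trans ?_
          have a1 : 0 ≤ ∑ k ∈ Finset.range (n + 1 - (L + N + 1)),
              T k * (D (n + 1 - (L + N + 1) - (k + 1)) - D (n + 1 - (L + N + 1) - k)) :=
            Finset.sum_nonneg fun k _ => mul_nonneg (hT0 k)
              (sub_nonneg.2 (hD (by omega)))
          have a2 := mul_nonneg (sub_nonneg.2 hc1) (hDnn (n + 1 - (L + N + 1)))
          nlinarith
      nlinarith
    refine le_of_forall_pos_le_add fun ε hε => ?_
    have hDn := hDnn (n + 1)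
    have h1 := hbound ((holderNorm τ η φ).toReal + ε / (8 * D (n + 1) + 1))
      (by positivity) (by have : 0 ≤ ε / (8 * D (n + 1) + 1) := by positivity
                          linarith)
    refine h1.trans ?_
    rw [mul_add]
    gcongr
    rw [← mul_div_assoc, div_le_iff₀ (by positivity)]
    nlinarith

end Decay

end YoungTower

namespace YoungTower

/-! ### Sequences satisfying the renewal-type inequality -/

section Numerics

theorem mul_rpow_neg_le_sub {x b : ℝ} (hx : 0 < x) (hb : 0 ≤ b) :
    b * (x + 1) ^ (-(b + 1)) ≤ x ^ (-b) - (x + 1) ^ (-b) := by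
  have hx1 : 0 < x + 1 := by linarith
  have h1 : (x / (x + 1)) ^ (-b) = x ^ (-b) / (x + 1) ^ (-b) := Real.div_rpow hx.le hx1.le _
  have h2 : 1 + b / (x + 1) ≤ (x / (x + 1)) ^ (-b) := by
    rw [Real.rpow_def_of_pos (by positivity)]
    have h3 : Real.log (x / (x + 1)) ≤ x / (x + 1) - 1 := Real.log_le_sub_one_of_pos (by positivity)
    have h4 : x / (x + 1) - 1 = -(1 / (x + 1)) := by field_simp; ring
    have h5 : b / (x + 1) ≤ Real.log (x / (x + 1)) * -b := by
      rw [h4] at h3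
      have := mul_le_mul_of_nonneg_right h3 hb
      rw [div_eq_mul_one_div]
      linarith
    linarith [Real.add_one_le_exp (Real.log (x / (x + 1)) * -b)]
  have h6 : (0 : ℝ) < (x + 1) ^ (-b) := Real.rpow_pos_of_pos hx1 _
  have h7 : (x + 1) ^ (-(b + 1)) = (x + 1) ^ (-b) / (x + 1) := by
    rw [neg_add, ← sub_eq_add_neg, Real.rpow_sub hx1, Real.rpow_one]
  rw [h7]
  rw [h1, le_div_iff₀ h6] at h2
  calc b * ((x + 1) ^ (-b) / (x + 1)) = (1 + b / (x + 1)) * (x + 1) ^ (-b) - (x + 1) ^ (-b) := by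
        field_simp; ring
    _ ≤ _ := by linarith

theorem sum_rpow_neg_le {b x : ℝ} (hb : 0 < b) (hx : 1 ≤ x) (n : ℕ) :
    ∑ j ∈ Finset.range n, (x + j) ^ (-(b + 1)) ≤ 2 ^ (b + 1) / b * x ^ (-b) := by
  have hx0 : 0 < x := by linarith
  have h : ∑ j ∈ Finset.range n, (x + j) ^ (-(b + 1)) ≤
      2 ^ (b + 1) / b * (x ^ (-b) - (x + n) ^ (-b)) := by
    induction n with
    | zero => simp
    | succ n ih =>
      rw [Finset.sum_range_succ]
      have hy : 1 ≤ x + n := by have : (0 : ℝ) ≤ n := n.cast_nonneg; linarith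
      have hy0 : 0 < x + n := by linarith
      have h1 := mul_rpow_neg_le_sub hy0 hb.le
      have h2 : (x + n) ^ (-(b + 1)) ≤ 2 ^ (b + 1) * (x + n + 1) ^ (-(b + 1)) := by
        calc (x + n) ^ (-(b + 1)) ≤ ((x + n + 1) / 2) ^ (-(b + 1)) :=
              Real.rpow_le_rpow_of_nonpos (by linarith) (by linarith) (by linarith)
          _ = _ := by
              rw [Real.div_rpow (by linarith) zero_le_two, Real.rpow_neg zero_le_two, div_inv_eq_mul,
                mul_comm]
      have h3 : (x + n) ^ (-(b + 1)) ≤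
          2 ^ (b + 1) / b * ((x + n) ^ (-b) - (x + n + 1) ^ (-b)) := by
        refine h2.trans ?_
        rw [div_mul_eq_mul_div, le_div_iff₀ hb]
        have h4 : (0 : ℝ) < 2 ^ (b + 1) := Real.rpow_pos_of_pos two_pos _
        nlinarith
      push_cast
      rw [← add_assoc]
      linarith
  refine h.trans ?_
  have h4 : (0 : ℝ) ≤ 2 ^ (b + 1) / b := by positivity
  have h5 : (0 : ℝ) ≤ (x + n) ^ (-b) := Real.rpow_nonneg (by positivity) _
  exact mul_le_mul_of_nonneg_left (by linarith) h4

/-- Bound `T k` by `T 0` before `k₀` and by `T k₀` from there on, then telescope each half. -/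
theorem sum_mul_sub_le_split {T a : ℕ → ℝ} (hT : Antitone T) (ha : Monotone a)
    (hT0 : ∀ k, 0 ≤ T k) (k₀ m : ℕ) :
    ∑ k ∈ Finset.range m, T k * (a (k + 1) - a k) ≤
      T 0 * (a k₀ - a 0) + T k₀ * (a m - a 0) := by
  have h : ∑ k ∈ Finset.range m, T k * (a (k + 1) - a k) ≤
      T 0 * (a (min m k₀) - a 0) + T k₀ * (a m - a 0) := by
    induction m with
    | zero => simp
    | succ m ih =>
      rw [Finset.sum_range_succ]
      have h1 : 0 ≤ a (m + 1) - a m := sub_nonneg.2 (ha m.le_succ)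
      rcases lt_or_ge m k₀ with hm | hm
      · rw [min_eq_left hm.le] at ih
        rw [min_eq_left (Nat.succ_le_of_lt hm)]
        nlinarith [mul_le_mul_of_nonneg_right (hT m.zero_le) h1, mul_nonneg (hT0 k₀) h1]
      · rw [min_eq_right hm] at ih
        rw [min_eq_right (hm.trans m.le_succ)]
        nlinarith [mul_le_mul_of_nonneg_right (hT hm) h1]
  refine h.trans ?_
  have := mul_le_mul_of_nonneg_left (ha (min_le_right m k₀)) (hT0 0)
  linarith

theorem summable_exp_neg_mul_rpow {a γ : ℝ} (ha : 0 < a) (hγ : 0 < γ) :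
    Summable fun n : ℕ => Real.exp (-a * ((n : ℝ) + 1) ^ γ) := by
  have h1 : Filter.Tendsto (fun n : ℕ => ((n : ℝ) + 1) ^ γ) Filter.atTop Filter.atTop :=
    (tendsto_rpow_atTop hγ).comp
      (Filter.tendsto_atTop_add_const_right _ _ tendsto_natCast_atTop_atTop)
  have h2 := ((isLittleO_exp_neg_mul_rpow_atTop ha (-2 / γ)).comp_tendsto h1).isBigO
  refine summable_of_isBigO_nat ?_ h2
  have h3 : Summable fun n : ℕ => ((n + 1 : ℕ) : ℝ) ^ (-2 : ℝ) :=
    (summable_nat_add_iff 1).2 (Real.summable_nat_rpow.2 (by norm_num))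
  refine h3.congr fun n => ?_
  have h4 : (0 : ℝ) ≤ (n : ℝ) + 1 := by positivity
  rw [Function.comp_apply, ← Real.rpow_mul h4, mul_div_cancel₀ _ hγ.ne']
  push_cast
  rfl

theorem add_rpow_le {x y γ : ℝ} (hx : 0 ≤ x) (hy : 0 ≤ y) (hγ : 0 ≤ γ) (hγ1 : γ ≤ 1) :
    (x + y) ^ γ ≤ x ^ γ + y ^ γ := by
  lift x to NNReal using hx
  lift y to NNReal using hy
  exact_mod_cast NNReal.rpow_add_le_add_rpow x y hγ hγ1

theorem rpow_neg_le_mul_of_div_le {x y s b b₁ : ℝ} (hx : 0 < x) (hs : 1 ≤ s) (hxy : x / s ≤ y)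
    (hb : 0 ≤ b) (hb₁ : b ≤ b₁) : y ^ (-b) ≤ s ^ b₁ * x ^ (-b) := by
  have hs0 : 0 < s := one_pos.trans_le hs
  calc y ^ (-b) ≤ (x / s) ^ (-b) :=
        Real.rpow_le_rpow_of_nonpos (by positivity) hxy (by linarith)
    _ = s ^ b * x ^ (-b) := by
        rw [Real.div_rpow hx.le hs0.le, Real.rpow_neg hs0.le, div_inv_eq_mul, mul_comm]
    _ ≤ _ := by
        gcongr

/-- The polynomial rate satisfies the renewal-type inequality. -/
theorem exists_polynomial_rate {c Q b₀ b₁ : ℝ} (hc : 0 < c) (hc1 : c ≤ 1) (hQ : 0 ≤ Q)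
    (hb₀ : 0 < b₀) (hb : b₀ ≤ b₁) (M : ℕ) :
    ∃ C : ℝ, 1 ≤ C ∧ ∀ b, b₀ ≤ b → b ≤ b₁ → ∀ T D : ℕ → ℝ,
      (∀ k : ℕ, T k = Q * ((k : ℝ) + 1) ^ (-b)) →
      (∀ n : ℕ, D n = min 1 (C * ((n : ℝ) + 1) ^ (-b))) →
      ∀ n, 1 ≤ D n ∨ (1 - c) * D (n - M) +
        2 * ∑ k ∈ Finset.range (n - M), T k * (D (n - M - (k + 1)) - D (n - M - k)) ≤ D n := by
  have hb₁ : 0 < b₁ := hb₀.trans_le hb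
  -- Chosen so that `(1 - c + ε) + 2 * Q * ε + c / 2 = 1`. The three terms will bound the contracted
  -- term, the early part of the sum and its late part, each relative to `D n`.
  set ε : ℝ := c / (2 * (1 + 2 * Q)) with hε
  have hε0 : 0 < ε := by positivity
  set s : ℝ := (1 + ε) ^ (1 / b₁) with hs
  have hs1 : 1 < s := Real.one_lt_rpow (by linarith) (by positivity)
  have hs0 : 0 < s := by linarith
  have hsb : s ^ b₁ = 1 + ε := by
    rw [hs, ← Real.rpow_mul (by linarith), one_div, inv_mul_cancel₀ hb₁.ne', Real.rpow_one]
  have hd : 0 < (1 - 1 / s) / 2 := by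
    have : 1 / s < 1 := by rw [div_lt_one hs0]; exact hs1
    linarith
  -- With `k₀ = n / A` and `n ≥ n₀`, the delay `M + k₀` is at most `(1 - 1 / s) * (n + 1)`. It then
  -- inflates the power by at most `s ^ b₁ = 1 + ε`.
  obtain ⟨A, hA⟩ := exists_nat_gt (((1 - 1 / s) / 2)⁻¹)
  have hA0 : (0 : ℝ) < A := (inv_pos.2 hd).trans hA
  have hAd : 1 / (A : ℝ) ≤ (1 - 1 / s) / 2 := by
    rw [one_div]
    exact inv_le_of_inv_le₀ hd hA.le
  obtain ⟨n₀, hn₀⟩ := exists_nat_gt ((M : ℝ) / ((1 - 1 / s) / 2))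
  rw [div_lt_iff₀ hd] at hn₀
  -- The first summand forces `1 ≤ D n` for `n < n₀`; the second gives `2 * T k₀ ≤ c / 2 * D n`.
  refine ⟨((n₀ : ℝ) + 1) ^ b₁ + 4 * Q * (A : ℝ) ^ b₁ / c, ?_, ?_⟩
  · have h1 : (1 : ℝ) ≤ ((n₀ : ℝ) + 1) ^ b₁ :=
      Real.one_le_rpow (by have : (0 : ℝ) ≤ n₀ := n₀.cast_nonneg; linarith) hb₁.le
    have h2 : 0 ≤ 4 * Q * (A : ℝ) ^ b₁ / c := by positivity
    linarith
  set C : ℝ := ((n₀ : ℝ) + 1) ^ b₁ + 4 * Q * (A : ℝ) ^ b₁ / c with hC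
  have hC0 : 0 < C := by positivity
  intro b hbl hbu T D hT hD n
  have hbp : 0 < b := hb₀.trans_le hbl
  have hpow : Antitone fun n : ℕ => ((n : ℝ) + 1) ^ (-b) := fun i j hij =>
    Real.rpow_le_rpow_of_nonpos (by positivity)
      (by have : (i : ℝ) ≤ j := Nat.cast_le.2 hij
          linarith) (by linarith)
  have hDanti : Antitone D := fun i j hij => by
    rw [hD, hD]
    exact min_le_min le_rfl (mul_le_mul_of_nonneg_left (hpow hij) hC0.le)
  have hTanti : Antitone T := fun i j hij => by
    rw [hT, hT]
    exact mul_le_mul_of_nonneg_left (hpow hij) hQ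
  have hT0 : ∀ k, 0 ≤ T k := fun k => by rw [hT]; positivity
  have hn1 : (0 : ℝ) < (n : ℝ) + 1 := by positivity
  by_cases hlarge : 1 ≤ C * ((n : ℝ) + 1) ^ (-b)
  · left
    rw [hD]
    exact le_min le_rfl hlarge
  right
  rw [not_le] at hlarge
  have hDn : D n = C * ((n : ℝ) + 1) ^ (-b) := by rw [hD, min_eq_right hlarge.le]
  have hDn0 : 0 < D n := by rw [hDn]; positivity
  have hn : (n₀ : ℝ) ≤ n := by
    by_contra hcon
    rw [not_le] at hcon
    have h1 : C < ((n : ℝ) + 1) ^ b := by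
      rwa [Real.rpow_neg hn1.le, ← div_eq_mul_inv, div_lt_one (by positivity)] at hlarge
    have h2 : ((n : ℝ) + 1) ^ b ≤ ((n : ℝ) + 1) ^ b₁ :=
      Real.rpow_le_rpow_of_exponent_le (by have : (0 : ℝ) ≤ n := n.cast_nonneg; linarith) hbu
    have h3 : ((n : ℝ) + 1) ^ b₁ ≤ ((n₀ : ℝ) + 1) ^ b₁ :=
      Real.rpow_le_rpow hn1.le (by linarith) hb₁.le
    have h4 : 0 ≤ 4 * Q * (A : ℝ) ^ b₁ / c := by positivity
    linarith
  set k₀ := n / A with hk₀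
  have hsplit := sum_mul_sub_le_split (a := fun k => D (n - M - k)) hTanti
    (fun i j hij => hDanti (by omega)) hT0 k₀ (n - M)
  simp only [Nat.sub_zero, Nat.sub_self] at hsplit
  have hD1 : ∀ k, D k ≤ 1 := fun k => by rw [hD]; exact min_le_left _ _
  have hDnn : ∀ k, 0 ≤ D k := fun k => by rw [hD]; positivity
  have hkey : D (n - M - k₀) ≤ (1 + ε) * D n := by
    have h1 : ((n : ℝ) + 1) / s ≤ ((n - M - k₀ : ℕ) : ℝ) + 1 := by
      have h2 : (n : ℝ) - M - k₀ ≤ ((n - M - k₀ : ℕ) : ℝ) := by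
        have : n ≤ (n - M - k₀) + M + k₀ := by omega
        have : (n : ℝ) ≤ ((n - M - k₀ : ℕ) : ℝ) + M + k₀ := by exact_mod_cast this
        linarith
      have h3 : (k₀ : ℝ) ≤ n / A := Nat.cast_div_le
      have h4 : (n : ℝ) / A ≤ (1 - 1 / s) / 2 * ((n : ℝ) + 1) := by
        rw [div_eq_mul_one_div, mul_comm]
        exact mul_le_mul hAd (by linarith) n.cast_nonneg hd.le
      have h5 : (M : ℝ) ≤ (1 - 1 / s) / 2 * ((n : ℝ) + 1) := by
        have := mul_le_mul_of_nonneg_right hn hd.le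
        linarith
      have h6 : ((n : ℝ) + 1) / s = (1 / s) * ((n : ℝ) + 1) := by ring
      rw [h6]
      linarith
    have h7 := rpow_neg_le_mul_of_div_le hn1 hs1.le h1 hbp.le hbu
    rw [hsb] at h7
    rw [hDn, hD]
    refine (min_le_right _ _).trans ?_
    have := mul_le_mul_of_nonneg_left h7 hC0.le
    linarith
  have hTk : 2 * T k₀ ≤ c / 2 * D n := by
    have hAn : 0 < A := by exact_mod_cast hA0
    have hA1 : (1 : ℝ) ≤ A := by exact_mod_cast hAn
    have h1 : ((n : ℝ) + 1) / A ≤ (k₀ : ℝ) + 1 := by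
      rw [div_le_iff₀ hA0]
      have : n + 1 ≤ (k₀ + 1) * A := by
        have := Nat.lt_div_mul_add (a := n) hAn
        rw [hk₀, add_mul, one_mul]
        omega
      exact_mod_cast this
    have h2 := rpow_neg_le_mul_of_div_le hn1 hA1 h1 hbp.le hbu
    have h3 : 4 * Q * (A : ℝ) ^ b₁ / c ≤ C := by
      have : 0 ≤ ((n₀ : ℝ) + 1) ^ b₁ := by positivity
      linarith
    rw [div_le_iff₀ hc] at h3
    have h4 : 0 ≤ ((n : ℝ) + 1) ^ (-b) := by positivity
    rw [hT, hDn]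
    have h5 := mul_le_mul_of_nonneg_left h2 hQ
    have h6 := mul_le_mul_of_nonneg_right h3 h4
    linarith
  have hmn : D n ≤ D (n - M) := hDanti (by omega)
  have hmk : D (n - M) ≤ D (n - M - k₀) := hDanti (Nat.sub_le _ _)
  have hTzero : T 0 = Q := by rw [hT]; simp
  have hε2 : ε * (2 * (1 + 2 * Q)) = c := div_mul_cancel₀ _ (by positivity)
  rw [hTzero] at hsplit
  have h1 : Q * (D (n - M - k₀) - D (n - M)) ≤ Q * (ε * D n) :=
    mul_le_mul_of_nonneg_left (by linarith) hQ
  have h2 : T k₀ * (D 0 - D (n - M)) ≤ T k₀ :=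
    mul_le_of_le_one_right (hT0 _) (by linarith [hD1 0, hDnn (n - M)])
  have h3 : (1 - c) * D (n - M) ≤ (1 - c) * ((1 + ε) * D n) :=
    mul_le_mul_of_nonneg_left (hmk.trans hkey) (by linarith)
  have h4 : (1 - c) * ((1 + ε) * D n) ≤ (1 - c + ε) * D n := by
    rw [← mul_assoc]
    exact mul_le_mul_of_nonneg_right (by linarith [mul_pos hc hε0]) hDn0.le
  have h5 : ε * (2 * (1 + 2 * Q)) * D n = c * D n := by rw [hε2]
  linarith

/-- The (stretched) exponential rate satisfies the renewal-type inequality. -/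
theorem exists_exponential_rate {c Q a γ₀ : ℝ} (hc : 0 < c) (hQ : 0 ≤ Q) (ha : 0 < a)
    (hγ₀ : 0 < γ₀) (M : ℕ) :
    ∃ B : ℝ, 0 < B ∧ ∀ γ, γ₀ ≤ γ → γ ≤ 1 → ∀ T D : ℕ → ℝ,
      (∀ k : ℕ, T k = Q * Real.exp (-a * ((k : ℝ) + 1) ^ γ)) →
      (∀ n : ℕ, D n = Real.exp (B * M) * Real.exp (-B * (n : ℝ) ^ γ)) →
      ∀ n, 1 ≤ D n ∨ (1 - c) * D (n - M) +
        2 * ∑ k ∈ Finset.range (n - M), T k * (D (n - M - (k + 1)) - D (n - M - k)) ≤ D n := by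
  have hsum := summable_exp_neg_mul_rpow (half_pos ha) hγ₀
  set S := ∑' n : ℕ, Real.exp (-(a / 2) * ((n : ℝ) + 1) ^ γ₀) with hS
  have hS0 : 0 ≤ S := tsum_nonneg fun n => (Real.exp_pos _).le
  -- `B ≤ a / 2` leaves half of the decay of `T` to make the sum converge, with value at most `B * Q
  -- * S * D m`. The other bound gives `B * (2 * Q * S + M) ≤ c`, so the gain `c` pays for the sum
  -- and for the delay `M`.
  refine ⟨min (a / 2) (c / (2 * (Q * S) + M + 1)), by positivity, ?_⟩
  set B := min (a / 2) (c / (2 * (Q * S) + M + 1)) with hB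
  have hB0 : 0 < B := by positivity
  have hBa : B ≤ a / 2 := min_le_left _ _
  have hBc : B * (2 * (Q * S) + M) ≤ c := by
    have h1 : B ≤ c / (2 * (Q * S) + M + 1) := min_le_right _ _
    rw [le_div_iff₀ (by positivity)] at h1
    linarith
  intro γ hγl hγ1 T D hT hD n
  have hγ : 0 < γ := hγ₀.trans_le hγl
  have hMγ : (M : ℝ) ^ γ ≤ M := by
    rcases Nat.eq_zero_or_pos M with h | h
    · rw [h, Nat.cast_zero, Real.zero_rpow hγ.ne']
    · calc (M : ℝ) ^ γ ≤ (M : ℝ) ^ (1 : ℝ) :=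
            Real.rpow_le_rpow_of_exponent_le (by exact_mod_cast h) hγ1
        _ = M := Real.rpow_one _
  have hD0 : ∀ n, 0 < D n := fun n => by rw [hD]; positivity
  rcases le_total n M with hnM | hnM
  -- The prefactor `exp (B * M)` in `D` covers exactly this range, because `M ^ γ ≤ M`.
  · left
    rw [hD, ← Real.exp_add]
    refine Real.one_le_exp ?_
    have h1 : (n : ℝ) ^ γ ≤ (M : ℝ) ^ γ :=
      Real.rpow_le_rpow n.cast_nonneg (Nat.cast_le.2 hnM) hγ.le
    nlinarith
  right
  obtain ⟨m, rfl⟩ : ∃ m, n = m + M := ⟨n - M, by omega⟩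
  rw [Nat.add_sub_cancel]
  -- Subadditivity of `x ↦ x ^ γ` is used twice: one step of `D` loses at most a fraction `B`, and
  -- going back `k + 1` steps costs `exp (B * (k + 1) ^ γ)`, which `T k` absorbs.
  have hstep : ∀ k ∈ Finset.range m, T k * (D (m - (k + 1)) - D (m - k)) ≤
      B * Q * D m * Real.exp (-(a / 2) * ((k : ℝ) + 1) ^ γ₀) := by
    intro k hk
    have hkm := Finset.mem_range.1 hk
    obtain ⟨j, hj⟩ : ∃ j, m = j + (k + 1) := ⟨m - (k + 1), by omega⟩
    have e1 : m - (k + 1) = j := by omega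
    have e2 : m - k = j + 1 := by omega
    rw [e1, e2]
    have hj0 : (0 : ℝ) ≤ j := j.cast_nonneg
    have hk0 : (0 : ℝ) ≤ (k : ℝ) + 1 := by positivity
    have h1 : D j - D (j + 1) ≤ B * D j := by
      have h2 : ((j + 1 : ℕ) : ℝ) ^ γ ≤ (j : ℝ) ^ γ + 1 := by
        have := add_rpow_le hj0 zero_le_one hγ.le hγ1
        rw [Real.one_rpow] at this
        exact_mod_cast this
      have h3 : D j * (1 - B) ≤ D (j + 1) := by
        rw [hD (j + 1), hD j, mul_assoc]
        refine mul_le_mul_of_nonneg_left ?_ (Real.exp_pos _).le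
        calc Real.exp (-B * (j : ℝ) ^ γ) * (1 - B)
            ≤ Real.exp (-B * (j : ℝ) ^ γ) * Real.exp (-B) := by
              gcongr
              linarith [Real.add_one_le_exp (-B)]
          _ ≤ _ := by
              rw [← Real.exp_add]
              refine Real.exp_le_exp.2 ?_
              nlinarith
      linarith
    have h4 : D j ≤ D m * Real.exp (B * ((k : ℝ) + 1) ^ γ) := by
      rw [hD j, hD m, mul_assoc]
      refine mul_le_mul_of_nonneg_left ?_ (Real.exp_pos _).le
      rw [← Real.exp_add]
      refine Real.exp_le_exp.2 ?_
      have h5 := add_rpow_le hj0 hk0 hγ.le hγ1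
      have h6 : (m : ℝ) = j + ((k : ℝ) + 1) := by rw [hj]; push_cast; ring
      rw [h6]
      have := mul_le_mul_of_nonneg_left h5 hB0.le
      linarith
    have h7 : Real.exp (-a * ((k : ℝ) + 1) ^ γ) * Real.exp (B * ((k : ℝ) + 1) ^ γ) ≤
        Real.exp (-(a / 2) * ((k : ℝ) + 1) ^ γ₀) := by
      rw [← Real.exp_add]
      refine Real.exp_le_exp.2 ?_
      have h8 : ((k : ℝ) + 1) ^ γ₀ ≤ ((k : ℝ) + 1) ^ γ :=
        Real.rpow_le_rpow_of_exponent_le (by have : (0 : ℝ) ≤ k := k.cast_nonneg; linarith) hγl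
      have h9 : 0 ≤ ((k : ℝ) + 1) ^ γ := Real.rpow_nonneg hk0 _
      nlinarith
    rw [hT]
    calc Q * Real.exp (-a * ((k : ℝ) + 1) ^ γ) * (D j - D (j + 1))
        ≤ Q * Real.exp (-a * ((k : ℝ) + 1) ^ γ) *
            (B * (D m * Real.exp (B * ((k : ℝ) + 1) ^ γ))) := by
          gcongr
          exact h1.trans (by gcongr)
      _ = B * Q * D m * (Real.exp (-a * ((k : ℝ) + 1) ^ γ) *
            Real.exp (B * ((k : ℝ) + 1) ^ γ)) := by ring
      _ ≤ _ := by
          have := (hD0 m).le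
          gcongr
  have htot : ∑ k ∈ Finset.range m, T k * (D (m - (k + 1)) - D (m - k)) ≤ B * Q * D m * S := by
    refine (Finset.sum_le_sum hstep).trans ?_
    rw [← Finset.mul_sum]
    have := (hD0 m).le
    gcongr
    exact hsum.sum_le_tsum _ fun _ _ => (Real.exp_pos _).le
  have hlast : D m * (1 - B * M) ≤ D (m + M) := by
    rw [hD (m + M), hD m, mul_assoc]
    refine mul_le_mul_of_nonneg_left ?_ (Real.exp_pos _).le
    have h1 := add_rpow_le m.cast_nonneg M.cast_nonneg hγ.le hγ1 (x := (m : ℝ)) (y := (M : ℝ))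
    calc Real.exp (-B * (m : ℝ) ^ γ) * (1 - B * M)
        ≤ Real.exp (-B * (m : ℝ) ^ γ) * Real.exp (-(B * M)) := by
          gcongr
          linarith [Real.add_one_le_exp (-(B * M))]
      _ ≤ _ := by
          rw [← Real.exp_add]
          refine Real.exp_le_exp.2 ?_
          push_cast
          nlinarith
  have h1 := mul_le_mul_of_nonneg_right hBc (hD0 m).le
  nlinarith

end Numerics

end YoungTower

namespace YoungTower

/-! ### Uniformity in the parameters and continuity of the constants -/

section Uniform

open Filter Topology

/-- Finite sets of integers with greatest common divisor `1` and bounded elements generate all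
large integers, uniformly. -/
theorem exists_forall_mem_closure_of_sup_eq (N : ℕ) :
    ∃ N₁, ∀ I : Finset ℕ, I.sup id = N → I.gcd id = 1 →
      ∀ n, N₁ ≤ n → n ∈ AddSubmonoid.closure (I : Set ℕ) := by
  have h : ∀ I : Finset ℕ, ∃ n₀, I.gcd id = 1 →
      ∀ n, n₀ ≤ n → n ∈ AddSubmonoid.closure (I : Set ℕ) := fun I => by
    obtain ⟨n₀, hn₀⟩ := Nat.exists_mem_closure_of_ge (I : Set ℕ)
    refine ⟨n₀, fun hI n hn => hn₀ n hn ?_⟩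
    have h1 : Nat.setGcd (I : Set ℕ) ∣ I.gcd id :=
      Finset.dvd_gcd fun i hi => Nat.setGcd_dvd_of_mem (by exact_mod_cast hi)
    rw [hI] at h1
    exact h1.trans (one_dvd n)
  choose n₀ hn₀ using h
  -- Only finitely many sets `I` have maximum `N`, so the largest threshold serves them all.
  refine ⟨(Finset.range (N + 1)).powerset.sup n₀, fun I hIN hI n hn => hn₀ I hI n ?_⟩
  refine le_trans (Finset.le_sup (f := n₀) (Finset.mem_powerset.2 fun i hi => ?_)) hn
  have : i ≤ I.sup id := Finset.le_sup (f := id) hi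
  rw [Finset.mem_range]
  omega

/-- With `q = lam₀ ^ (-η₀) < 1` the worst contraction factor, `R` solves `R * (1 - q) = 2 * K₀ + 1`.
Then `R' = R * q + K₀` lies below `R` by `K₀ + 1`. -/
theorem exists_uniform_log_holder_constants {lam₀ K₀ η₀ : ℝ} (hlam : 1 < lam₀) (hK : 0 < K₀)
    (hη : 0 < η₀) :
    ∃ R R' : ℝ, 0 ≤ R' ∧ R' < R ∧ 1 ≤ R ∧ ∀ lam K η : ℝ, lam₀ ≤ lam → K ≤ K₀ → η₀ ≤ η →
      R * lam ^ (-η) + K ≤ R' := by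
  have hlam0 : 0 < lam₀ := by linarith
  set q := lam₀ ^ (-η₀) with hq
  have hq0 : 0 < q := Real.rpow_pos_of_pos hlam0 _
  have hq1 : q < 1 := Real.rpow_lt_one_of_one_lt_of_neg hlam (by linarith)
  have h1q : 0 < 1 - q := by linarith
  have hR : 1 ≤ (2 * K₀ + 1) / (1 - q) := by rw [le_div_iff₀ h1q]; linarith
  refine ⟨(2 * K₀ + 1) / (1 - q), (2 * K₀ + 1) / (1 - q) * q + K₀, by positivity, ?_, hR, ?_⟩
  · have h2 : (2 * K₀ + 1) / (1 - q) * (1 - q) = 2 * K₀ + 1 := div_mul_cancel₀ _ h1q.ne'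
    linarith
  · intro lam K η h1 h2 h3
    have h4 : lam ^ (-η) ≤ q := by
      calc lam ^ (-η) ≤ lam₀ ^ (-η) := Real.rpow_le_rpow_of_nonpos hlam0 h1 (by linarith)
        _ ≤ _ := Real.rpow_le_rpow_of_exponent_le hlam.le (by linarith)
    have := mul_le_mul_of_nonneg_left h4 (by linarith : 0 ≤ (2 * K₀ + 1) / (1 - q))
    linarith

/-- Decay of the transfer operator at a rate that satisfies a renewal-type inequality, with
constants that are uniform over the systems with given bounds on the parameters. -/
theorem exists_uniform_renewal {lam₀ K₀ η₀ δ₀ : ℝ} (hlam : 1 < lam₀) (hK : 0 < K₀) (hη : 0 < η₀)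
    (hδ : 0 < δ₀) (N : ℕ) :
    ∃ E : ℝ, 0 < E ∧ ∀ T₀ : ℕ → ℝ, Tendsto T₀ atTop (𝓝 0) → ∃ (M : ℕ) (c : ℝ), 0 < c ∧ c ≤ 1 / 2 ∧
      ∀ (Y : Type u) [MetricSpace Y] [MeasurableSpace Y] (m : Measure Y) (F : Y → Y)
        (α : Set (Set Y)) (lam K η : ℝ) (τ : Y → ℕ) (I : Finset ℕ) (δ : ℝ),
        IsUniformlyExpanding m F α lam K η → ∀ hτ : IsReturnTime m α τ, IsMixingData m τ I δ →
        lam₀ ≤ lam → K ≤ K₀ → η₀ ≤ η → δ₀ ≤ δ → I.sup id = N →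
        ∀ T D : ℕ → ℝ, (∀ k, 0 ≤ T k) → (∀ k, T k ≤ T₀ k) →
        (∀ k n, E * ∑ j ∈ Finset.range n, m.real {y | k + 1 + j ≤ τ y} ≤ T k) →
        Antitone D → (∀ n, 0 ≤ D n) → 1 ≤ D 0 →
        (∀ n, 1 ≤ D n ∨ (1 - c) * D (n - M) + 2 * ∑ k ∈ Finset.range (n - M),
          T k * (D (n - M - (k + 1)) - D (n - M - k)) ≤ D n) →
        ∀ φ : Tower τ → ℝ, AEMeasurable φ (towerMeasure m τ) → holderNorm τ η φ < ∞ →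
          ∫ x, φ x ∂towerMeasure m τ = 0 → ∀ n : ℕ,
          Integrable ((transferOperator (towerMeasure m τ) (towerMap F τ hτ.pos))^[n] φ)
            (towerMeasure m τ) ∧
          ∫ x, |(transferOperator (towerMeasure m τ) (towerMap F τ hτ.pos))^[n] φ x|
            ∂towerMeasure m τ ≤ 8 * D n * (holderNorm τ η φ).toReal := by
  obtain ⟨R, R', hR', hR, hR1, hRR'⟩ := exists_uniform_log_holder_constants hlam hK hη
  obtain ⟨N₁, hN₁⟩ := exists_forall_mem_closure_of_sup_eq N
  -- The order of choices avoids a circle: `E` is fixed by `R`, the worst-case tail `T₀` may depend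
  -- on `E`, and it determines `L`, hence `M` and `c`; only then is `D` built. The tail `T` of an
  -- individual system may be smaller than `T₀` and sets its own rate.
  refine ⟨Real.exp R, Real.exp_pos R, fun T₀ hT₀ => ?_⟩
  obtain ⟨L, hL⟩ := ((tendsto_order.1 hT₀).2 (1 / 2) (by norm_num)).exists
  set c₀ := Real.exp (-R') * ((R - R') / (R * Real.exp R)) *
    ((Real.exp (-R) * δ₀) ^ (L + N₁) * (1 / 2)) with hc₀
  have hRp : 0 < R := by linarith
  have hc₀p : 0 < c₀ := by
    have := sub_pos.2 hR
    positivity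
  refine ⟨L + N₁ + 1, min (1 / 2) c₀, by positivity, min_le_left _ _, ?_⟩
  intro Y _ _ m F α lam K η τ I δ hF hτ hI h1 h2 h3 h4 h5 T D hT0 hTT hT hD hDnn hD0 hrec φ hφ
    hφn h0 n
  have hI' : IsMixingData m τ I δ₀ :=
    ⟨hδ, hI.pos, hI.gcd_eq_one, fun i hi => h4.trans (hI.le_measure i hi)⟩
  exact integral_abs_iterate_transferOperator_le hF hτ hI' hR' hR (hRR' lam K η h1 h2 h3) hR1
    (hN₁ I h5 hI.gcd_eq_one) hT0 hT ((hTT L).trans hL.le) (by positivity) (min_le_left _ _)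
    (min_le_right _ _) hD hDnn hD0 hrec hφ hφn h0 n

/-- All systems with the given parameters and polynomial tails mix at a polynomial rate with the
constant `C`. -/
def HasPolynomialDecay (lam K η : ℝ) (N : ℕ) (δ β Cτ C : ℝ) : Prop :=
  ∀ (Y : Type u) [MetricSpace Y] [MeasurableSpace Y] (m : Measure Y) (F : Y → Y)
    (α : Set (Set Y)) (τ : Y → ℕ) (I : Finset ℕ),
    IsUniformlyExpanding m F α lam K η → ∀ hτ : IsReturnTime m α τ, IsMixingData m τ I δ →
    I.sup id = N →
    (∀ n : ℕ, 0 < n → m.real {y | n ≤ τ y} ≤ Cτ * (n : ℝ) ^ (-β)) →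
    ∀ φ : Tower τ → ℝ, AEMeasurable φ (towerMeasure m τ) → holderNorm τ η φ < ∞ →
      ∫ x, φ x ∂towerMeasure m τ = 0 → ∀ n : ℕ, 0 < n →
      Integrable ((transferOperator (towerMeasure m τ) (towerMap F τ hτ.pos))^[n] φ)
        (towerMeasure m τ) ∧
      ∫ x, |(transferOperator (towerMeasure m τ) (towerMap F τ hτ.pos))^[n] φ x|
        ∂towerMeasure m τ ≤ C * (holderNorm τ η φ).toReal * (n : ℝ) ^ (-(β - 1))

/-- Summing the tails of `τ` costs one power, so residual times have tails of order `k ^ (-(β -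
1))`, and the renewal-type inequality passes this exponent on to `D`. The worst exponent `β₀` fixes
`M` and `c`; the decay itself is obtained with the actual `β`. -/
theorem exists_hasPolynomialDecay {lam₀ K₀ η₀ δ₀ β₀ β₁ C₀ : ℝ} (hlam : 1 < lam₀) (hK : 0 < K₀)
    (hη : 0 < η₀) (hδ : 0 < δ₀) (hβ₀ : 1 < β₀) (hβ : β₀ ≤ β₁) (hC₀ : 0 < C₀) (N : ℕ) :
    ∃ C : ℝ, 0 < C ∧ ∀ lam K η δ β Cτ : ℝ, lam₀ ≤ lam → K ≤ K₀ → η₀ ≤ η → δ₀ ≤ δ → β₀ ≤ β →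
      β ≤ β₁ → Cτ ≤ C₀ → HasPolynomialDecay.{u} lam K η N δ β Cτ C := by
  obtain ⟨E, hE, hren⟩ := exists_uniform_renewal.{u} hlam hK hη hδ N
  have hb₀ : 0 < β₀ - 1 := by linarith
  set Q := E * (C₀ * (2 ^ β₁ / (β₀ - 1))) with hQ
  have hQ0 : 0 < Q := by positivity
  obtain ⟨M, c, hc, hc1, hren⟩ := hren (fun k => Q * ((k : ℝ) + 1) ^ (-(β₀ - 1))) (by
    rw [← mul_zero Q]
    exact ((tendsto_rpow_neg_atTop hb₀).comp
      (tendsto_atTop_add_const_right _ _ tendsto_natCast_atTop_atTop)).const_mul Q)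
  obtain ⟨C, hC1, hC⟩ := exists_polynomial_rate hc (by linarith) hQ0.le hb₀
    (by linarith : β₀ - 1 ≤ β₁ - 1) M
  have hC0 : 0 < C := by linarith
  refine ⟨8 * C, by positivity, ?_⟩
  intro lam K η δ β Cτ h1 h2 h3 h4 h5 h6 h7 Y _ _ m F α τ I hF hτ hI hIN htail φ hφ hφn h0 n hn
  set b := β - 1 with hb
  have hbp : 0 < b := by rw [hb]; linarith
  have hpow : Antitone fun n : ℕ => ((n : ℝ) + 1) ^ (-b) := fun i j hij =>
    Real.rpow_le_rpow_of_nonpos (by positivity)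
      (by have : (i : ℝ) ≤ j := Nat.cast_le.2 hij
          linarith) (by linarith)
  have hT : ∀ k n : ℕ, E * ∑ j ∈ Finset.range n, m.real {y | k + 1 + j ≤ τ y} ≤
      Q * ((k : ℝ) + 1) ^ (-b) := fun k n => by
    have hk1 : (1 : ℝ) ≤ (k : ℝ) + 1 := by
      have : (0 : ℝ) ≤ k := k.cast_nonneg
      linarith
    have hsum : ∑ j ∈ Finset.range n, m.real {y | k + 1 + j ≤ τ y} ≤
        C₀ * (2 ^ β₁ / (β₀ - 1)) * ((k : ℝ) + 1) ^ (-b) := by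
      calc ∑ j ∈ Finset.range n, m.real {y | k + 1 + j ≤ τ y}
          ≤ ∑ j ∈ Finset.range n, C₀ * (((k : ℝ) + 1) + j) ^ (-(b + 1)) := by
            refine Finset.sum_le_sum fun j _ => (htail _ (by omega)).trans ?_
            have e : (((k + 1 + j : ℕ) : ℝ)) ^ (-β) = (((k : ℝ) + 1) + j) ^ (-(b + 1)) := by
              rw [hb, sub_add_cancel]
              push_cast
              rfl
            rw [e]
            gcongr
        _ ≤ C₀ * (2 ^ (b + 1) / b * ((k : ℝ) + 1) ^ (-b)) := by
            rw [← Finset.mul_sum]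
            exact mul_le_mul_of_nonneg_left (sum_rpow_neg_le hbp hk1 n) hC₀.le
        _ ≤ _ := by
            rw [← mul_assoc]
            gcongr
            · exact one_le_two
            · rw [hb]; linarith
            · rw [hb]; linarith
    calc _ ≤ E * (C₀ * (2 ^ β₁ / (β₀ - 1)) * ((k : ℝ) + 1) ^ (-b)) := by gcongr
      _ = _ := by rw [hQ]; ring
  have key := hren Y m F α lam K η τ I δ hF hτ hI h1 h2 h3 h4 hIN
    (fun k => Q * ((k : ℝ) + 1) ^ (-b)) (fun n => min 1 (C * ((n : ℝ) + 1) ^ (-b)))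
    (fun k => by positivity)
    (fun k => by
      have hk1 : (1 : ℝ) ≤ (k : ℝ) + 1 := by
        have : (0 : ℝ) ≤ k := k.cast_nonneg
        linarith
      exact mul_le_mul_of_nonneg_left
        (Real.rpow_le_rpow_of_exponent_le hk1 (by rw [hb]; linarith)) hQ0.le)
    hT
    (fun i j hij => min_le_min le_rfl (mul_le_mul_of_nonneg_left (hpow hij) hC0.le))
    (fun n => by positivity)
    (by simpa using hC1)
    (hC b (by rw [hb]; linarith) (by rw [hb]; linarith) _ _ (fun k => rfl) fun n => rfl)
    φ hφ hφn h0 n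
  refine ⟨key.1, key.2.trans ?_⟩
  have hn0 : (0 : ℝ) < n := by exact_mod_cast hn
  have h8 : min 1 (C * ((n : ℝ) + 1) ^ (-b)) ≤ C * (n : ℝ) ^ (-b) :=
    (min_le_right _ _).trans (mul_le_mul_of_nonneg_left
      (Real.rpow_le_rpow_of_nonpos hn0 (by linarith) (by linarith)) hC0.le)
  have h9 : 0 ≤ (holderNorm τ η φ).toReal := ENNReal.toReal_nonneg
  calc 8 * min 1 (C * ((n : ℝ) + 1) ^ (-b)) * (holderNorm τ η φ).toReal
      ≤ 8 * (C * (n : ℝ) ^ (-b)) * (holderNorm τ η φ).toReal := by gcongr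
    _ = _ := by ring

/-- All systems with the given parameters and (stretched) exponential tails mix at a (stretched)
exponential rate with the constants `B` and `C`. -/
def HasExponentialDecay (lam K η : ℝ) (N : ℕ) (δ A γ Cτ B C : ℝ) : Prop :=
  ∀ (Y : Type u) [MetricSpace Y] [MeasurableSpace Y] (m : Measure Y) (F : Y → Y)
    (α : Set (Set Y)) (τ : Y → ℕ) (I : Finset ℕ),
    IsUniformlyExpanding m F α lam K η → ∀ hτ : IsReturnTime m α τ, IsMixingData m τ I δ →
    I.sup id = N →
    (∀ n : ℕ, 0 < n → m.real {y | n ≤ τ y} ≤ Cτ * Real.exp (-A * (n : ℝ) ^ γ)) →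
    ∀ φ : Tower τ → ℝ, AEMeasurable φ (towerMeasure m τ) → holderNorm τ η φ < ∞ →
      ∫ x, φ x ∂towerMeasure m τ = 0 → ∀ n : ℕ,
      Integrable ((transferOperator (towerMeasure m τ) (towerMap F τ hτ.pos))^[n] φ)
        (towerMeasure m τ) ∧
      ∫ x, |(transferOperator (towerMeasure m τ) (towerMap F τ hτ.pos))^[n] φ x|
        ∂towerMeasure m τ ≤ C * (holderNorm τ η φ).toReal * Real.exp (-B * (n : ℝ) ^ γ)

theorem exists_hasExponentialDecay {lam₀ K₀ η₀ δ₀ A₀ γ₀ C₀ : ℝ} (hlam : 1 < lam₀) (hK : 0 < K₀)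
    (hη : 0 < η₀) (hδ : 0 < δ₀) (hA₀ : 0 < A₀) (hγ₀ : 0 < γ₀) (hC₀ : 0 < C₀) (N : ℕ) :
    ∃ B C : ℝ, 0 < B ∧ 0 < C ∧ ∀ lam K η δ A γ Cτ : ℝ, lam₀ ≤ lam → K ≤ K₀ → η₀ ≤ η → δ₀ ≤ δ →
      A₀ ≤ A → γ₀ ≤ γ → γ ≤ 1 → Cτ ≤ C₀ → HasExponentialDecay.{u} lam K η N δ A γ Cτ B C := by
  obtain ⟨E, hE, hren⟩ := exists_uniform_renewal.{u} hlam hK hη hδ N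
  have ha : 0 < A₀ / 2 := half_pos hA₀
  have hsum := summable_exp_neg_mul_rpow ha hγ₀
  set S := ∑' n : ℕ, Real.exp (-(A₀ / 2) * ((n : ℝ) + 1) ^ γ₀) with hS
  have hS0 : 0 ≤ S := tsum_nonneg fun n => (Real.exp_pos _).le
  set Q := E * (C₀ * S) with hQ
  have hQ0 : 0 ≤ Q := by positivity
  obtain ⟨M, c, hc, hc1, hren⟩ := hren
    (fun k => Q * Real.exp (-(A₀ / 2) * ((k : ℝ) + 1) ^ γ₀)) (by
      rw [← mul_zero Q]
      exact hsum.tendsto_atTop_zero.const_mul Q)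
  obtain ⟨B, hB0, hB⟩ := exists_exponential_rate hc hQ0 ha hγ₀ M
  refine ⟨B, 8 * Real.exp (B * M), hB0, by positivity, ?_⟩
  intro lam K η δ A γ Cτ h1 h2 h3 h4 h5 h6 h6' h7 Y _ _ m F α τ I hF hτ hI hIN htail φ hφ hφn h0 n
  have hγ : 0 < γ := hγ₀.trans_le h6
  have hk1 : ∀ k : ℕ, (1 : ℝ) ≤ (k : ℝ) + 1 := fun k => by
    have : (0 : ℝ) ≤ k := k.cast_nonneg
    linarith
  have hγpow : ∀ k : ℕ, ((k : ℝ) + 1) ^ γ₀ ≤ ((k : ℝ) + 1) ^ γ := fun k =>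
    Real.rpow_le_rpow_of_exponent_le (hk1 k) h6
  have hT : ∀ k n : ℕ, E * ∑ j ∈ Finset.range n, m.real {y | k + 1 + j ≤ τ y} ≤
      Q * Real.exp (-(A₀ / 2) * ((k : ℝ) + 1) ^ γ) := fun k n => by
    have hs : ∑ j ∈ Finset.range n, m.real {y | k + 1 + j ≤ τ y} ≤
        C₀ * (Real.exp (-(A₀ / 2) * ((k : ℝ) + 1) ^ γ) * S) := by
      calc ∑ j ∈ Finset.range n, m.real {y | k + 1 + j ≤ τ y}
          ≤ ∑ j ∈ Finset.range n, C₀ * (Real.exp (-(A₀ / 2) * ((k : ℝ) + 1) ^ γ) *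
              Real.exp (-(A₀ / 2) * ((j : ℝ) + 1) ^ γ₀)) := by
            refine Finset.sum_le_sum fun j _ => (htail _ (by omega)).trans ?_
            rw [← Real.exp_add]
            -- Half of the exponent at `k + 1 + j` is spent on decay in `k`, the other half on
            -- summability in `j`.
            refine mul_le_mul h7 (Real.exp_le_exp.2 ?_) (Real.exp_pos _).le hC₀.le
            have g0 : ((k + 1 + j : ℕ) : ℝ) = (k : ℝ) + 1 + j := by push_cast; ring
            have g1 : ((k : ℝ) + 1) ^ γ ≤ ((k + 1 + j : ℕ) : ℝ) ^ γ := by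
              rw [g0]
              exact Real.rpow_le_rpow (by positivity) (by
                have : (0 : ℝ) ≤ j := j.cast_nonneg
                linarith) hγ.le
            have g2 : ((j : ℝ) + 1) ^ γ ≤ ((k + 1 + j : ℕ) : ℝ) ^ γ := by
              rw [g0]
              exact Real.rpow_le_rpow (by positivity) (by
                have : (0 : ℝ) ≤ k := k.cast_nonneg
                linarith) hγ.le
            have g3 := (hγpow j).trans g2
            have g4 : 0 ≤ ((k + 1 + j : ℕ) : ℝ) ^ γ := by positivity
            have g5 := mul_le_mul_of_nonneg_right h5 g4
            have g6 := mul_le_mul_of_nonneg_left g1 ha.le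
            have g7 := mul_le_mul_of_nonneg_left g3 ha.le
            linarith
        _ ≤ _ := by
            rw [← Finset.mul_sum, ← Finset.mul_sum]
            gcongr
            exact hsum.sum_le_tsum _ fun _ _ => (Real.exp_pos _).le
    calc _ ≤ E * (C₀ * (Real.exp (-(A₀ / 2) * ((k : ℝ) + 1) ^ γ) * S)) := by gcongr
      _ = _ := by rw [hQ]; ring
  have key := hren Y m F α lam K η τ I δ hF hτ hI h1 h2 h3 h4 hIN
    (fun k => Q * Real.exp (-(A₀ / 2) * ((k : ℝ) + 1) ^ γ))
    (fun n => Real.exp (B * M) * Real.exp (-B * (n : ℝ) ^ γ))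
    (fun k => by positivity)
    (fun k => mul_le_mul_of_nonneg_left (Real.exp_le_exp.2 (by
      have := mul_le_mul_of_nonneg_left (hγpow k) ha.le
      linarith)) hQ0)
    hT
    (fun i j hij => mul_le_mul_of_nonneg_left (Real.exp_le_exp.2 (by
      have := mul_le_mul_of_nonneg_left
        (Real.rpow_le_rpow i.cast_nonneg (Nat.cast_le.2 hij : (i : ℝ) ≤ j) hγ.le) hB0.le
      linarith)) (Real.exp_pos _).le)
    (fun n => by positivity)
    (by
      rw [Nat.cast_zero, Real.zero_rpow hγ.ne', mul_zero, Real.exp_zero, mul_one]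
      exact Real.one_le_exp (by positivity))
    (hB γ h6 h6' _ _ (fun k => rfl) fun n => rfl)
    φ hφ hφn h0 n
  refine ⟨key.1, key.2.trans (le_of_eq ?_)⟩
  ring

/-- A family of upward closed conditions that can be satisfied locally uniformly can be satisfied
by a positive continuous function. -/
theorem exists_continuousOn_of_locally_bounded {X : Type*} [PseudoMetricSpace X] {S : Set X}
    {P : X → ℝ → Prop} (hmono : ∀ p ∈ S, ∀ c c', 0 < c → P p c → c ≤ c' → P p c')
    (hloc : ∀ p ∈ S, ∃ c, 0 < c ∧ ∀ᶠ q in 𝓝 p, q ∈ S → P q c) :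
    ∃ f : X → ℝ, ContinuousOn f S ∧ (∀ p ∈ S, 0 < f p) ∧ ∀ p ∈ S, P p (f p) := by
  classical
  obtain ⟨g, hg⟩ := exists_continuous_forall_mem_convex_of_local_const (X := S) (E := ℝ)
    -- Upward closed sets of reals are convex, so locally constant choices can be averaged by a
    -- partition of unity.
    (t := fun p => {c | 0 < c ∧ P p c})
    (fun p => by
      refine (ordConnected_def.2 ?_).convex
      rintro c ⟨hc, hPc⟩ c' _ z ⟨hz, _⟩
      exact ⟨hc.trans_le hz, hmono p p.2 c z hc hPc hz⟩)
    (fun p => by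
      obtain ⟨c, hc, h⟩ := hloc p p.2
      refine ⟨c, ?_⟩
      filter_upwards [(continuous_subtype_val.tendsto p).eventually h] with q hq
      exact ⟨hc, hq q.2⟩)
  refine ⟨fun p => if h : p ∈ S then g ⟨p, h⟩ else 1, ?_, fun p hp => ?_, fun p hp => ?_⟩
  · rw [continuousOn_iff_continuous_domRestrict]
    refine g.continuous.congr fun p => ?_
    simp [p.2]
  · simpa [hp] using (hg ⟨p, hp⟩).1
  · simpa [hp] using (hg ⟨p, hp⟩).2

/-- At `n = 1` the tail has full mass, so positivity of `Cτ` need not be assumed. -/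
theorem pos_of_tail_le {Y : Type u} [MeasurableSpace Y] {m : Measure Y} [IsProbabilityMeasure m]
    {τ : Y → ℕ} (hτ : ∀ y, 0 < τ y) {C x : ℝ} (hx : 0 ≤ x)
    (h : m.real {y | 1 ≤ τ y} ≤ C * x) : 0 < C := by
  rw [show {y | 1 ≤ τ y} = univ from eq_univ_of_forall hτ, probReal_univ] at h
  by_contra hC
  nlinarith [mul_nonneg (neg_nonneg.2 (not_lt.1 hC)) hx]

end Uniform

end YoungTower

open YoungTower Filter Topology in
theorem mainTheorem4 :
    (∃ C : ℝ × ℝ × ℝ × ℕ × ℝ × ℝ × ℝ → ℝ,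
      ContinuousOn C YoungTower.polyParams ∧ (∀ p ∈ YoungTower.polyParams, 0 < C p) ∧
      ∀ (Y : Type u) [MetricSpace Y] [MeasurableSpace Y] (m : Measure Y) (F : Y → Y)
        (α : Set (Set Y)) (lam K η : ℝ) (τ : Y → ℕ) (I : Finset ℕ) (δ β Cτ : ℝ),
        YoungTower.IsUniformlyExpanding m F α lam K η →
        ∀ hτ : YoungTower.IsReturnTime m α τ,
        YoungTower.IsMixingData m τ I δ →
        1 < β →
        (∀ n : ℕ, 0 < n → m.real {y | n ≤ τ y} ≤ Cτ * (n : ℝ) ^ (-β)) →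
        ∀ φ : YoungTower.Tower τ → ℝ,
          AEMeasurable φ (YoungTower.towerMeasure m τ) →
          YoungTower.holderNorm τ η φ < ∞ →
          ∫ x, φ x ∂(YoungTower.towerMeasure m τ) = 0 →
          ∀ n : ℕ, 0 < n →
            Integrable ((YoungTower.transferOperator (YoungTower.towerMeasure m τ)
              (YoungTower.towerMap F τ hτ.pos))^[n] φ) (YoungTower.towerMeasure m τ) ∧
            ∫ x, |(YoungTower.transferOperator (YoungTower.towerMeasure m τ)
              (YoungTower.towerMap F τ hτ.pos))^[n] φ x| ∂(YoungTower.towerMeasure m τ) ≤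
              C (lam, K, η, I.sup id, δ, β, Cτ) * (YoungTower.holderNorm τ η φ).toReal *
                (n : ℝ) ^ (-(β - 1))) ∧
    (∃ B C : ℝ × ℝ × ℝ × ℕ × ℝ × ℝ × ℝ × ℝ → ℝ,
      ContinuousOn B YoungTower.expParams ∧ (∀ p ∈ YoungTower.expParams, 0 < B p) ∧
      ContinuousOn C YoungTower.expParams ∧ (∀ p ∈ YoungTower.expParams, 0 < C p) ∧
      ∀ (Y : Type u) [MetricSpace Y] [MeasurableSpace Y] (m : Measure Y) (F : Y → Y)
        (α : Set (Set Y)) (lam K η : ℝ) (τ : Y → ℕ) (I : Finset ℕ) (δ A γ Cτ : ℝ),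
        YoungTower.IsUniformlyExpanding m F α lam K η →
        ∀ hτ : YoungTower.IsReturnTime m α τ,
        YoungTower.IsMixingData m τ I δ →
        0 < A → 0 < γ → γ ≤ 1 →
        (∀ n : ℕ, 0 < n → m.real {y | n ≤ τ y} ≤ Cτ * Real.exp (-A * (n : ℝ) ^ γ)) →
        ∀ φ : YoungTower.Tower τ → ℝ,
          AEMeasurable φ (YoungTower.towerMeasure m τ) →
          YoungTower.holderNorm τ η φ < ∞ →
          ∫ x, φ x ∂(YoungTower.towerMeasure m τ) = 0 →
          ∀ n : ℕ,
            Integrable ((YoungTower.transferOperator (YoungTower.towerMeasure m τ)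
              (YoungTower.towerMap F τ hτ.pos))^[n] φ) (YoungTower.towerMeasure m τ) ∧
            ∫ x, |(YoungTower.transferOperator (YoungTower.towerMeasure m τ)
              (YoungTower.towerMap F τ hτ.pos))^[n] φ x| ∂(YoungTower.towerMeasure m τ) ≤
              C (lam, K, η, I.sup id, δ, A, γ, Cτ) * (YoungTower.holderNorm τ η φ).toReal *
                Real.exp (-(B (lam, K, η, I.sup id, δ, A, γ, Cτ)) * (n : ℝ) ^ γ)) := by
  constructor
  · obtain ⟨C, hCc, hC0, hC⟩ := exists_continuousOn_of_locally_bounded (S := polyParams)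
      (P := fun p c => HasPolynomialDecay.{u} p.1 p.2.1 p.2.2.1 p.2.2.2.1 p.2.2.2.2.1
        p.2.2.2.2.2.1 p.2.2.2.2.2.2 c)
      (fun p _ c c' _ h hcc Y _ _ m F α τ I hF hτ hI hIN ht φ hφ hφn h0 n hn => by
        obtain ⟨h1, h2⟩ := h Y m F α τ I hF hτ hI hIN ht φ hφ hφn h0 n hn
        refine ⟨h1, h2.trans ?_⟩
        have := ENNReal.toReal_nonneg (a := holderNorm τ p.2.2.1 φ)
        gcongr)
      (by
        rintro ⟨lam, K, η, N, δ, β, Cτ⟩ ⟨hlam, hK, hη, hη1, hδ, hβ, hCτ⟩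
        obtain ⟨C, hC0, hC⟩ := exists_hasPolynomialDecay.{u} (lam₀ := (1 + lam) / 2)
          (K₀ := K + 1) (η₀ := η / 2) (δ₀ := δ / 2) (β₀ := (1 + β) / 2) (β₁ := β + 1)
          (C₀ := Cτ + 1) (by linarith) (by linarith) (by linarith) (by linarith) (by linarith)
          (by linarith) (by linarith) N
        refine ⟨C, hC0, ?_⟩
        -- The coordinate `max I` is discrete, so it stays equal to `N` nearby; the others move in
        -- intervals on which the uniform bounds hold.
        rw [nhds_prod_eq, nhds_prod_eq, nhds_prod_eq, nhds_prod_eq, nhds_prod_eq, nhds_prod_eq]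
        filter_upwards [prod_mem_prod (Ioi_mem_nhds (by linarith : (1 + lam) / 2 < lam))
          (prod_mem_prod (Iio_mem_nhds (by linarith : K < K + 1))
          (prod_mem_prod (Ioi_mem_nhds (by linarith : η / 2 < η))
          (prod_mem_prod (mem_nhds_discrete.2 rfl : {N} ∈ 𝓝 N)
          (prod_mem_prod (Ioi_mem_nhds (by linarith : δ / 2 < δ))
          (prod_mem_prod (Ioo_mem_nhds (by linarith : (1 + β) / 2 < β) (by linarith : β < β + 1))
            (Iio_mem_nhds (by linarith : Cτ < Cτ + 1)))))))]
        rintro ⟨lam', K', η', N', δ', β', Cτ'⟩ ⟨h1, h2, h3, h4, h5, ⟨h6, h6'⟩, h7⟩ -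
        simp only [mem_Ioi, mem_Iio, mem_singleton_iff] at *
        subst h4
        exact hC _ _ _ _ _ _ h1.le h2.le h3.le h5.le h6.le h6'.le h7.le)
    refine ⟨C, hCc, hC0, ?_⟩
    intro Y _ _ m F α lam K η τ I δ β Cτ hF hτ hI hβ ht φ hφ hφn h0 n hn
    have hprob := hF.isProbabilityMeasure
    have hCτ : 0 < Cτ := pos_of_tail_le hτ.pos (x := 1) zero_le_one
      (by simpa using ht 1 one_pos)
    exact hC (lam, K, η, I.sup id, δ, β, Cτ)
      ⟨hF.one_lt_lam, hF.K_pos, hF.η_pos, hF.η_le_one, hI.δ_pos, hβ, hCτ⟩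
      Y m F α τ I hF hτ hI rfl ht φ hφ hφn h0 n hn
  -- Taking `B = c⁻¹` and `C = c` turns the two constants into a single one, for which the condition
  -- is upward closed.
  · obtain ⟨C, hCc, hC0, hC⟩ := exists_continuousOn_of_locally_bounded (S := expParams)
      (P := fun p c => HasExponentialDecay.{u} p.1 p.2.1 p.2.2.1 p.2.2.2.1 p.2.2.2.2.1
        p.2.2.2.2.2.1 p.2.2.2.2.2.2.1 p.2.2.2.2.2.2.2 c⁻¹ c)
      (fun p _ c c' hc h hcc Y _ _ m F α τ I hF hτ hI hIN ht φ hφ hφn h0 n => by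
        obtain ⟨h1, h2⟩ := h Y m F α τ I hF hτ hI hIN ht φ hφ hφn h0 n
        refine ⟨h1, h2.trans ?_⟩
        have := ENNReal.toReal_nonneg (a := holderNorm τ p.2.2.1 φ)
        have : (0 : ℝ) ≤ (n : ℝ) ^ p.2.2.2.2.2.2.1 := by positivity
        have hc' : 0 < c' := hc.trans_le hcc
        gcongr)
      (by
        rintro ⟨lam, K, η, N, δ, A, γ, Cτ⟩ ⟨hlam, hK, hη, hη1, hδ, hA, hγ, hγ1, hCτ⟩
        obtain ⟨B, C, hB0, hC0, hC⟩ := exists_hasExponentialDecay.{u} (lam₀ := (1 + lam) / 2)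
          (K₀ := K + 1) (η₀ := η / 2) (δ₀ := δ / 2) (A₀ := A / 2) (γ₀ := γ / 2)
          (C₀ := Cτ + 1) (by linarith) (by linarith) (by linarith) (by linarith) (by linarith)
          (by linarith) (by linarith) N
        refine ⟨max C B⁻¹, lt_max_of_lt_left hC0, ?_⟩
        rw [nhds_prod_eq, nhds_prod_eq, nhds_prod_eq, nhds_prod_eq, nhds_prod_eq, nhds_prod_eq,
          nhds_prod_eq]
        filter_upwards [prod_mem_prod (Ioi_mem_nhds (by linarith : (1 + lam) / 2 < lam))
          (prod_mem_prod (Iio_mem_nhds (by linarith : K < K + 1))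
          (prod_mem_prod (Ioi_mem_nhds (by linarith : η / 2 < η))
          (prod_mem_prod (mem_nhds_discrete.2 rfl : {N} ∈ 𝓝 N)
          (prod_mem_prod (Ioi_mem_nhds (by linarith : δ / 2 < δ))
          (prod_mem_prod (Ioi_mem_nhds (by linarith : A / 2 < A))
          (prod_mem_prod (Ioi_mem_nhds (by linarith : γ / 2 < γ))
            (Iio_mem_nhds (by linarith : Cτ < Cτ + 1))))))))]
        rintro ⟨lam', K', η', N', δ', A', γ', Cτ'⟩ ⟨h1, h2, h3, h4, h5, h6, h6', h7⟩ hp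
        have hγ' : γ' ≤ 1 := hp.2.2.2.2.2.2.2.1
        simp only [mem_Ioi, mem_Iio, mem_singleton_iff] at h1 h2 h3 h4 h5 h6 h6' h7
        subst h4
        intro Y _ _ m F α τ I hF hτ hI hIN ht φ hφ hφn h0 n
        obtain ⟨k1, k2⟩ := hC _ _ _ _ _ _ _ h1.le h2.le h3.le h5.le h6.le h6'.le hγ' h7.le
          Y m F α τ I hF hτ hI hIN ht φ hφ hφn h0 n
        refine ⟨k1, k2.trans ?_⟩
        have hBC : (max C B⁻¹)⁻¹ ≤ B := inv_le_of_inv_le₀ hB0 (le_max_right _ _)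
        have : (0 : ℝ) ≤ (n : ℝ) ^ γ' := by positivity
        have := ENNReal.toReal_nonneg (a := holderNorm τ η' φ)
        gcongr
        exact le_max_left _ _)
    refine ⟨fun p => (C p)⁻¹, C, hCc.inv₀ fun p hp => (hC0 p hp).ne',
      fun p hp => inv_pos.2 (hC0 p hp), hCc, hC0, ?_⟩
    intro Y _ _ m F α lam K η τ I δ A γ Cτ hF hτ hI hA hγ hγ1 ht φ hφ hφn h0 n
    have hprob := hF.isProbabilityMeasure
    have hCτ : 0 < Cτ := pos_of_tail_le hτ.pos (x := Real.exp (-A)) (Real.exp_pos _).le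
      (by simpa using ht 1 one_pos)
    exact hC (lam, K, η, I.sup id, δ, A, γ, Cτ)
      ⟨hF.one_lt_lam, hF.K_pos, hF.η_pos, hF.η_le_one, hI.δ_pos, hA, hγ, hγ1, hCτ⟩
      Y m F α τ I hF hτ hI rfl ht φ hφ hφn h0 n
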